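/- **Setting.** Consider QCD Feynman graphs, built from three types of (unoriented) edges, $e_1$ (quark), $e_2$ (ghost), $e_3$ (gluon), and five types of vertices: $v_1$ (two quark lines, one gluon line), $v_2$ (two ghost lines, one gluon line), $v_3$ (three gluon lines), $v_4$ (four gluon lines) and the mass vertex $v_5$ (two quark lines). Let $R=\{e_1,e_2,e_3,v_1,\dots,v_5\}$ and let $N_k(r)$ be the number of lines of type $k$ at $r\in R$, where $N_k(e_i)=2\delta_{ik}$. A 1PI graph is a connected graph, not a tree, that no cut of a single internal edge disconnects; it has residue $r\in R$ if it has exactly $N_k(r)$ external lines of each type $k$. A graph with two external quark lines is counted twice, once with residue $e_1$ and once (dressed with a bullet) with residue $v_5$. Let $H_{CK}$ be the free commutative $\mathbb C$-algebra on the isomorphism classes of 1PI graphs with residue in $R$, with counit $\epsilon(\Gamma)=0$ and coproduct $$\Delta(\Gamma)=\Gamma\otimes 1+1\otimes\Gamma+\sum_{\emptyset\ne\gamma\subsetneq\Gamma}\gamma\otimes\Gamma/\gamma ,$$ the sum being over disjoint unions $\gamma$ of 1PI subgraphs with (a choice of) residue in $R$; $\Gamma/\gamma$ is obtained by contracting each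 component of $\gamma$ to its residue. $H_{CK}$ is $\mathbb Z^5$-graded by $d_j(\Gamma)=\#\{\text{vertices } v_j \text{ in } \Gamma\}-\delta_{v_j,\mathrm{res}(\Gamma)}$; let $p_n$ be the projection onto degree $n=(n_1,\dots,n_5)\in\mathbb Z^5$. The Green's functions are the formal series $$G^{e_i}=1-\sum_{\mathrm{res}(\Gamma)=e_i}\frac{\Gamma}{\mathrm{Sym}(\Gamma)},\qquad G^{v_j}=1+\sum_{\mathrm{res}(\Gamma)=v_j}\frac{\Gamma}{\mathrm{Sym}(\Gamma)},$$ where $1/\mathrm{Sym}(\Gamma)=\prod_k N_k(\mathrm{res}\,\Gamma)!\,/\,|\mathrm{Aut}(\Gamma)|$, automorphisms being allowed to permute the external lines (equivalently, one sums, over the inequivalent labellings of the external lines, the inverse orders of the automorphism groups fixing these lines). Put $Y_{v_j}=G^{v_j}\prod_{i}(G^{e_i})^{-N_i(v_j)/2}$, with powers defined by the binomial series, and let $H\subset H_{CK}$ be the subalgebra generated by all $p_n(G^r)$, $r\in R$, $n\in\mathbb Z^5$. Let $\mathcal A$ be the free graded-commutative $\mathbb C$-algebra on the derivatives $\partial^\alpha\phi$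 of the components $\phi$ of the fields $A$, $\psi,\bar\psi$, $\omega,\bar\omega$, $h$ on four-dimensional spacetime (Grassmann degrees $0$, $1,-1$, $1,-1$, $0$), with derivations $\partial_\mu$. Let $\mathrm{Loc}$ be the algebra of local functionals, i.e. the graded-commutative algebra generated by the integrals $\int P\,d\mu$, $P\in\mathcal A$, where integrals of total derivatives vanish. Let $\mathcal F=\mathrm{Loc}\otimes\mathbb C[[\lambda_1,\dots,\lambda_5]]$. Write $\lambda^n=\lambda_1^{n_1}\cdots\lambda_5^{n_5}$, and $\mathcal F\,\hat\otimes\,B=\mathrm{Loc}\otimes B[[\lambda_1,\dots,\lambda_5]]$ for a commutative algebra $B$; similarly for $\mathcal A$ instead of $\mathrm{Loc}$. **Theorem.** The coproduct and counit of $H_{CK}$ restrict to $H$ and make $H$ a Hopf algebra. All the elements $p_n(Y_{v_j})$ and $p_n(\sqrt{G^{e_i}})$ lie in $H$, with $p_n(Y_{v_j})=0$ unless $\lambda_j\lambda^n$ has non-negative exponents and $p_n(\sqrt{G^{e_i}})=0$ unless $n\ge 0$. There are $\lambda$-adically continuous algebra maps $\rho:\mathcal A\otimes\mathbb C[[\lambda]]\to(\mathcal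 A\otimes\mathbb C[[\lambda]])\,\hat\otimes\,H$ and $\rho:\mathcal F\to\mathcal F\,\hat\otimes\,H$, compatible with $P\mapsto\int P\,d\mu$, that make both algebras comodule algebras over $H$, i.e. $(\rho\otimes 1)\rho=(1\otimes\Delta)\rho$ and $(1\otimes\epsilon)\rho=\mathrm{id}$, such that $$\rho(\lambda_j)=\sum_{n\in\mathbb Z^5}\lambda_j\lambda^n\otimes p_n(Y_{v_j})\quad(j=1,\dots,5),\qquad \rho(\phi)=\sum_{n\in\mathbb Z^5}\phi\,\lambda^n\otimes p_n\big(\sqrt{G^{e_i}}\big)$$ for each component $\phi$ of a field whose edge is $e_i$ (that is, $\psi,\bar\psi$ for $e_1$; $\omega,\bar\omega$ for $e_2$; $A$ for $e_3$), $\rho(h)=h\otimes1$, and $\rho$ commutes with the partial derivatives: $\rho\circ\partial_\mu=(\partial_\mu\otimes 1)\circ\rho$. -/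

import Mathlib

open scoped TensorProduct

noncomputable section

namespace QCD

/-! ## Edge types, vertex types and Feynman graphs -/

/-- The three types of edges: `0` is the quark edge `e₁` (straight), `1` the ghost edge `e₂`
(dotted), `2` the gluon edge `e₃` (curly). -/
abbrev EdgeType := Fin 3

/-- The five types of vertices: `0` is the quark-gluon vertex `v₁`, `1` the ghost-gluon vertex
`v₂`, `2` the cubic gluon vertex `v₃`, `3` the quartic gluon vertex `v₄`, and `4` the bivalent
quark mass vertex `v₅`. -/
abbrev VertexType := Fin 5

/-- `R = R_E ∪ R_V`. -/
abbrev Residue := EdgeType ⊕ VertexType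

/-- Number of lines of type `k` attached to a vertex of type `j`. -/
def vertexLegs (j : VertexType) (k : EdgeType) : ℕ :=
  (![![2, 0, 1], ![0, 2, 1], ![0, 0, 3], ![0, 0, 4], ![2, 0, 0]] : Fin 5 → Fin 3 → ℕ) j k

/-- `N_k(r)`, the number of lines of type `k` attached to `r ∈ R`; an edge `e_i` has two lines,
both of type `i`. -/
def legs : Residue → EdgeType → ℕ
  | Sum.inl i, k => if k = i then 2 else 0
  | Sum.inr j, k => vertexLegs j k

/-- A (finite, not necessarily connected) Feynman graph, given by its vertices and half-edges.
A half-edge `h` is attached to the vertex `base h`; it is joined to the half-edge `twin h` to form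
an internal edge if `twin h ≠ h`, and it is an external line if `twin h = h`. -/
structure FeynmanGraph : Type 1 where
  V : Type
  HE : Type
  finV : Finite V
  finHE : Finite HE
  vtype : V → VertexType
  etype : HE → EdgeType
  base : HE → V
  twin : HE → HE
  twin_twin : ∀ h, twin (twin h) = h
  etype_twin : ∀ h, etype (twin h) = etype h
  valence : ∀ v k, Nat.card {h // base h = v ∧ etype h = k} = vertexLegs (vtype v) k

attribute [instance] FeynmanGraph.finV FeynmanGraph.finHE

namespace FeynmanGraph

variable (Γ : FeynmanGraph)

/-- Number of external lines of type `k`. -/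
def extCount (k : EdgeType) : ℕ := Nat.card {h // Γ.twin h = h ∧ Γ.etype h = k}

/-- Two vertices are adjacent through an edge one of whose halves lies in `S`. -/
def Adj (S : Set Γ.HE) (v w : Γ.V) : Prop := ∃ h ∈ S, Γ.base h = v ∧ Γ.base (Γ.twin h) = w

/-- Being in the same connected component of the graph with all vertices of `Γ`, whose internal
edges are those of `S`. -/
def compSetoid (S : Set Γ.HE) : Setoid Γ.V := Relation.EqvGen.setoid (Γ.Adj S)

/-- One-particle irreducible: connected, still connected when any one internal edge is cut, and
not a tree. (A connected graph without an edge that disconnects it is a tree exactly if it has no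
internal edge.) -/
structure IsOnePI : Prop where
  connected : Nonempty Γ.V ∧ ∀ v w, Γ.compSetoid Set.univ v w
  cut : ∀ h, Γ.twin h ≠ h → ∀ v w, Γ.compSetoid {x | x ≠ h ∧ x ≠ Γ.twin h} v w
  not_tree : ∃ h, Γ.twin h ≠ h

/-- Isomorphisms of Feynman graphs. External lines may be permuted. -/
structure Iso (Γ Γ' : FeynmanGraph) where
  onV : Γ.V ≃ Γ'.V
  onHE : Γ.HE ≃ Γ'.HE
  vtype_eq : ∀ v, Γ'.vtype (onV v) = Γ.vtype v
  etype_eq : ∀ h, Γ'.etype (onHE h) = Γ.etype h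
  base_eq : ∀ h, Γ'.base (onHE h) = onV (Γ.base h)
  twin_eq : ∀ h, Γ'.twin (onHE h) = onHE (Γ.twin h)

def Iso.refl : Iso Γ Γ := ⟨.refl _, .refl _, by simp, by simp, by simp, by simp⟩

variable {Γ}

def Iso.symm {Γ' : FeynmanGraph} (f : Iso Γ Γ') : Iso Γ' Γ where
  onV := f.onV.symm
  onHE := f.onHE.symm
  vtype_eq v := by rw [← f.vtype_eq]; simp
  etype_eq h := by rw [← f.etype_eq]; simp
  base_eq h := by
    apply f.onV.injective
    rw [← f.base_eq]; simp
  twin_eq h := by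
    apply f.onHE.injective
    rw [← f.twin_eq]; simp

def Iso.trans {Γ' Γ'' : FeynmanGraph} (f : Iso Γ Γ') (g : Iso Γ' Γ'') : Iso Γ Γ'' where
  onV := f.onV.trans g.onV
  onHE := f.onHE.trans g.onHE
  vtype_eq v := by simp [g.vtype_eq, f.vtype_eq]
  etype_eq h := by simp [g.etype_eq, f.etype_eq]
  base_eq h := by simp [g.base_eq, f.base_eq]
  twin_eq h := by simp [g.twin_eq, f.twin_eq]

variable (Γ)

/-! ### Subgraphs and contraction -/

/-- The set of components of the graph with all vertices of `Γ` and the internal edges in `S`. -/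
abbrev Comp (S : Set Γ.HE) : Type := Quotient (Γ.compSetoid S)

/-- The component of a half-edge. -/
def compOf (S : Set Γ.HE) (h : Γ.HE) : Γ.Comp S := Quotient.mk _ (Γ.base h)

variable {Γ}

theorem compOf_twin {S : Set Γ.HE} {h : Γ.HE} (hh : h ∈ S) :
    Γ.compOf S (Γ.twin h) = Γ.compOf S h :=
  Quotient.sound (Relation.EqvGen.symm _ _ (Relation.EqvGen.rel _ _ ⟨h, hh, rfl, rfl⟩))

open Classical in
/-- The connected component `c` of the subgraph with internal edges `S`, as a Feynman graph:
every half-edge of `Γ` at a vertex of `c` that does not belong to an edge in `S` becomes an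
external line. -/
def component (S : Set Γ.HE) (hS : ∀ h ∈ S, Γ.twin h ∈ S) (c : Γ.Comp S) : FeynmanGraph where
  V := {v : Γ.V // (Quotient.mk _ v : Γ.Comp S) = c}
  HE := {h : Γ.HE // Γ.compOf S h = c}
  finV := inferInstance
  finHE := inferInstance
  vtype v := Γ.vtype v.1
  etype h := Γ.etype h.1
  base h := ⟨Γ.base h.1, h.2⟩
  twin h := if hh : h.1 ∈ S then ⟨Γ.twin h.1, (compOf_twin hh).trans h.2⟩ else h
  twin_twin h := by
    by_cases hh : h.1 ∈ S
    · simp [hh, hS _ hh, Γ.twin_twin]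
    · simp [hh]
  etype_twin h := by
    by_cases hh : h.1 ∈ S
    · simp [hh, Γ.etype_twin]
    · simp [hh]
  valence v k := by
    rw [← Γ.valence v.1 k]
    refine Nat.card_congr ⟨fun h => ⟨h.1.1, ?_, h.2.2⟩,
      fun h => ⟨⟨h.1, ?_⟩, ?_, h.2.2⟩, fun h => rfl, fun h => rfl⟩
    · exact congrArg Subtype.val h.2.1
    · unfold compOf; rw [h.2.1]; exact v.2
    · exact Subtype.ext h.2.1

variable (Γ)

/-- A disjoint union `γ ⊆ Γ` of 1PI subgraphs with residue in `R`, together with the choice of a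
residue for each of them (a choice only for a subgraph with two external quark lines, which is
dressed with a bullet if its residue is the mass vertex). It is encoded by the set `S` of
half-edges belonging to internal edges of `γ`. The vertices of `Γ` outside `γ` are the components
without an edge in `S`; they keep their own type as residue. -/
structure Subgraph where
  S : Set Γ.HE
  internal : ∀ h ∈ S, Γ.twin h ≠ h
  twin_mem : ∀ h ∈ S, Γ.twin h ∈ S
  res : Γ.Comp S → Residue
  res_trivial : ∀ v, (∀ h, Γ.base h = v → h ∉ S) → res (Quotient.mk _ v) = Sum.inr (Γ.vtype v)
  onePI : ∀ h ∈ S, (component S twin_mem (Γ.compOf S h)).IsOnePI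
  legs_eq : ∀ c k, (component S twin_mem c).extCount k = legs (res c) k

instance : Finite Γ.Subgraph :=
  Finite.of_injective (β := Σ S : Set Γ.HE, (Γ.Comp S → Residue)) (fun f => ⟨f.S, f.res⟩) (by
    rintro ⟨S, _, _, r, _, _, _⟩ ⟨S', _, _, r', _, _, _⟩ h
    obtain ⟨h1, h2⟩ := Sigma.mk.inj h
    dsimp only at h1 h2
    subst h1
    obtain rfl := eq_of_heq h2
    rfl)

end FeynmanGraph

/-! ### First return maps of permutations -/

section FirstReturn

variable {α : Type} [Finite α]

theorem exists_return (p : Equiv.Perm α) (B : Set α) (b : B) :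
    ∃ n, 0 < n ∧ (p ^ n) (b : α) ∈ B :=
  ⟨orderOf p, orderOf_pos p, by rw [pow_orderOf_eq_one]; exact b.2⟩

open Classical in
/-- The first point of `B` in the sequence `p b, p (p b), …`. -/
def firstReturn (p : Equiv.Perm α) (B : Set α) (b : B) : B :=
  ⟨(p ^ Nat.find (exists_return p B b)) b, (Nat.find_spec (exists_return p B b)).2⟩

open Classical in
theorem firstReturn_involutive (σ τ : Equiv.Perm α) (hσ : ∀ x, σ (σ x) = x)
    (hτ : ∀ x, τ (τ x) = x) (B : Set α) (hB : ∀ x ∈ B, τ x = x) (b : B) :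
    firstReturn (σ * τ) B (firstReturn (σ * τ) B b) = b := by
  set p := σ * τ with hp
  have hB' : ∀ x, τ x ∈ B → x ∈ B := fun x hx => by
    have h1 := hB _ hx
    rw [hτ] at h1
    rwa [← h1] at hx
  have key : ∀ n x, (p ^ n) (τ ((p ^ n) x)) = τ x := by
    intro n
    induction n with
    | zero => simp
    | succ n ih =>
      intro x
      rw [pow_succ' p n]
      have h1 : (p * p ^ n) x = p ((p ^ n) x) := rfl
      rw [h1, ← pow_succ', pow_succ]
      have h2 : (p ^ n * p) (τ (p ((p ^ n) x))) = (p ^ n) (p (τ (p ((p ^ n) x)))) := rfl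
      rw [h2]
      have h3 : p (τ (p ((p ^ n) x))) = τ ((p ^ n) x) := by
        simp [hp, hτ, hσ]
      rw [h3, ih]
  have hsub : ∀ (n j : ℕ) (x : α), j ≤ n → (p ^ j) (τ ((p ^ n) x)) = τ ((p ^ (n - j)) x) := by
    intro n j x hj
    conv_lhs => rw [← Nat.add_sub_cancel' hj, pow_add]
    exact key j _
  set n := Nat.find (exists_return p B b) with hn
  have hns := Nat.find_spec (exists_return p B b)
  have hy : ((firstReturn p B b : B) : α) = (p ^ n) b := rfl
  have hyB : τ ((p ^ n) (b : α)) = (p ^ n) b := hB _ hns.2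
  have hfind : Nat.find (exists_return p B (firstReturn p B b)) = n := by
    rw [Nat.find_eq_iff]
    refine ⟨⟨hns.1, ?_⟩, ?_⟩
    · rw [hy, ← hyB, key, hB _ b.2]; exact b.2
    · rintro j hj ⟨hj0, hjB⟩
      rw [hy, ← hyB, hsub n j _ hj.le] at hjB
      exact Nat.find_min (exists_return p B b) (m := n - j) (by omega) ⟨by omega, hB' _ hjB⟩
  apply Subtype.ext
  change (p ^ Nat.find (exists_return p B (firstReturn p B b))) ((firstReturn p B b : B) : α) = b
  rw [hfind, hy, ← hyB, key, hB _ b.2]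

end FirstReturn

namespace FeynmanGraph

namespace Subgraph

variable {Γ : FeynmanGraph} (γ : Γ.Subgraph)

/-- `h` and `h'` are the two external lines of a component that is to be contracted to an edge. -/
def Mate (h h' : Γ.HE) : Prop :=
  h ∉ γ.S ∧ h' ∉ γ.S ∧ h ≠ h' ∧ Γ.compOf γ.S h = Γ.compOf γ.S h' ∧
    (γ.res (Γ.compOf γ.S h)).isLeft

variable {γ}

theorem Mate.symm {h h' : Γ.HE} (m : γ.Mate h h') : γ.Mate h' h :=
  ⟨m.2.1, m.1, m.2.2.1.symm, m.2.2.2.1.symm, m.2.2.2.1 ▸ m.2.2.2.2⟩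

theorem etype_of_isLeft {h : Γ.HE} {i : EdgeType} (hS : h ∉ γ.S)
    (hi : γ.res (Γ.compOf γ.S h) = Sum.inl i) : Γ.etype h = i := by
  by_contra hne
  have h1 := γ.legs_eq (Γ.compOf γ.S h) (Γ.etype h)
  rw [hi] at h1
  simp only [legs, hne, if_false] at h1
  have h2 := Finite.card_eq_zero_iff.mp h1
  refine h2.false ⟨⟨h, rfl⟩, ?_, rfl⟩
  simp [component, hS]

theorem Mate.etype_eq {h h' : Γ.HE} (m : γ.Mate h h') : Γ.etype h = Γ.etype h' := by
  obtain ⟨i, hi⟩ := Sum.isLeft_iff.mp m.2.2.2.2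
  rw [etype_of_isLeft m.1 hi, etype_of_isLeft m.2.1 (m.2.2.2.1 ▸ hi)]

theorem Mate.unique {h a b : Γ.HE} (ma : γ.Mate h a) (mb : γ.Mate h b) : a = b := by
  by_contra hab
  obtain ⟨i, hi⟩ := Sum.isLeft_iff.mp ma.2.2.2.2
  have h1 := γ.legs_eq (Γ.compOf γ.S h) i
  rw [hi] at h1
  simp only [legs, if_true] at h1
  let mk : ∀ x : Γ.HE, x ∉ γ.S → Γ.compOf γ.S h = Γ.compOf γ.S x →
      {x : (component γ.S γ.twin_mem (Γ.compOf γ.S h)).HE //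
        (component γ.S γ.twin_mem (Γ.compOf γ.S h)).twin x = x ∧
        (component γ.S γ.twin_mem (Γ.compOf γ.S h)).etype x = i} :=
    fun x hx hc => ⟨⟨x, hc.symm⟩, by simp [component, hx],
      etype_of_isLeft (γ := γ) (h := x) hx (hc ▸ hi)⟩
  obtain ⟨x, y, -, hxy⟩ := Nat.card_eq_two_iff.mp h1
  have hm : ∀ z, z = x ∨ z = y := fun z => by
    have : z ∈ ({x, y} : Set _) := hxy ▸ Set.mem_univ z
    simpa using this
  have e1 := hm (mk h ma.1 rfl)
  have e2 := hm (mk a ma.2.1 ma.2.2.2.1)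
  have e3 := hm (mk b mb.2.1 mb.2.2.2.1)
  have n1 := ma.2.2.1
  have n2 := mb.2.2.1
  rcases e1 with e1 | e1 <;> rcases e2 with e2 | e2 <;> rcases e3 with e3 | e3
  all_goals first
    | exact n1 (congrArg (fun z => z.1.1) (e1.trans e2.symm))
    | exact n2 (congrArg (fun z => z.1.1) (e1.trans e3.symm))
    | exact hab (congrArg (fun z => z.1.1) (e2.trans e3.symm))

variable (γ)

open Classical in
/-- Passing through a component that is contracted to an edge, from one of its two external lines
to the other; all other half-edges are fixed. -/
def pass (h : Γ.HE) : Γ.HE := if hx : ∃ h', γ.Mate h h' then hx.choose else h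

theorem pass_spec (h : Γ.HE) : γ.Mate h (γ.pass h) ∨ γ.pass h = h := by
  unfold pass
  split_ifs with hx
  · exact Or.inl hx.choose_spec
  · exact Or.inr rfl

theorem pass_pass (h : Γ.HE) : γ.pass (γ.pass h) = h := by
  rcases γ.pass_spec h with m | e
  · rcases γ.pass_spec (γ.pass h) with m' | e'
    · exact m'.unique m.symm
    · have : ∃ h', γ.Mate (γ.pass h) h' := ⟨h, m.symm⟩
      have hc : γ.pass (γ.pass h) = this.choose := by
        conv_lhs => unfold pass
        exact dif_pos this
      rw [hc]
      exact this.choose_spec.unique m.symm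
  · rw [e, e]

theorem etype_pass (h : Γ.HE) : Γ.etype (γ.pass h) = Γ.etype h := by
  rcases γ.pass_spec h with m | e
  · exact m.etype_eq.symm
  · rw [e]

def passPerm : Equiv.Perm Γ.HE := ⟨γ.pass, γ.pass, γ.pass_pass, γ.pass_pass⟩

def twinPerm (Γ : FeynmanGraph) : Equiv.Perm Γ.HE := ⟨Γ.twin, Γ.twin, Γ.twin_twin, Γ.twin_twin⟩

/-- The half-edges of `Γ/γ`: those outside `γ` that are attached to a component with a vertex as
residue. -/
def keep : Set Γ.HE := {h | h ∉ γ.S ∧ (γ.res (Γ.compOf γ.S h)).isRight}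

theorem pass_of_keep (h : Γ.HE) (hh : h ∈ γ.keep) : γ.passPerm h = h := by
  rcases γ.pass_spec h with m | e
  · have h1 := m.2.2.2.2
    have h2 := hh.2
    rw [← Sum.not_isLeft] at h2
    simp [h1] at h2
  · exact e

theorem etype_pow (n : ℕ) (h : Γ.HE) :
    Γ.etype (((twinPerm Γ * γ.passPerm) ^ n) h) = Γ.etype h := by
  induction n with
  | zero => rfl
  | succ n ih =>
    rw [pow_succ']
    exact (Γ.etype_twin _).trans ((γ.etype_pass _).trans ih)

theorem getRight_eq {r : Residue} (h : r.isRight) : Sum.inr (r.getRight h) = r :=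
  Sum.inr_getRight r h

/-- The contracted graph `Γ/γ`. Each component of `γ` whose residue is a vertex (and each vertex
outside `γ`) gives a vertex. Each component whose residue is an edge is removed and the two lines
attached to it are merged: the partner of a half-edge `h` of `Γ/γ` is found by going along the edge
from `h`, then passing through the components contracted to edges that one meets, until one arrives
at a half-edge of `Γ/γ` again. -/
def contract : FeynmanGraph where
  V := {c : Γ.Comp γ.S // (γ.res c).isRight}
  HE := γ.keep
  finV := inferInstance
  finHE := inferInstance
  vtype c := (γ.res c.1).getRight c.2
  etype h := Γ.etype h.1
  base h := ⟨Γ.compOf γ.S h.1, h.2.2⟩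
  twin h := firstReturn (twinPerm Γ * γ.passPerm) γ.keep h
  twin_twin h := firstReturn_involutive _ _ Γ.twin_twin γ.pass_pass _ γ.pass_of_keep h
  etype_twin h := γ.etype_pow _ _
  valence c k := by
    have h1 := γ.legs_eq c.1 k
    rw [← getRight_eq c.2] at h1
    refine Eq.trans ?_ h1
    refine Nat.card_congr ⟨fun h => ⟨⟨h.1.1, congrArg Subtype.val h.2.1⟩, ?_, h.2.2⟩,
      fun h => ⟨⟨h.1.1, ?_, ?_⟩, Subtype.ext h.1.2, h.2.2⟩, fun h => rfl, fun h => rfl⟩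
    · have := h.1.2.1
      simp [component, this]
    · intro hS
      have h2 := h.2.1
      simp only [component, hS, dif_pos] at h2
      exact γ.internal _ hS (congrArg Subtype.val h2)
    · rw [h.1.2]; exact c.2

end Subgraph

end FeynmanGraph

/-! ## The Hopf algebra of Feynman graphs -/

/-- A 1PI Feynman graph with residue in `R`: its external lines are those of `res`. A graph with
two external quark lines occurs twice, with residue `e₁` and (dressed with a bullet) with residue
`v₅`. -/
structure DressedGraph : Type 1 where
  graph : FeynmanGraph
  res : Residue
  onePI : graph.IsOnePI
  legs_eq : ∀ k, graph.extCount k = legs res k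

instance dressedSetoid : Setoid DressedGraph where
  r a b := Nonempty (a.graph.Iso b.graph) ∧ a.res = b.res
  iseqv :=
    { refl := fun _ => ⟨⟨FeynmanGraph.Iso.refl _⟩, rfl⟩
      symm := fun h => ⟨h.1.map FeynmanGraph.Iso.symm, h.2.symm⟩
      trans := fun h h' => ⟨⟨h.1.some.trans h'.1.some⟩, h.2.trans h'.2⟩ }

/-- Isomorphism classes of 1PI Feynman graphs with residue in `R`. -/
def GraphClass : Type 1 := Quotient dressedSetoid

namespace GraphClass

/-- A representative of an isomorphism class. -/
def rep (g : GraphClass) : DressedGraph := Quotient.out g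

def res (g : GraphClass) : Residue := g.rep.res

/-- The multidegree: `d_j(Γ)` is the number of vertices `v_j` in `Γ`, minus one if `v_j` is the
residue of `Γ`. -/
def multideg (g : GraphClass) (j : Fin 5) : ℤ :=
  (Nat.card {v // g.rep.graph.vtype v = j} : ℤ) - if g.res = Sum.inr j then 1 else 0

/-- The symmetry factor, for external lines that are held fixed: `1 / Sym(Γ)` is the sum, over the
inequivalent labellings of the external lines of `Γ` by the lines of its residue (respecting
their type), of `1 / |Aut|`, where `Aut` is the group of automorphisms preserving the labelling.
By orbit counting it equals `∏ₖ Nₖ(res Γ)! / |Aut Γ|`, where automorphisms in `Aut Γ` may permute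
the external lines. -/
def sym (g : GraphClass) : ℂ :=
  (Nat.card (g.rep.graph.Iso g.rep.graph) : ℂ) / ∏ k, (Nat.factorial (legs g.res k) : ℂ)

end GraphClass

/-- `H_CK`: the free commutative algebra on the 1PI Feynman graphs with residue in `R`. -/
abbrev HCK : Type 1 := MvPolynomial GraphClass ℂ

/-- Formal (infinite) linear combinations of monomials in 1PI graphs. -/
abbrev HCKHat : Type 1 := MvPowerSeries GraphClass ℂ

open Classical in
/-- The generator of `H_CK` given by a Feynman graph `Γ` with residue `r`. (A contraction
`Γ/γ` of a 1PI graph `Γ` by `γ ⊊ Γ` is 1PI, with the external lines of `Γ`.) -/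
def gen (Γ : FeynmanGraph) (r : Residue) : HCK :=
  if h : Γ.IsOnePI ∧ ∀ k, Γ.extCount k = legs r k then
    MvPolynomial.X (Quotient.mk _ ⟨Γ, r, h.1, h.2⟩ : GraphClass) else 0

/-- A subgraph `γ` as an element of `H_CK`: the product of its connected components. -/
def FeynmanGraph.Subgraph.toHCK {Γ : FeynmanGraph} (γ : Γ.Subgraph) : HCK :=
  ∏ᶠ c : {c : Γ.Comp γ.S // ∃ h ∈ γ.S, Γ.compOf γ.S h = c},
    gen (FeynmanGraph.component γ.S γ.twin_mem c.1) (γ.res c.1)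

/-- `Δ(Γ) = Γ ⊗ 1 + 1 ⊗ Γ + ∑ γ ⊗ Γ/γ`, over nonempty `γ ⊊ Γ`. -/
def coproductGen (g : GraphClass) : HCK ⊗[ℂ] HCK :=
  MvPolynomial.X g ⊗ₜ 1 + 1 ⊗ₜ MvPolynomial.X g +
    ∑ᶠ γ : {γ : g.rep.graph.Subgraph // γ.S ≠ ∅ ∧ γ.S ≠ {h | g.rep.graph.twin h ≠ h}},
      γ.1.toHCK ⊗ₜ gen γ.1.contract g.res

/-- The coproduct of `H_CK`. -/
def comulCK : HCK →ₐ[ℂ] HCK ⊗[ℂ] HCK := MvPolynomial.aeval coproductGen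

/-- The counit of `H_CK`. -/
def counitCK : HCK →ₐ[ℂ] ℂ := MvPolynomial.aeval (fun _ => 0)

/-- Multidegree of a monomial in graphs. -/
def monomialDeg (m : GraphClass →₀ ℕ) (j : Fin 5) : ℤ := m.sum fun g k => k * g.multideg j

open Classical in
/-- `p_n`: the part of multidegree `n ∈ ℤ⁵`. -/
def proj (n : Fin 5 → ℤ) (F : HCKHat) : HCKHat :=
  fun m => if monomialDeg m = n then MvPowerSeries.coeff m F else 0

open Classical in
/-- The 1PI Green's functions: `G^{e_i} = 1 - ∑ Γ / Sym(Γ)` and `G^{v_j} = 1 + ∑ Γ / Sym(Γ)`,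
over the 1PI graphs with residue `e_i`, resp. `v_j`. -/
def green (r : Residue) : HCKHat := fun m =>
  if m = 0 then 1
  else if h : ∃ g : GraphClass, g.res = r ∧ m = Finsupp.single g 1 then
    (if r.isLeft then -1 else 1) / h.choose.sym
  else 0

/-- Real powers of a formal series with constant term `1`, by the binomial series. -/
def rpow (F : HCKHat) (α : ℝ) : HCKHat :=
  (PowerSeries.binomialSeries ℂ α).subst (F - 1)

/-- `Y_{v_j} = G^{v_j} / ∏ᵢ (G^{e_i})^{Nᵢ(v_j)/2}`. -/
def Yv (j : VertexType) : HCKHat :=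
  green (Sum.inr j) * ∏ i : EdgeType, rpow (green (Sum.inl i)) (-(legs (Sum.inr j) i / 2 : ℝ))

/-- `√(G^{e_i})`. -/
def sqrtG (i : EdgeType) : HCKHat := rpow (green (Sum.inl i)) (1 / 2)

/-- `H`: the subalgebra of `H_CK` generated by the Green's functions in each multidegree. -/
def greenAlg : Subalgebra ℂ HCK :=
  Algebra.adjoin ℂ {x | ∃ (r : Residue) (n : Fin 5 → ℤ), (x : HCKHat) = proj n (green r)}

/-- The counit of `H`. -/
def counitH : greenAlg →ₐ[ℂ] ℂ := counitCK.comp greenAlg.val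

/-- The axioms of a Hopf algebra, for a commutative algebra `B` with coproduct `Δ`, counit `ε` and
antipode `S`. -/
structure IsHopfAlgebra {B : Type*} [CommRing B] [Algebra ℂ B] (Δ : B →ₐ[ℂ] B ⊗[ℂ] B)
    (ε : B →ₐ[ℂ] ℂ) (S : B →ₗ[ℂ] B) : Prop where
  coassoc : ∀ x, Algebra.TensorProduct.assoc ℂ ℂ ℂ B B B
    (Algebra.TensorProduct.map Δ (AlgHom.id ℂ B) (Δ x)) =
      Algebra.TensorProduct.map (AlgHom.id ℂ B) Δ (Δ x)
  counit_left : ∀ x, Algebra.TensorProduct.lid ℂ B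
    (Algebra.TensorProduct.map ε (AlgHom.id ℂ B) (Δ x)) = x
  counit_right : ∀ x, Algebra.TensorProduct.rid ℂ ℂ B
    (Algebra.TensorProduct.map (AlgHom.id ℂ B) ε (Δ x)) = x
  antipode_left : ∀ x, LinearMap.mul' ℂ B (TensorProduct.map S LinearMap.id (Δ x)) =
    algebraMap ℂ B (ε x)
  antipode_right : ∀ x, LinearMap.mul' ℂ B (TensorProduct.map LinearMap.id S (Δ x)) =
    algebraMap ℂ B (ε x)

/-! ## Fields and local functionals -/

/-- The components of the fields: the gluon field `A_μ^a`, the quark field `ψ` and its conjugate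
(with spinor and colour index), the ghost field `ω^a` and its conjugate, and the auxiliary field
`h^a`. -/
inductive Field : Type
  | A (μ : Fin 4) (a : Fin 8)
  | psi (s : Fin 4) (i : Fin 3)
  | psibar (s : Fin 4) (i : Fin 3)
  | omega (a : Fin 8)
  | omegabar (a : Fin 8)
  | h (a : Fin 8)

namespace Field

/-- The Grassmann degree. -/
def grassmann : Field → ℤ
  | A _ _ => 0
  | psi _ _ => 1
  | psibar _ _ => -1
  | omega _ => 1
  | omegabar _ => -1
  | h _ => 0

/-- The type of edge by which a field propagates; there is none for `h`. -/
def edge : Field → Option EdgeType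
  | A _ _ => some 2
  | psi _ _ => some 0
  | psibar _ _ => some 0
  | omega _ => some 1
  | omegabar _ => some 1
  | h _ => none

end Field

/-- A derivative `∂^α φ` of a component of a field, `α` a multi-index. -/
structure Jet : Type where
  field : Field
  order : Fin 4 →₀ ℕ

/-- The sign `(-1)^(p q)`. -/
def koszul (p q : ℤ) : ℂ := ((Int.negOnePow (p * q) : ℤ) : ℂ)

/-- Graded commutativity of the fields and their derivatives. -/
inductive DensityRel : FreeAlgebra ℂ Jet → FreeAlgebra ℂ Jet → Prop
  | comm (x y : Jet) : DensityRel (FreeAlgebra.ι ℂ x * FreeAlgebra.ι ℂ y)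
      (koszul x.field.grassmann y.field.grassmann • (FreeAlgebra.ι ℂ y * FreeAlgebra.ι ℂ x))

/-- The algebra of polynomials in the fields and their derivatives: the free graded-commutative
algebra on the symbols `∂^α φ`. -/
abbrev Density : Type := RingQuot DensityRel

/-- The symbol `∂^α φ` as an element of `Density`. -/
def Density.jet (x : Jet) : Density := RingQuot.mkAlgHom ℂ DensityRel (FreeAlgebra.ι ℂ x)

theorem Density.jet_comm (x y : Jet) : Density.jet x * Density.jet y =
    koszul x.field.grassmann y.field.grassmann • (Density.jet y * Density.jet x) := by
  have := RingQuot.mkAlgHom_rel ℂ (DensityRel.comm x y)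
  simpa [Density.jet] using this

/-- `∂_μ` applied to a symbol `∂^α φ`. -/
def Jet.succ (μ : Fin 4) (x : Jet) : Jet := ⟨x.field, x.order + Finsupp.single μ 1⟩

/-- The algebra map `a ↦ a + ε ∂_μ a` into the dual numbers over `Density`. -/
def Density.dual (μ : Fin 4) : Density →ₐ[ℂ] TrivSqZeroExt Density Density :=
  RingQuot.liftAlgHom ℂ ⟨FreeAlgebra.lift ℂ fun x : Jet =>
    TrivSqZeroExt.inl (Density.jet x) + TrivSqZeroExt.inr (Density.jet (x.succ μ)), by
      rintro _ _ ⟨x, y⟩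
      have e1 := Density.jet_comm x y
      have e2 := Density.jet_comm x (y.succ μ)
      have e3 := Density.jet_comm (x.succ μ) y
      simp only [Jet.succ] at e2 e3
      ext
      · simp [e1]
      · simp [Jet.succ, e2, e3, add_comm]⟩

/-- The derivation `∂_μ` of `Density`, with `∂_μ (∂^α φ) = ∂^(α + e_μ) φ`. -/
def Density.deriv (μ : Fin 4) : Density →ₗ[ℂ] Density :=
  (TrivSqZeroExt.sndHom Density Density).restrictScalars ℂ ∘ₗ (Density.dual μ).toLinearMap

theorem Density.deriv_jet (μ : Fin 4) (x : Jet) :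
    Density.deriv μ (Density.jet x) = Density.jet (x.succ μ) := by
  simp [Density.deriv, Density.dual, Density.jet]

theorem Density.dual_fst (μ : Fin 4) (a : Density) : (Density.dual μ a).fst = a := by
  have : (TrivSqZeroExt.fstHom ℂ Density Density).comp (Density.dual μ) = AlgHom.id ℂ _ := by
    apply RingQuot.ringQuot_ext'
    ext x
    simp [Density.dual, Density.jet]
  exact DFunLike.congr_fun this a

theorem Density.deriv_mul (μ : Fin 4) (a b : Density) :
    Density.deriv μ (a * b) = a * Density.deriv μ b + Density.deriv μ a * b := by
  simp [Density.deriv, TrivSqZeroExt.snd_mul, Density.dual_fst]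

/-- Integrated densities `∫ P dμ`: polynomials in the fields and their derivatives, modulo total
derivatives. -/
abbrev Integrals : Type := Density ⧸ (⨆ μ, LinearMap.range (Density.deriv μ))

/-- The integral of a monomial. -/
def Integrals.word (w : List Jet) : Integrals := Submodule.Quotient.mk (w.map Density.jet).prod

/-- Total Grassmann degree of a monomial. -/
def wordDegree (w : List Jet) : ℤ := (w.map fun x => x.field.grassmann).sum

/-- Graded commutativity of the product of integrals. -/
inductive LocRel : TensorAlgebra ℂ Integrals → TensorAlgebra ℂ Integrals → Prop
  | comm (w w' : List Jet) : LocRel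
      (TensorAlgebra.ι ℂ (Integrals.word w) * TensorAlgebra.ι ℂ (Integrals.word w'))
      (koszul (wordDegree w) (wordDegree w') •
        (TensorAlgebra.ι ℂ (Integrals.word w') * TensorAlgebra.ι ℂ (Integrals.word w)))

/-- The algebra of local functionals: (graded-commutative) polynomials in the integrals. -/
abbrev Loc : Type := RingQuot LocRel

/-- The local functional `∫ P dμ`. -/
def integral : Density →ₗ[ℂ] Loc :=
  (RingQuot.mkAlgHom ℂ LocRel).toLinearMap ∘ₗ TensorAlgebra.ι ℂ ∘ₗ Submodule.mkQ _

/-! ## Completed tensor products and the coaction -/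

/-- `L ⊗ B[[λ₁, …, λ₅]]`. For `B = ℂ` this is `L ⊗ ℂ[[λ₁, …, λ₅]]`; for general `B` it is the
completed tensor product of `L ⊗ ℂ[[λ₁, …, λ₅]]` with `B`, in which a series
`∑ₙ x λⁿ ⊗ bₙ` is an element. -/
abbrev Ext (L B : Type*) [Ring L] [Algebra ℂ L] [CommRing B] [Algebra ℂ B] :=
  L ⊗[ℂ] MvPowerSeries (Fin 5) B

section Coaction

variable (L : Type*) [Ring L] [Algebra ℂ L]
variable {B C : Type*} [CommRing B] [Algebra ℂ B] [CommRing C] [Algebra ℂ C]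

/-- `id ⊗ f` for an algebra map `f : B → C`, applied coefficientwise in `λ`. -/
def idTensor (f : B →ₐ[ℂ] C) : Ext L B →ₐ[ℂ] Ext L C :=
  Algebra.TensorProduct.map (AlgHom.id ℂ L) (MvPowerSeries.mapAlgHom f)

variable (B) in
/-- The elements of order at least `k` in `λ`. -/
def orderGE (k : ℕ) : Submodule ℂ (Ext L B) :=
  Submodule.span ℂ {z | ∃ (x : L) (f : MvPowerSeries (Fin 5) B),
    (∀ m : Fin 5 →₀ ℕ, m.degree < k → MvPowerSeries.coeff m f = 0) ∧ z = x ⊗ₜ f}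

variable {L}

/-- `ρ'` is `ρ ⊗ id_B`: the algebra map on the completed tensor products that extends `ρ`, is the
identity on the last factor `B`, and is continuous in the `λ`-adic topology. -/
structure IsTensorId (ρ : Ext L ℂ →ₐ[ℂ] Ext L B) (ρ' : Ext L B →ₐ[ℂ] Ext L (B ⊗[ℂ] B)) :
    Prop where
  extend : ∀ z, ρ' (idTensor L (Algebra.ofId ℂ B) z) =
    idTensor L Algebra.TensorProduct.includeLeft (ρ z)
  scalar : ∀ b : B, ρ' (1 ⊗ₜ MvPowerSeries.C b) = 1 ⊗ₜ MvPowerSeries.C (1 ⊗ₜ b)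
  continuous : ∀ k, ∀ z ∈ orderGE L B k, ρ' z ∈ orderGE L (B ⊗[ℂ] B) k

/-- The algebra map `ρ` makes `L ⊗ ℂ[[λ]]` a (completed, right) comodule algebra over the bialgebra
`B`: it is `λ`-adically continuous, `(id ⊗ ε) ρ = id` and `(ρ ⊗ id) ρ = (id ⊗ Δ) ρ`. -/
structure IsComoduleAlgebra (Δ : B →ₐ[ℂ] B ⊗[ℂ] B) (ε : B →ₐ[ℂ] ℂ)
    (ρ : Ext L ℂ →ₐ[ℂ] Ext L B) : Prop where
  continuous : ∀ k, ∀ z ∈ orderGE L ℂ k, ρ z ∈ orderGE L B k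
  counit : ∀ z, idTensor L ε (ρ z) = z
  coassoc : ∃ ρ' : Ext L B →ₐ[ℂ] Ext L (B ⊗[ℂ] B), IsTensorId ρ ρ' ∧
    ∀ z, ρ' (ρ z) = idTensor L Δ (ρ z)

end Coaction

/-- `f = ∑ₙ λ^s λⁿ ⊗ p_n(y)`, over `n ∈ ℤ⁵`, as a power series in `λ` with coefficients in `H`.
That is: all `p_n(y)` lie in `H`, there is no contribution from an `n` for which `λ^s λⁿ` has a
negative exponent, and the coefficient of `λ^s λⁿ` is `p_n(y)` for the others. -/
structure IsExpansion (s : Fin 5 →₀ ℕ) (y : HCKHat) (f : MvPowerSeries (Fin 5) greenAlg) :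
    Prop where
  coeff_eq : ∀ (n : Fin 5 → ℤ) (m : Fin 5 →₀ ℕ), (∀ j, (m j : ℤ) = s j + n j) →
    (((MvPowerSeries.coeff m f : greenAlg) : HCK) : HCKHat) = proj n y
  proj_eq_zero : ∀ n : Fin 5 → ℤ, (∃ j, (s j : ℤ) + n j < 0) → proj n y = 0

/-- The factor by which a field is multiplied: the series of its edge, and `1` for `h`. -/
def fieldFactor (wave : EdgeType → MvPowerSeries (Fin 5) greenAlg) (φ : Field) :
    MvPowerSeries (Fin 5) greenAlg :=
  φ.edge.elim 1 wave

end QCD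

end

open scoped TensorProduct

noncomputable section

namespace QCD

/-! ## Connectivity of half-edge graphs -/

/-! Everything rests on one formula, `comul_greenSeries`. Collect the graphs with residue r into a
power series G^r(λ), where λ^N marks the graphs with N_j vertices v_j and G^{v_j} begins with λ_j.
Let W_k be the square root of G^{e_k}, and let Y_j be G^{v_j} times the product of the
W_k^{-N_k(v_j)}. Then ΔG^r(λ) is the product of the W_k^{N_k(r)} ⊗ 1 times the series 1 ⊗ G^r in
which each λ_j is replaced by Y_j ⊗ 1.

The formula is proved by counting. A graph with a subgraph is a family of components, lone vertices
included, each put into a slot with its residue, together with a wiring of their external lines.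
Once the components are labelled and identified with fixed representatives, automorphisms cancel the
symmetry factors exactly, and the sum of the contracted graphs depends only on the number of slots
of each residue (`sum_classes_dissection`). Slots whose residue is an edge can be removed: to insert
one more is to choose an internal half-edge of its type (`Slots.wiringSum_addEdge`). Hence m such
slots of type k give the product of the t + 2i for i < m, where t is the number of k-lines at the
vertex slots minus N_k(r). Divided by m! these are, up to powers of -2, the coefficients of a
binomial series (`choose_rescale`), and summation over m yields (G^{e_k})^{-t/2}. These powers
recombine with the G^{v_j} into the W_k and Y_j (`wave_mul_coupling`, `sum_classes_subgraph_eq`).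

From there on graphs are hardly needed. An algebra map on H is determined by its values on the
coefficients of W and Y, and the formula becomes ΔW_k = (W_k ⊗ 1) · (1 ⊗ W_k)(Y ⊗ 1) and ΔY_j = (1 ⊗
Y_j)(Y ⊗ 1). This is the composition law of the transformations λ ↦ Y(λ), φ ↦ W φ. Coassociativity
is the associativity of substitution (`IsCoproduct.coassoc`), and the counit is the identity
transformation. The antipode is the geometric series of the convolution powers of (unit ∘ counit) -
id. It is locally finite because the k-th power takes values in the k-th power of the augmentation
ideal, while every graph has positive weight and the powers preserve weights (`eq_zero_of_scaleH`).

The coaction multiplies an expression with u_k fields of type k by the product of the W_k^{u_k} and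
substitutes Y for λ (`twist`, `coaction`). The comodule axioms are again the composition law. A
derivative does not change the numbers of fields, so the coaction commutes with ∂_μ and passes to
integrals. That the p_n of Y_{v_j} and of the roots are the coefficients of these series follows by
comparing expansions by multidegree (`Expands`). -/

/-- Connection by a path of edges, each with a half in `S`. -/
def Linked {V HE : Type} (base : HE → V) (twin : HE → HE) (S : Set HE) : V → V → Prop :=
  Relation.EqvGen fun v w => ∃ h ∈ S, base h = v ∧ base (twin h) = w

section Linked

theorem eqvGen_lift {X Y : Type} {R : X → X → Prop} {R' : Y → Y → Prop} (f : X → Y)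
    (h : ∀ x y, R x y → Relation.EqvGen R' (f x) (f y)) {x y : X} (hxy : Relation.EqvGen R x y) :
    Relation.EqvGen R' (f x) (f y) := by
  induction hxy with
  | rel x y hr => exact h x y hr
  | refl x => exact .refl _
  | symm x y _ ih => exact .symm _ _ ih
  | trans x y z _ _ ih1 ih2 => exact .trans _ _ _ ih1 ih2

/-- Connectedness is transported along a map that need be neither injective nor surjective: related
points must have linked images, and every target point must be linked to some image. Contraction of
components and insertion or removal of a slot are all of this kind. -/
theorem eqvGen_total_of_retract {X Y : Type} {R : X → X → Prop} {R' : Y → Y → Prop} (f : X → Y)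
    (h : ∀ x y, R x y → Relation.EqvGen R' (f x) (f y))
    (hf : ∀ y, ∃ x, Relation.EqvGen R' (f x) y)
    (hR : ∀ x y, Relation.EqvGen R x y) (y y' : Y) : Relation.EqvGen R' y y' := by
  obtain ⟨x, hx⟩ := hf y
  obtain ⟨x', hx'⟩ := hf y'
  exact .trans _ _ _ (.symm _ _ hx) (.trans _ _ _ (eqvGen_lift f h (hR x x')) hx')

variable {V HE V' HE' : Type} {base : HE → V} {twin : HE → HE} {base' : HE' → V'}
  {twin' : HE' → HE'}

theorem Linked.edge {S : Set HE} {h : HE} (hh : h ∈ S) :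
    Linked base twin S (base h) (base (twin h)) := .rel _ _ ⟨h, hh, rfl, rfl⟩

theorem Linked.refl {S : Set HE} (v : V) : Linked base twin S v v := Relation.EqvGen.refl _

theorem Linked.symm {S : Set HE} {v w : V} (h : Linked base twin S v w) :
    Linked base twin S w v := Relation.EqvGen.symm _ _ h

theorem Linked.trans {S : Set HE} {u v w : V} (h : Linked base twin S u v)
    (h' : Linked base twin S v w) : Linked base twin S u w := Relation.EqvGen.trans _ _ _ h h'

theorem Linked.lift {S : Set HE} {S' : Set HE'} (f : V → V')
    (h : ∀ x ∈ S, Linked base' twin' S' (f (base x)) (f (base (twin x)))) {v w : V}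
    (hvw : Linked base twin S v w) : Linked base' twin' S' (f v) (f w) :=
  eqvGen_lift f (by rintro _ _ ⟨x, hx, rfl, rfl⟩; exact h x hx) hvw

theorem Linked.mono {S S' : Set HE} (h : S ⊆ S') {v w : V} (hvw : Linked base twin S v w) :
    Linked base twin S' v w :=
  eqvGen_lift id (fun _ _ ⟨x, hx, h1, h2⟩ => .rel _ _ ⟨x, h hx, h1, h2⟩) hvw

theorem Linked.total_of_retract {S : Set HE} {S' : Set HE'} (f : V → V')
    (h : ∀ x ∈ S, Linked base' twin' S' (f (base x)) (f (base (twin x))))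
    (hf : ∀ y, ∃ x, Linked base' twin' S' (f x) y)
    (hR : ∀ v w, Linked base twin S v w) (v w : V') : Linked base' twin' S' v w :=
  eqvGen_total_of_retract f (by rintro _ _ ⟨x, hx, rfl, rfl⟩; exact h x hx) hf hR v w

/-- A vertex without an allowed edge is linked to itself only. -/
theorem Linked.eq_of_isolated {S : Set HE} {v w : V}
    (h1 : ∀ x ∈ S, base x = v → base (twin x) = v) (h2 : ∀ x ∈ S, base (twin x) = v → base x = v)
    (h : Linked base twin S v w) : w = v := by
  have key : ∀ a b, Linked base twin S a b → (a = v ↔ b = v) := by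
    intro a b hab
    induction hab with
    | rel a b hr =>
      obtain ⟨x, hx, rfl, rfl⟩ := hr
      exact ⟨h1 x hx, h2 x hx⟩
    | refl => rfl
    | symm _ _ _ ih => exact ih.symm
    | trans _ _ _ _ _ i1 i2 => exact i1.trans i2
  exact (key v w h).mp rfl

/-- Connected, not disconnected by cutting an internal edge, and with an internal edge. -/
structure Bridgeless (base : HE → V) (twin : HE → HE) : Prop where
  nonempty : Nonempty V
  connected : ∀ v w, Linked base twin Set.univ v w
  cut : ∀ h, twin h ≠ h → ∀ v w, Linked base twin {x | x ≠ h ∧ x ≠ twin h} v w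
  internal : ∃ h, twin h ≠ h

theorem Bridgeless.of_equiv (hb : Bridgeless base twin) (eV : V ≃ V') (eH : HE ≃ HE')
    (h1 : ∀ h, base' (eH h) = eV (base h)) (h2 : ∀ h, twin' (eH h) = eH (twin h)) :
    Bridgeless base' twin' where
  nonempty := hb.nonempty.map eV
  connected := by
    refine Linked.total_of_retract eV (fun x _ => ?_)
      (fun y => ⟨eV.symm y, by simpa using Linked.refl _⟩) hb.connected
    rw [← h1, ← h1, ← h2]; exact Linked.edge trivial
  cut := by
    intro h hh
    have hh' : twin (eH.symm h) ≠ eH.symm h := by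
      intro e
      apply hh
      have := h2 (eH.symm h)
      rw [e] at this
      simpa using this
    refine Linked.total_of_retract eV (fun x hx => ?_)
      (fun y => ⟨eV.symm y, by simpa using Linked.refl _⟩) (hb.cut _ hh')
    rw [← h1, ← h1, ← h2]
    refine Linked.edge ⟨?_, ?_⟩
    · rintro rfl; exact hx.1 (by simp)
    · intro e
      apply hx.2
      apply eH.injective
      rw [← h2, e, Equiv.apply_symm_apply]
  internal := by
    obtain ⟨h, hh⟩ := hb.internal
    exact ⟨eH h, by rw [h2]; exact fun e => hh (eH.injective e)⟩

end Linked

/-! ## First returns -/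

section Reach

variable {α β : Type}

/-- `y` is the first point of `B` on the orbit `p x, p (p x), …`. -/
inductive Reach (p : Equiv.Perm α) (B : Set α) : α → α → Prop
  | last {x : α} : p x ∈ B → Reach p B x (p x)
  | step {x y : α} : p x ∉ B → Reach p B (p x) y → Reach p B x y

theorem Reach.unique {p : Equiv.Perm α} {B : Set α} {x y z : α} (h : Reach p B x y)
    (h' : Reach p B x z) : y = z := by
  induction h with
  | last hx =>
    cases h' with
    | last _ => rfl
    | step h1 _ => exact absurd hx h1
  | step hx _ ih =>
    cases h' with
    | last h1 => exact absurd h1 hx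
    | step _ h2 => exact ih h2

theorem reach_pow (p : Equiv.Perm α) (B : Set α) (n : ℕ) (x : α)
    (h : ∀ j, 0 < j → j < n + 1 → (p ^ j) x ∉ B) (hn : (p ^ (n + 1)) x ∈ B) :
    Reach p B x ((p ^ (n + 1)) x) := by
  induction n generalizing x with
  | zero => simpa using Reach.last (p := p) (B := B) (x := x) (by simpa using hn)
  | succ n ih =>
    have e : ∀ j, (p ^ (j + 1)) x = (p ^ j) (p x) := fun j => by rw [pow_succ]; rfl
    rw [e] at hn ⊢
    refine Reach.step (by simpa using h 1 one_pos (by omega)) (ih (p x) (fun j hj hj' => ?_) hn)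
    rw [← e]
    exact h _ (by omega) (by omega)

/-- The inductive relation carries no exponent. It can therefore be compared between permutations
whose orbits have different lengths, which is needed when a slot is inserted into a chain. -/
theorem firstReturn_reach [Finite α] (p : Equiv.Perm α) (B : Set α) (b : B) :
    Reach p B b (firstReturn p B b : B) := by
  classical
  have hs := Nat.find_spec (exists_return p B b)
  obtain ⟨n, hn⟩ := Nat.exists_eq_add_one_of_ne_zero hs.1.ne'
  have hy : ((firstReturn p B b : B) : α) = (p ^ (n + 1)) b := by
    rw [← hn]; rfl
  rw [hy]
  refine reach_pow p B n b (fun j hj hj' hB => ?_) (by rw [← hn]; exact hs.2)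
  exact Nat.find_min (exists_return p B b) (hn ▸ hj') ⟨hj, hB⟩

theorem Reach.map {p : Equiv.Perm α} {q : Equiv.Perm β} {B : Set α} {B' : Set β} (e : α → β)
    (h : ∀ x, q (e x) = e (p x)) (hB : ∀ x, e x ∈ B' ↔ x ∈ B) {x y : α} (r : Reach p B x y) :
    Reach q B' (e x) (e y) := by
  induction r with
  | last hx =>
    rw [← h]
    exact Reach.last (by rw [h, hB]; exact hx)
  | step hx _ ih =>
    refine Reach.step (by rw [h, hB]; exact hx) ?_
    rw [h]; exact ih

theorem firstReturn_eq [Finite α] {p : Equiv.Perm α} {B : Set α} {b : B} {y : α}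
    (h : Reach p B b y) : ((firstReturn p B b : B) : α) = y :=
  (firstReturn_reach p B b).unique h

end Reach

/-! ## Isomorphisms -/

namespace FeynmanGraph

variable {Γ Γ' Γ'' : FeynmanGraph}

theorem isOnePI_iff : Γ.IsOnePI ↔ Bridgeless Γ.base Γ.twin :=
  ⟨fun h => ⟨h.connected.1, h.connected.2, h.cut, h.not_tree⟩,
    fun h => ⟨⟨h.nonempty, h.connected⟩, h.cut, h.internal⟩⟩

theorem Iso.ext {f g : Iso Γ Γ'} (h1 : ∀ v, f.onV v = g.onV v) (h2 : ∀ h, f.onHE h = g.onHE h) :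
    f = g := by
  cases f; cases g
  obtain rfl := Equiv.ext h1
  obtain rfl := Equiv.ext h2
  rfl

instance : Finite (Iso Γ Γ') :=
  Finite.of_injective (β := (Γ.V ≃ Γ'.V) × (Γ.HE ≃ Γ'.HE)) (fun f => (f.onV, f.onHE)) (by
    intro f g h
    exact Iso.ext (fun v => by rw [(Prod.mk.inj h).1]) (fun v => by rw [(Prod.mk.inj h).2]))

instance : Fintype (Iso Γ Γ') := Fintype.ofFinite _

instance : Fintype Γ.Subgraph := Fintype.ofFinite _

theorem IsOnePI.of_iso (f : Iso Γ Γ') (h : Γ.IsOnePI) : Γ'.IsOnePI :=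
  isOnePI_iff.mpr ((isOnePI_iff.mp h).of_equiv f.onV f.onHE f.base_eq f.twin_eq)

theorem extCount_of_iso (f : Iso Γ Γ') (k : EdgeType) : Γ'.extCount k = Γ.extCount k :=
  (Nat.card_congr (f.onHE.subtypeEquiv fun h => by
    rw [f.twin_eq, f.etype_eq, f.onHE.injective.eq_iff])).symm

/-- The number of vertices of each type. -/
def vcount (Γ : FeynmanGraph) : Fin 5 →₀ ℕ :=
  Finsupp.equivFunOnFinite.symm fun j => Nat.card {v // Γ.vtype v = j}

theorem vcount_apply (Γ : FeynmanGraph) (j : Fin 5) :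
    Γ.vcount j = Nat.card {v // Γ.vtype v = j} := rfl

theorem vcount_of_iso (f : Iso Γ Γ') : Γ'.vcount = Γ.vcount := by
  ext j
  exact (Nat.card_congr (f.onV.subtypeEquiv fun h => by rw [f.vtype_eq])).symm

def Iso.congr (f : Iso Γ Γ') : Iso Γ Γ ≃ Iso Γ Γ' where
  toFun g := g.trans f
  invFun g := g.trans f.symm
  left_inv g := Iso.ext (fun v => by simp [Iso.trans, Iso.symm])
    (fun v => by simp [Iso.trans, Iso.symm])
  right_inv g := Iso.ext (fun v => by simp [Iso.trans, Iso.symm])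
    (fun v => by simp [Iso.trans, Iso.symm])

theorem Iso.card_eq (f : Iso Γ Γ') : Nat.card (Iso Γ Γ') = Nat.card (Iso Γ Γ) :=
  (Nat.card_congr f.congr).symm

theorem Iso.card_pos (f : Iso Γ Γ') : 0 < Nat.card (Iso Γ Γ') :=
  have : Nonempty (Iso Γ Γ') := ⟨f⟩
  Nat.card_pos

end FeynmanGraph

theorem gen_of_iso {Γ Γ' : FeynmanGraph} (f : Γ.Iso Γ') (r : Residue) : gen Γ' r = gen Γ r := by
  have h1 : (Γ'.IsOnePI ∧ ∀ k, Γ'.extCount k = legs r k) ↔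
      (Γ.IsOnePI ∧ ∀ k, Γ.extCount k = legs r k) := by
    refine and_congr ⟨.of_iso f.symm, .of_iso f⟩ ?_
    simp only [FeynmanGraph.extCount_of_iso f]
  unfold gen
  by_cases h : Γ.IsOnePI ∧ ∀ k, Γ.extCount k = legs r k
  · rw [dif_pos h, dif_pos (h1.mpr h)]
    congr 1
    exact Quotient.sound ⟨⟨f.symm⟩, rfl⟩
  · rw [dif_neg h, dif_neg (h1.not.mpr h)]

end QCD

namespace QCD

theorem exists_equiv_over {A B K : Type} [Finite A] [Finite B] (f : A → K) (g : B → K)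
    (h : ∀ k, Nat.card {a // f a = k} = Nat.card {b // g b = k}) :
    ∃ e : A ≃ B, ∀ a, g (e a) = f a := by
  have E : ∀ k, Nonempty ({a // f a = k} ≃ {b // g b = k}) := fun k =>
    (Finite.card_eq).mp (h k)
  refine ⟨(Equiv.sigmaFiberEquiv f).symm.trans
    ((Equiv.sigmaCongrRight fun k => (E k).some).trans (Equiv.sigmaFiberEquiv g)), fun a => ?_⟩
  exact ((E (f a)).some ⟨a, rfl⟩).2

/-! ## Slots and wirings -/

/-- A finite family of slots with residues in `R`, each with the legs of its residue. -/
structure Slots : Type 1 where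
  A : Type
  L : Type
  finA : Finite A
  finL : Finite L
  res : A → Residue
  etype : L → EdgeType
  base : L → A
  valence : ∀ a k, Nat.card {x // base x = a ∧ etype x = k} = legs (res a) k

attribute [instance] Slots.finA Slots.finL

namespace Slots

/-- A way to join the legs of slots to each other; the fixed points remain external. -/
structure Wiring (s : Slots) where
  twin : s.L → s.L
  twin_twin : ∀ x, twin (twin x) = x
  etype_twin : ∀ x, s.etype (twin x) = s.etype x

variable (s : Slots)

theorem Wiring.ext {s : Slots} {i j : s.Wiring} (h : ∀ x, i.twin x = j.twin x) : i = j := by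
  cases i; cases j
  obtain rfl := funext h
  rfl

instance : Finite s.Wiring :=
  Finite.of_injective (β := s.L → s.L) Wiring.twin fun _ _ h => Wiring.ext fun x => congrFun h x

instance : Fintype s.Wiring := Fintype.ofFinite _

/-- `x` and `y` are the two legs of a slot whose residue is an edge. -/
def Mate (x y : s.L) : Prop := s.base x = s.base y ∧ x ≠ y ∧ (s.res (s.base x)).isLeft

variable {s}

theorem Mate.symm {x y : s.L} (m : s.Mate x y) : s.Mate y x :=
  ⟨m.1.symm, m.2.1.symm, m.1 ▸ m.2.2⟩

theorem etype_of_isLeft {x : s.L} {i : EdgeType} (h : s.res (s.base x) = Sum.inl i) :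
    s.etype x = i := by
  by_contra hne
  have h1 := s.valence (s.base x) (s.etype x)
  rw [h] at h1
  simp only [legs, hne, if_false] at h1
  exact (Finite.card_eq_zero_iff.mp h1).false ⟨x, rfl, rfl⟩

theorem Mate.etype_eq {x y : s.L} (m : s.Mate x y) : s.etype x = s.etype y := by
  obtain ⟨i, hi⟩ := Sum.isLeft_iff.mp m.2.2
  rw [etype_of_isLeft hi, etype_of_isLeft (m.1 ▸ hi)]

/-- A slot whose residue is an edge has exactly two legs, so beside `x` there is only one other. -/
theorem Mate.unique {x y z : s.L} (my : s.Mate x y) (mz : s.Mate x z) : y = z := by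
  obtain ⟨i, hi⟩ := Sum.isLeft_iff.mp my.2.2
  have h1 := s.valence (s.base x) i
  rw [hi] at h1
  simp only [legs, if_true] at h1
  obtain ⟨w, -, hw⟩ := (Nat.card_eq_two_iff' (⟨x, rfl, etype_of_isLeft hi⟩ :
    {y // s.base y = s.base x ∧ s.etype y = i})).mp h1
  have e1 := hw ⟨y, my.1.symm, etype_of_isLeft (my.1 ▸ hi)⟩
    fun e => my.2.1 (congrArg Subtype.val e).symm
  have e2 := hw ⟨z, mz.1.symm, etype_of_isLeft (mz.1 ▸ hi)⟩
    fun e => mz.2.1 (congrArg Subtype.val e).symm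
  exact congrArg Subtype.val (e1.trans e2.symm)

variable (s)

open Classical in
/-- Passing through a slot whose residue is an edge. -/
def pass (x : s.L) : s.L := if hx : ∃ y, s.Mate x y then hx.choose else x

variable {s}

theorem pass_eq_of_mate {x y : s.L} (m : s.Mate x y) : s.pass x = y := by
  have hx : ∃ y, s.Mate x y := ⟨y, m⟩
  unfold pass
  rw [dif_pos hx]
  exact hx.choose_spec.unique m

theorem pass_eq_self {x : s.L} (h : ¬ ∃ y, s.Mate x y) : s.pass x = x := dif_neg h

variable (s)

theorem pass_pass (x : s.L) : s.pass (s.pass x) = x := by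
  by_cases hx : ∃ y, s.Mate x y
  · obtain ⟨y, m⟩ := hx
    rw [pass_eq_of_mate m, pass_eq_of_mate m.symm]
  · rw [pass_eq_self hx, pass_eq_self hx]

theorem etype_pass (x : s.L) : s.etype (s.pass x) = s.etype x := by
  by_cases hx : ∃ y, s.Mate x y
  · obtain ⟨y, m⟩ := hx
    rw [pass_eq_of_mate m, m.etype_eq]
  · rw [pass_eq_self hx]

def passPerm : Equiv.Perm s.L := ⟨s.pass, s.pass, s.pass_pass, s.pass_pass⟩

/-- The legs of the slots whose residue is a vertex. -/
def keep : Set s.L := {x | (s.res (s.base x)).isRight}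

variable {s}

theorem pass_of_keep (x : s.L) (hx : x ∈ s.keep) : s.passPerm x = x := by
  refine pass_eq_self ?_
  rintro ⟨y, m⟩
  have h1 : (s.res (s.base x)).isRight := hx
  rw [← Sum.not_isLeft] at h1
  simp [m.2.2] at h1

namespace Wiring

variable (i : s.Wiring)

def perm : Equiv.Perm s.L := ⟨i.twin, i.twin, i.twin_twin, i.twin_twin⟩

/-- The permutation whose first return map gives the edges of the contracted graph. -/
def step : Equiv.Perm s.L := i.perm * s.passPerm

theorem step_apply (x : s.L) : i.step x = i.twin (s.pass x) := rfl

theorem etype_step_pow (n : ℕ) (x : s.L) : s.etype ((i.step ^ n) x) = s.etype x := by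
  induction n with
  | zero => rfl
  | succ n ih =>
    rw [pow_succ']
    exact (i.etype_twin _).trans ((s.etype_pass _).trans ih)

/-- The graph with the vertex slots as vertices, whose edges are the chains of edge slots. -/
def contract : FeynmanGraph where
  V := {a : s.A // (s.res a).isRight}
  HE := s.keep
  finV := inferInstance
  finHE := inferInstance
  vtype a := (s.res a.1).getRight a.2
  etype x := s.etype x.1
  base x := ⟨s.base x.1, x.2⟩
  twin x := firstReturn i.step s.keep x
  twin_twin x := firstReturn_involutive _ _ i.twin_twin s.pass_pass _ pass_of_keep x
  etype_twin x := i.etype_step_pow _ _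
  valence a k := by
    have h1 := s.valence a.1 k
    rw [← FeynmanGraph.Subgraph.getRight_eq a.2] at h1
    refine Eq.trans ?_ h1
    exact Nat.card_congr ⟨fun x => ⟨x.1.1, congrArg Subtype.val x.2.1, x.2.2⟩,
      fun x => ⟨⟨x.1, by rw [keep, Set.mem_ofPred_eq, x.2.1]; exact a.2⟩, Subtype.ext x.2.1, x.2.2⟩,
      fun x => rfl, fun x => rfl⟩

theorem contract_twin_reach (x : s.keep) :
    Reach i.step s.keep x (firstReturn i.step s.keep x : s.keep) := firstReturn_reach _ _ _

/-- The wirings whose graph of slots is one-particle irreducible, with the external legs of `r`. -/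
def Good (r : Residue) : Prop :=
  Bridgeless s.base i.twin ∧ ∀ k, Nat.card {x // i.twin x = x ∧ s.etype x = k} = legs r k

end Wiring

variable (s) in
open Classical in
/-- The sum over the good wirings of the contracted graphs. -/
def wiringSum (r : Residue) : HCK := ∑ i : s.Wiring, if i.Good r then gen i.contract r else 0

/-! ### Isomorphisms of slots -/

structure Iso (s s' : Slots) where
  onA : s.A ≃ s'.A
  onL : s.L ≃ s'.L
  res_eq : ∀ a, s'.res (onA a) = s.res a
  etype_eq : ∀ x, s'.etype (onL x) = s.etype x
  base_eq : ∀ x, s'.base (onL x) = onA (s.base x)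

variable {s' : Slots}

theorem Iso.mate_iff (e : Iso s s') (x y : s.L) :
    s'.Mate (e.onL x) (e.onL y) ↔ s.Mate x y := by
  simp only [Mate, e.base_eq, e.res_eq, e.onA.injective.eq_iff, e.onL.injective.ne_iff]

theorem Iso.pass_eq (e : Iso s s') (x : s.L) : s'.pass (e.onL x) = e.onL (s.pass x) := by
  by_cases hx : ∃ y, s.Mate x y
  · obtain ⟨y, m⟩ := hx
    rw [pass_eq_of_mate m, pass_eq_of_mate ((e.mate_iff x y).mpr m)]
  · rw [pass_eq_self hx, pass_eq_self]
    rintro ⟨y, m⟩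
    exact hx ⟨e.onL.symm y, (e.mate_iff _ _).mp (by simpa using m)⟩

theorem Iso.keep_iff (e : Iso s s') (x : s.L) : e.onL x ∈ s'.keep ↔ x ∈ s.keep := by
  simp only [keep, Set.mem_ofPred_eq, e.base_eq, e.res_eq]

theorem Iso.bridgeless (e : Iso s s') {i : s.Wiring} {j : s'.Wiring}
    (h : ∀ x, j.twin (e.onL x) = e.onL (i.twin x)) (hb : Bridgeless s.base i.twin) :
    Bridgeless s'.base j.twin := hb.of_equiv e.onA e.onL e.base_eq h

def Iso.symm (e : Iso s s') : Iso s' s where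
  onA := e.onA.symm
  onL := e.onL.symm
  res_eq v := by rw [← e.res_eq]; simp
  etype_eq h := by rw [← e.etype_eq]; simp
  base_eq h := by
    apply e.onA.injective
    rw [← e.base_eq]; simp

theorem Iso.symm_twin (e : Iso s s') {i : s.Wiring} {j : s'.Wiring}
    (h : ∀ x, j.twin (e.onL x) = e.onL (i.twin x)) (x : s'.L) :
    i.twin (e.symm.onL x) = e.symm.onL (j.twin x) := by
  apply e.onL.injective
  rw [← h]; simp [Iso.symm]

theorem Iso.good_iff (e : Iso s s') {i : s.Wiring} {j : s'.Wiring}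
    (h : ∀ x, j.twin (e.onL x) = e.onL (i.twin x)) (r : Residue) : j.Good r ↔ i.Good r := by
  refine and_congr ⟨e.symm.bridgeless (e.symm_twin h), e.bridgeless h⟩ ?_
  refine forall_congr' fun k => ?_
  rw [Nat.card_congr (e.onL.subtypeEquiv (q := fun x => j.twin x = x ∧ s'.etype x = k)
    (p := fun x => i.twin x = x ∧ s.etype x = k) fun x => by
      rw [h, e.etype_eq, e.onL.injective.eq_iff])]

def Iso.contract (e : Iso s s') {i : s.Wiring} {j : s'.Wiring}
    (h : ∀ x, j.twin (e.onL x) = e.onL (i.twin x)) :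
    FeynmanGraph.Iso i.contract j.contract where
  onV := e.onA.subtypeEquiv fun a => by rw [e.res_eq]
  onHE := e.onL.subtypeEquiv fun x => (e.keep_iff x).symm
  vtype_eq a := by
    have h1 := e.res_eq a.1
    apply Sum.inr_injective (α := EdgeType)
    change Sum.inr (Sum.getRight _ _) = Sum.inr (Sum.getRight _ _)
    rw [Sum.inr_getRight, Sum.inr_getRight]
    exact h1
  etype_eq x := e.etype_eq x.1
  base_eq x := Subtype.ext (e.base_eq x.1)
  twin_eq x := by
    refine Subtype.ext (firstReturn_eq (α := s'.L) ?_)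
    exact (i.contract_twin_reach x).map e.onL
      (fun y => by rw [Wiring.step_apply, e.pass_eq, h]; rfl) e.keep_iff

/-- Transport of wirings. -/
def Iso.wiring (e : Iso s s') : s.Wiring ≃ s'.Wiring where
  toFun i := ⟨fun x => e.onL (i.twin (e.onL.symm x)), fun x => by simp [i.twin_twin],
    fun x => by rw [e.etype_eq, i.etype_twin, ← e.etype_eq, Equiv.apply_symm_apply]⟩
  invFun j := ⟨fun x => e.onL.symm (j.twin (e.onL x)), fun x => by simp [j.twin_twin],
    fun x => by rw [← e.etype_eq, Equiv.apply_symm_apply, j.etype_twin, e.etype_eq]⟩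
  left_inv i := Wiring.ext fun x => by simp
  right_inv i := Wiring.ext fun x => by simp

theorem Iso.wiringSum_eq (e : Iso s s') (r : Residue) : s'.wiringSum r = s.wiringSum r := by
  classical
  refine (Fintype.sum_equiv e.wiring _ _ fun i => ?_).symm
  have h : ∀ x, (e.wiring i).twin (e.onL x) = e.onL (i.twin x) := fun x => by simp [Iso.wiring]
  simp only [e.good_iff h, gen_of_iso (e.contract h)]

/-- The number of slots of each residue. -/
def count (s : Slots) (r : Residue) : ℕ := Nat.card {a // s.res a = r}

theorem exists_iso (h : ∀ r, s.count r = s'.count r) : Nonempty (Iso s s') := by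
  obtain ⟨e, he⟩ := exists_equiv_over s.res s'.res h
  obtain ⟨f, hf⟩ := exists_equiv_over (fun x : s.L => (e (s.base x), s.etype x))
    (fun x : s'.L => (s'.base x, s'.etype x)) (by
      rintro ⟨a, k⟩
      have h1 := s.valence (e.symm a) k
      have h2 := s'.valence a k
      rw [← he, Equiv.apply_symm_apply] at h1
      refine Eq.trans (Nat.card_congr ?_) (h1.trans (h2.symm.trans (Nat.card_congr ?_)))
      · exact Equiv.subtypeEquivRight fun x => by rw [Prod.mk.injEq, Equiv.eq_symm_apply]
      · exact Equiv.subtypeEquivRight fun x => by rw [Prod.mk.injEq])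
  exact ⟨⟨e, f, he, fun x => (Prod.mk.inj (hf x)).2, fun x => (Prod.mk.inj (hf x)).1⟩⟩

/-- The residue of a slot dictates how many legs of each type it has, so equal counts of residues
give isomorphic families of slots. This is why the sum of contracted graphs does not see what fills
the slots. -/
theorem wiringSum_eq_of_count (h : ∀ r, s.count r = s'.count r) (r : Residue) :
    s.wiringSum r = s'.wiringSum r := ((exists_iso h).some.wiringSum_eq r).symm

end Slots

end QCD

namespace QCD

theorem legs_ne_zero (r : Residue) : ∃ k, legs r k ≠ 0 := by
  rcases r with i | j
  · exact ⟨i, by simp [legs]⟩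
  · revert j; decide

namespace Slots

variable (s : Slots)

/-! ### Adding an edge slot -/

/-- The slots `s` together with a further slot whose residue is the edge `k`. -/
abbrev addEdge (k : EdgeType) : Slots where
  A := Option s.A
  L := s.L ⊕ Bool
  finA := inferInstance
  finL := inferInstance
  res a := a.elim (Sum.inl k) s.res
  etype := Sum.elim s.etype fun _ => k
  base := Sum.elim (fun x => some (s.base x)) fun _ => none
  valence a l := by
    cases a with
    | some a =>
      refine Eq.trans (Nat.card_eq_of_bijective
        (fun x : {x // s.base x = a ∧ s.etype x = l} => ⟨Sum.inl x.1, congrArg some x.2.1, x.2.2⟩)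
        ⟨fun x y e => Subtype.ext (Sum.inl.inj (congrArg Subtype.val e)), ?_⟩).symm (s.valence a l)
      rintro ⟨x | b, h1, h2⟩
      · exact ⟨⟨x, Option.some.inj h1, h2⟩, rfl⟩
      · cases h1
    | none =>
      change _ = if l = k then 2 else 0
      split_ifs with hl
      · subst hl
        refine Eq.trans (Nat.card_eq_of_bijective (fun b : Bool => ⟨Sum.inr b, rfl, rfl⟩)
          ⟨fun x y e => Sum.inr.inj (congrArg Subtype.val e), ?_⟩).symm
          (Nat.card_eq_fintype_card (α := Bool))
        rintro ⟨x | b, h1, h2⟩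
        · cases h1
        · exact ⟨b, rfl⟩
      · rw [Finite.card_eq_zero_iff]
        refine ⟨?_⟩
        rintro ⟨x | b, h1, h2⟩
        · cases h1
        · exact hl h2.symm

variable {s} {k : EdgeType}

namespace Wiring

open Classical in
/-- Inserting the additional slot into the edge with the half `h`. -/
def insert (i : s.Wiring) (h : s.L) (hi : i.twin h ≠ h) (hk : s.etype h = k) :
    (s.addEdge k).Wiring where
  twin := Sum.elim (fun x => if x = h then Sum.inr true else
    if x = i.twin h then Sum.inr false else Sum.inl (i.twin x))
    fun b => Sum.inl (if b then h else i.twin h)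
  twin_twin := by
    rintro (x | b)
    · by_cases h1 : x = h
      · simp [h1]
      · by_cases h2 : x = i.twin h
        · simp [h2, hi]
        · have h3 : i.twin x ≠ h := fun e => h2 (by rw [← e, i.twin_twin])
          have h4 : i.twin x ≠ i.twin h := fun e => h1 (by rw [← i.twin_twin x, e, i.twin_twin])
          simp [h1, h2, h3, h4, i.twin_twin]
    · cases b <;> simp [hi]
  etype_twin := by
    rintro (x | b)
    · by_cases h1 : x = h
      · simp [h1, addEdge, hk]
      · by_cases h2 : x = i.twin h
        · simp [h2, hi, addEdge, i.etype_twin, hk]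
        · simp [h1, h2, addEdge, i.etype_twin]
    · cases b <;> simp [addEdge, i.etype_twin, hk]

section insert

variable (i : s.Wiring) (h : s.L) (hi : i.twin h ≠ h) (hk : s.etype h = k)

@[simp] theorem insert_inr_true : (i.insert h hi hk).twin (Sum.inr true) = Sum.inl h := by
  simp [insert]

@[simp] theorem insert_inr_false :
    (i.insert h hi hk).twin (Sum.inr false) = Sum.inl (i.twin h) := by simp [insert]

@[simp] theorem insert_inl_self : (i.insert h hi hk).twin (Sum.inl h) = Sum.inr true := by
  simp [insert]

@[simp] theorem insert_inl_twin :
    (i.insert h hi hk).twin (Sum.inl (i.twin h)) = Sum.inr false := by simp [insert, hi]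

theorem insert_inl {x : s.L} (h1 : x ≠ h) (h2 : x ≠ i.twin h) :
    (i.insert h hi hk).twin (Sum.inl x) = Sum.inl (i.twin x) := by simp [insert, h1, h2]

variable {i h hi hk}

/-- The edge of `h` becomes a path of two edges through the new slot. So wherever the old edge may
be used, both new ones must be allowed, and the new slot needs at least one of them to hang on. -/
theorem insert_total {T : Set s.L} {T' : Set (s.L ⊕ Bool)}
    (h1 : ∀ x ∈ T, x ≠ h → x ≠ i.twin h → Sum.inl x ∈ T')
    (h2 : h ∈ T ∨ i.twin h ∈ T → Sum.inr true ∈ T' ∧ Sum.inr false ∈ T')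
    (h3 : Sum.inr true ∈ T' ∨ Sum.inr false ∈ T')
    (H : ∀ a b, Linked s.base i.twin T a b) (a b : Option s.A) :
    Linked (s.addEdge k).base (i.insert h hi hk).twin T' a b := by
  have et : Sum.inr true ∈ T' →
      Linked (s.addEdge k).base (i.insert h hi hk).twin T' none (some (s.base h)) := by
    intro ht
    have := Linked.edge (base := (s.addEdge k).base) (twin := (i.insert h hi hk).twin) ht
    rwa [insert_inr_true] at this
  have ef : Sum.inr false ∈ T' → Linked (s.addEdge k).base (i.insert h hi hk).twin T' none
      (some (s.base (i.twin h))) := by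
    intro ht
    have := Linked.edge (base := (s.addEdge k).base) (twin := (i.insert h hi hk).twin) ht
    rwa [insert_inr_false] at this
  refine Linked.total_of_retract (V' := Option s.A) some (fun x hx => ?_) ?_ H a b
  · by_cases e1 : x = h
    · subst e1
      obtain ⟨ht, hf⟩ := h2 (Or.inl hx)
      exact (et ht).symm.trans (ef hf)
    · by_cases e2 : x = i.twin h
      · subst e2
        obtain ⟨ht, hf⟩ := h2 (Or.inr hx)
        rw [i.twin_twin]
        exact (ef hf).symm.trans (et ht)
      · have := Linked.edge (base := (s.addEdge k).base) (twin := (i.insert h hi hk).twin)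
          (h1 x hx e1 e2)
        rwa [insert_inl i h hi hk e1 e2] at this
  · rintro (_ | a)
    · rcases h3 with ht | hf
      · exact ⟨_, (et ht).symm⟩
      · exact ⟨_, (ef hf).symm⟩
    · exact ⟨a, Linked.refl _⟩

/-- The new slot is collapsed onto `a₀`, which in the applications is one end of the edge of `h`.
When one of the two new edges is cut, `a₀` is chosen as the end at the other one, and the condition
for the cut edge is vacuous. -/
theorem total_of_insert {T : Set s.L} {T' : Set (s.L ⊕ Bool)} (a₀ : s.A)
    (h1 : ∀ x, Sum.inl x ∈ T' → x ≠ h → x ≠ i.twin h → x ∈ T)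
    (h2 : Sum.inl h ∈ T' ∨ Sum.inr true ∈ T' → Linked s.base i.twin T (s.base h) a₀)
    (h3 : Sum.inl (i.twin h) ∈ T' ∨ Sum.inr false ∈ T' →
      Linked s.base i.twin T (s.base (i.twin h)) a₀)
    (H : ∀ a b, Linked (s.addEdge k).base (i.insert h hi hk).twin T' a b) (a b : s.A) :
    Linked s.base i.twin T a b := by
  refine Linked.total_of_retract (V' := s.A) (fun o : Option s.A => o.getD a₀) (fun x hx => ?_)
    (fun a => ⟨some a, Linked.refl _⟩) H a b
  rcases x with x | b
  · by_cases e1 : x = h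
    · subst e1
      rw [insert_inl_self]
      exact h2 (Or.inl hx)
    · by_cases e2 : x = i.twin h
      · subst e2
        rw [insert_inl_twin]
        exact h3 (Or.inl hx)
      · rw [insert_inl i h hi hk e1 e2]
        exact Linked.edge (h1 x hx e1 e2)
  · cases b
    · rw [insert_inr_false]
      exact (h3 (Or.inr hx)).symm
    · rw [insert_inr_true]
      exact (h2 (Or.inr hx)).symm

theorem insert_bridgeless (H : Bridgeless s.base i.twin) :
    Bridgeless (s.addEdge k).base (i.insert h hi hk).twin where
  nonempty := ⟨none⟩
  connected := insert_total (T := Set.univ) (by simp) (by simp) (by simp) H.connected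
  internal := ⟨Sum.inr true, by simp⟩
  cut := by
    have key : ∀ x : s.L, (i.insert h hi hk).twin (Sum.inl x) ≠ Sum.inl x →
        ∀ v w, Linked (s.addEdge k).base (i.insert h hi hk).twin
          {y | y ≠ Sum.inl x ∧ y ≠ (i.insert h hi hk).twin (Sum.inl x)} v w := by
      intro x hx
      by_cases e1 : x = h
      · subst e1
        refine insert_total ?_ ?_ ?_ (H.cut x hi) <;> simp +contextual
      · by_cases e2 : x = i.twin h
        · subst e2
          refine insert_total ?_ ?_ ?_ (H.cut (i.twin h) (by rwa [i.twin_twin, ne_comm])) <;>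
            simp +contextual [i.twin_twin]
        · rw [insert_inl i h hi hk e1 e2] at hx ⊢
          refine insert_total ?_ ?_ ?_ (H.cut x fun e => hx (by rw [e])) <;> simp +contextual
    rintro (x | b) hx
    · exact key x hx
    -- Cutting at a leg of the new slot cuts the same edge as cutting at its old partner.
    · have h1 : ∃ y, (i.insert h hi hk).twin (Sum.inr b) = Sum.inl y := by cases b <;> simp
      obtain ⟨y, hy⟩ := h1
      have h2 : (i.insert h hi hk).twin (Sum.inl y) = Sum.inr b := by
        rw [← hy, (i.insert h hi hk).twin_twin]
      have := key y (by rw [h2]; exact Sum.inr_ne_inl)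
      rw [h2] at this
      intro v w
      refine (this v w).mono fun z hz => ?_
      rw [hy]
      exact ⟨hz.2, hz.1⟩

theorem bridgeless_of_insert (H : Bridgeless (s.addEdge k).base (i.insert h hi hk).twin) :
    Bridgeless s.base i.twin where
  nonempty := ⟨s.base h⟩
  connected := by
    refine total_of_insert (T := Set.univ) (s.base h) ?_ ?_ ?_ H.connected
    · simp
    · exact fun _ => Linked.refl _
    · exact fun _ => (Linked.edge (Set.mem_univ h)).symm
  internal := ⟨h, hi⟩
  cut := by
    intro x hx
    by_cases e1 : x = h
    · subst e1
      refine total_of_insert (s.base (i.twin x)) ?_ ?_ ?_ (H.cut (Sum.inl x) (by simp))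
      · simp +contextual
      · simp
      · exact fun _ => Linked.refl _
    · by_cases e2 : x = i.twin h
      · subst e2
        refine total_of_insert (s.base h) ?_ ?_ ?_ (H.cut (Sum.inl (i.twin h)) (by simp))
        · simp +contextual [i.twin_twin]
        · exact fun _ => Linked.refl _
        · simp
      · refine total_of_insert (s.base h) ?_ ?_ ?_ (H.cut (Sum.inl x) (by
          rw [insert_inl i h hi hk e1 e2]; exact fun e => hx (Sum.inl.inj e)))
        · rw [insert_inl i h hi hk e1 e2]; simp +contextual
        · exact fun _ => Linked.refl _
        · refine fun _ => (Linked.edge (S := {y | y ≠ x ∧ y ≠ i.twin x}) (h := h)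
            ⟨Ne.symm e1, fun e => e2 ?_⟩).symm
          rw [e, i.twin_twin]

theorem insert_good_iff {r : Residue} : (i.insert h hi hk).Good r ↔ i.Good r := by
  refine and_congr ⟨bridgeless_of_insert, insert_bridgeless⟩ (forall_congr' fun l => ?_)
  suffices e : Nat.card {x // i.twin x = x ∧ s.etype x = l} =
      Nat.card {x // (i.insert h hi hk).twin x = x ∧ (s.addEdge k).etype x = l} by rw [e]
  refine Nat.card_eq_of_bijective (fun x => ⟨Sum.inl x.1, ?_, x.2.2⟩) ⟨?_, ?_⟩
  · have hx := x.2.1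
    rw [insert_inl i h hi hk, hx]
    · rintro e; rw [e] at hx; exact hi hx
    · rintro e; rw [e, i.twin_twin] at hx; exact hi hx.symm
  · intro x y e
    exact Subtype.ext (Sum.inl.inj (congrArg Subtype.val e))
  · rintro ⟨x | b, h1, h2⟩
    · refine ⟨⟨x, ?_, h2⟩, rfl⟩
      by_cases e1 : x = h
      · subst e1; simp at h1
      · by_cases e2 : x = i.twin h
        · subst e2; simp at h1
        · rw [insert_inl i h hi hk e1 e2] at h1
          exact Sum.inl.inj h1
    · cases b <;> simp at h1

end insert

end Wiring

theorem addEdge_pass_inl (x : s.L) : (s.addEdge k).pass (Sum.inl x) = Sum.inl (s.pass x) := by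
  by_cases hx : ∃ y, s.Mate x y
  · obtain ⟨y, m⟩ := hx
    rw [pass_eq_of_mate m]
    exact pass_eq_of_mate ⟨congrArg some m.1, fun e => m.2.1 (Sum.inl.inj e), m.2.2⟩
  · rw [pass_eq_self hx, pass_eq_self]
    rintro ⟨y | b, h1, h2, h3⟩
    · exact hx ⟨y, Option.some.inj h1, fun e => h2 (congrArg _ e), h3⟩
    · cases h1

theorem addEdge_pass_inr (b : Bool) : (s.addEdge k).pass (Sum.inr b) = Sum.inr !b :=
  pass_eq_of_mate (s := s.addEdge k) (y := Sum.inr !b)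
    ⟨rfl, (by intro e; cases b <;> cases e), rfl⟩

theorem addEdge_keep_inr (b : Bool) : Sum.inr b ∉ (s.addEdge k).keep := by
  intro h
  cases h

namespace Wiring

variable (i : s.Wiring) (h : s.L) (hi : i.twin h ≠ h) (hk : s.etype h = k)

/-- A chain that crosses the edge of `h` makes one further step, which lands on a leg of the new
slot and hence outside `keep`. First returns among the old legs are unaffected. -/
theorem insert_reach {x y : s.L} (r : Reach i.step s.keep x y) :
    Reach (i.insert h hi hk).step (s.addEdge k).keep (Sum.inl x) (Sum.inl y) := by
  have key : ∀ x, (i.insert h hi hk).step (Sum.inl x) = Sum.inl (i.step x) ∨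
      ((i.insert h hi hk).step (Sum.inl x) ∉ (s.addEdge k).keep ∧
        (i.insert h hi hk).step ((i.insert h hi hk).step (Sum.inl x)) = Sum.inl (i.step x)) := by
    intro x
    have st : ∀ z, (i.insert h hi hk).step z =
      (i.insert h hi hk).twin ((s.addEdge k).pass z) := fun _ => rfl
    simp only [st]
    rw [addEdge_pass_inl, step_apply]
    by_cases e1 : s.pass x = h
    · rw [e1, insert_inl_self, addEdge_pass_inr]
      exact Or.inr ⟨addEdge_keep_inr _, insert_inr_false ..⟩
    · by_cases e2 : s.pass x = i.twin h
      · rw [e2, insert_inl_twin, addEdge_pass_inr, i.twin_twin]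
        exact Or.inr ⟨addEdge_keep_inr _, insert_inr_true ..⟩
      · exact Or.inl (insert_inl i h hi hk e1 e2)
  induction r with
  | last hx =>
    rename_i x
    rcases key x with e | ⟨e1, e2⟩
    · rw [← e]
      exact Reach.last (by rw [e]; exact hx)
    · refine Reach.step e1 ?_
      rw [← e2]
      exact Reach.last (by rw [e2]; exact hx)
  | step hx _ ih =>
    rename_i x y _
    rcases key x with e | ⟨e1, e2⟩
    · refine Reach.step (by rw [e]; exact hx) ?_
      rw [e]; exact ih
    · refine Reach.step e1 (Reach.step (by rw [e2]; exact hx) ?_)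
      rw [e2]; exact ih

def insertContract : FeynmanGraph.Iso i.contract (i.insert h hi hk).contract where
  onV := Equiv.ofBijective (fun a => ⟨some a.1, a.2⟩)
    ⟨fun a b e => Subtype.ext (Option.some.inj (congrArg Subtype.val e)), by
      rintro ⟨_ | a, ha⟩
      · cases ha
      · exact ⟨⟨a, ha⟩, rfl⟩⟩
  onHE := Equiv.ofBijective (fun x => ⟨Sum.inl x.1, x.2⟩)
    ⟨fun a b e => Subtype.ext (Sum.inl.inj (congrArg Subtype.val e)), by
      rintro ⟨x | b, hx⟩
      · exact ⟨⟨x, hx⟩, rfl⟩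
      · exact absurd hx (addEdge_keep_inr b)⟩
  vtype_eq a := rfl
  etype_eq x := rfl
  base_eq x := rfl
  twin_eq x := Subtype.ext (firstReturn_eq (α := s.L ⊕ Bool)
    (i.insert_reach h hi hk (i.contract_twin_reach x)))

/-- The new slot cannot keep a leg to itself. With one line attached it would hang on a bridge. With
none it would be the whole graph, which then is either a slot without an internal edge or a closed
loop without external lines. -/
theorem Good.exists_inl {j : (s.addEdge k).Wiring} {r : Residue} (hj : j.Good r) (b : Bool) :
    ∃ x, j.twin (Sum.inr b) = Sum.inl x := by
  obtain ⟨hb, hr⟩ := hj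
  rcases hx : j.twin (Sum.inr b) with x | c
  · exact ⟨x, rfl⟩
  exfalso
  -- If neither leg leads out of the new slot, the slot is a connected component by itself, and
  -- connectedness leaves no room for old legs.
  have all_inr : (∀ d, ∃ e, j.twin (Sum.inr d) = Sum.inr e) → ∀ x : s.L, False := by
    intro hd x
    have := Linked.eq_of_isolated (v := none) (w := some (s.base x)) ?_ ?_ (hb.connected _ _)
    · cases this
    · rintro (y | d) - hy
      · cases hy
      · obtain ⟨e, he⟩ := hd d
        rw [he]; rfl
    · rintro (y | d) - hy
      · rcases hz : j.twin (Sum.inl y) with z | e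
        · rw [hz] at hy; cases hy
        · obtain ⟨f, hf⟩ := hd e
          rw [← hz, j.twin_twin] at hf
          cases hf
      · rfl
  rcases hy : j.twin (Sum.inr !b) with y | d
  · have hc : c = b := by
      by_contra hc
      have : c = !b := by cases b <;> cases c <;> simp_all
      rw [← this, ← hx, j.twin_twin] at hy
      cases hy
    subst hc
    -- The slot is attached by a single edge, and cutting this edge isolates it.
    have := Linked.eq_of_isolated (v := none) (w := some (s.base y)) ?_ ?_
      (hb.cut (Sum.inr !c) (by rw [hy]; exact Sum.inl_ne_inr) _ _)
    · cases this
    · rintro (z | e) he hz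
      · cases hz
      · have : e = c := by
          by_contra hne
          apply he.1
          cases e <;> cases c <;> simp_all
        rw [this, hx]; rfl
    · rintro (z | e) he hz
      · rcases hw : j.twin (Sum.inl z) with w | e
        · rw [hw] at hz; cases hz
        · exfalso
          have hw' : j.twin (Sum.inr e) = Sum.inl z := by rw [← hw, j.twin_twin]
          by_cases hne : e = c
          · rw [hne, hx] at hw'; cases hw'
          · have h3 : e = !c := by cases e <;> cases c <;> simp_all
            rw [h3, hy] at hw'
            exact he.2 (by rw [hy, hw'])
      · rfl
  · have hd : ∀ d, ∃ e, j.twin (Sum.inr d) = Sum.inr e := by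
      intro e
      by_cases he : e = b
      · exact ⟨c, by rw [he, hx]⟩
      · have : e = !b := by cases e <;> cases b <;> simp_all
        exact ⟨d, by rw [this, hy]⟩
    by_cases hcb : c = b
    · subst hcb
      have hd' : d = !c := by
        by_contra hne
        have : d = c := by cases d <;> cases c <;> simp_all
        rw [this, ← hx] at hy
        have := congrArg j.twin hy
        rw [j.twin_twin, j.twin_twin] at this
        cases c <;> cases this
      obtain ⟨z | e, hz⟩ := hb.internal
      · exact all_inr hd z
      · apply hz
        by_cases he : e = c
        · rw [he, hx]
        · have : e = !c := by cases e <;> cases c <;> simp_all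
          rw [this, hy, hd']
    · have hc : c = !b := by cases c <;> cases b <;> simp_all
      -- The two legs are joined to each other. Such a loop has no external lines, whereas every
      -- residue has some.
      obtain ⟨l, hl⟩ := legs_ne_zero r
      apply hl
      rw [← hr l, Finite.card_eq_zero_iff]
      refine ⟨?_⟩
      rintro ⟨z | e, hz, -⟩
      · exact all_inr hd z
      · by_cases he : e = b
        · rw [he, hx, hc] at hz
          cases b <;> cases hz
        · have h3 : e = !b := by cases e <;> cases b <;> simp_all
          have h4 : j.twin (Sum.inr !b) = Sum.inr b := by rw [← hc, ← hx, j.twin_twin]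
          rw [h3, h4] at hz
          cases b <;> cases hz

open Classical in
/-- Removing the additional slot. -/
theorem Good.exists_insert {j : (s.addEdge k).Wiring} {r : Residue} (hj : j.Good r) :
    ∃ (i : s.Wiring) (h : s.L) (hi : i.twin h ≠ h) (hk : s.etype h = k), i.insert h hi hk = j := by
  obtain ⟨h, hh⟩ := hj.exists_inl true
  obtain ⟨h', hh'⟩ := hj.exists_inl false
  have eh : j.twin (Sum.inl h) = Sum.inr true := by rw [← hh, j.twin_twin]
  have eh' : j.twin (Sum.inl h') = Sum.inr false := by rw [← hh', j.twin_twin]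
  have hne : h' ≠ h := by
    rintro rfl
    rw [eh] at eh'
    cases eh'
  have other : ∀ x, x ≠ h → x ≠ h' → ∃ y, j.twin (Sum.inl x) = Sum.inl y := by
    intro x h1 h2
    rcases hx : j.twin (Sum.inl x) with y | b
    · exact ⟨y, rfl⟩
    · have := congrArg j.twin hx
      rw [j.twin_twin] at this
      cases b
      · rw [hh'] at this; exact absurd (Sum.inl.inj this) h2
      · rw [hh] at this; exact absurd (Sum.inl.inj this) h1
  -- The partners `h` and `h'` of the two legs of the slot are joined directly. The default `x` is
  -- never attained, because by `other` all remaining old legs are joined to old legs.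
  let t : s.L → s.L := fun x => if x = h then h' else if x = h' then h else
    (j.twin (Sum.inl x)).elim id fun _ => x
  have th : t h = h' := if_pos rfl
  have th' : t h' = h := (if_neg hne).trans (if_pos rfl)
  have tx : ∀ x, x ≠ h → x ≠ h' → j.twin (Sum.inl x) = Sum.inl (t x) := by
    intro x h1 h2
    obtain ⟨y, hy⟩ := other x h1 h2
    rw [hy]
    change _ = Sum.inl (ite _ _ _)
    rw [if_neg h1, if_neg h2, hy]
    rfl
  have e0 : s.etype h = k := by
    have := j.etype_twin (Sum.inr true)
    rwa [hh] at this
  have e0' : s.etype h' = k := by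
    have := j.etype_twin (Sum.inr false)
    rwa [hh'] at this
  let i : s.Wiring := ⟨t, fun x => by
      by_cases h1 : x = h
      · rw [h1, th, th']
      · by_cases h2 : x = h'
        · rw [h2, th', th]
        · have e := tx x h1 h2
          have e' := congrArg j.twin e
          rw [j.twin_twin] at e'
          have n1 : t x ≠ h := by
            intro en; rw [en, eh] at e'; cases e'
          have n2 : t x ≠ h' := by
            intro en; rw [en, eh'] at e'; cases e'
          rw [tx _ n1 n2] at e'
          exact (Sum.inl.inj e').symm, fun x => by
      by_cases h1 : x = h
      · rw [h1, th, e0, e0']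
      · by_cases h2 : x = h'
        · rw [h2, th', e0, e0']
        · have e := j.etype_twin (Sum.inl x)
          rw [tx x h1 h2] at e
          exact e⟩
  have ih : i.twin h = h' := th
  refine ⟨i, h, ih ▸ hne, e0, Wiring.ext ?_⟩
  rintro (x | b)
  · by_cases h1 : x = h
    · subst h1; rw [insert_inl_self, eh]
    · by_cases h2 : x = h'
      · have e := insert_inl_twin i h (ih ▸ hne) e0
        have e1 : (Sum.inl x : s.L ⊕ Bool) = Sum.inl (i.twin h) := by rw [h2, ih]
        rw [e1, e, ih, eh']
      · rw [insert_inl i h _ _ h1 (ih ▸ h2), tx x h1 h2]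
  · cases b
    · rw [insert_inr_false, ih, hh']
    · rw [insert_inr_true, hh]

end Wiring

/-- The number of legs of type `k`. -/
def legCount (s : Slots) (k : EdgeType) : ℕ := Nat.card {x // s.etype x = k}

theorem Wiring.Good.card_internal {i : s.Wiring} {r : Residue} (hi : i.Good r) :
    (Nat.card {x // i.twin x ≠ x ∧ s.etype x = k} : ℂ) = s.legCount k - legs r k := by
  classical
  rw [eq_sub_iff_add_eq, ← hi.2 k, ← Nat.cast_add, legCount]
  congr 1
  have := Fintype.ofFinite s.L
  simp only [Nat.card_eq_fintype_card, Fintype.card_subtype]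
  rw [← Finset.card_union_of_disjoint]
  · congr 1
    ext x
    simp only [Finset.mem_union, Finset.mem_filter, Finset.mem_univ, true_and]
    tauto
  · rw [Finset.disjoint_filter]
    tauto

/-- A good wiring with the extra slot is, in exactly one way, a good wiring without it and an
internal half-edge of type `k` into whose edge the slot is inserted; a half-edge rather than an
edge, since the two legs of the slot are distinguishable. Insertion does not change the contracted
graph. The number of internal half-edges of type `k` is the same for all good wirings, namely all
legs minus the external ones. -/
theorem wiringSum_addEdge (r : Residue) :
    (s.addEdge k).wiringSum r = ((s.legCount k : ℂ) - legs r k) • s.wiringSum r := by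
  classical
  have : ∀ i : s.Wiring, Fintype {x // i.twin x ≠ x ∧ s.etype x = k} := fun i => Fintype.ofFinite _
  unfold wiringSum
  rw [Finset.smul_sum, ← Finset.sum_filter]
  have h1 : ∀ i : s.Wiring, ((s.legCount k : ℂ) - legs r k) •
      (if i.Good r then gen i.contract r else 0) =
      ∑ h : {x // i.twin x ≠ x ∧ s.etype x = k}, if i.Good r then gen i.contract r else 0 := by
    intro i
    split_ifs with hi
    · rw [← hi.card_internal, Finset.sum_const, Finset.card_univ, Nat.card_eq_fintype_card,
        Nat.cast_smul_eq_nsmul]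
    · simp
  rw [Finset.sum_congr rfl fun i _ => h1 i, ← Fintype.sum_sigma', ← Finset.sum_filter]
  symm
  refine Finset.sum_bij (fun p _ => p.1.insert p.2.1 p.2.2.1 p.2.2.2) ?_ ?_ ?_ ?_
  · intro p hp
    simp only [Finset.mem_filter, Finset.mem_univ, true_and] at hp ⊢
    exact Wiring.insert_good_iff.mpr hp
  · rintro ⟨i, h, hi, hk⟩ - ⟨i', h', hi', hk'⟩ - e
    dsimp only at e
    have e1 := congrArg (fun j => j.twin (Sum.inr true)) e
    simp only [Wiring.insert_inr_true] at e1
    obtain rfl : h = h' := Sum.inl.inj e1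
    have e2 := congrArg (fun j => j.twin (Sum.inr false)) e
    simp only [Wiring.insert_inr_false] at e2
    have e2 := Sum.inl.inj e2
    have : i = i' := by
      refine Wiring.ext fun x => ?_
      by_cases h1 : x = h
      · rw [h1, e2]
      · by_cases h2 : x = i.twin h
        · conv_rhs => rw [h2, e2, i'.twin_twin]
          rw [h2, i.twin_twin]
        · have e3 := congrArg (fun j => j.twin (Sum.inl x)) e
          dsimp only at e3
          rw [Wiring.insert_inl i h hi hk h1 h2, Wiring.insert_inl i' h hi' hk' h1 (e2 ▸ h2)] at e3
          exact Sum.inl.inj e3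
    subst this
    rfl
  · intro j hj
    simp only [Finset.mem_filter, Finset.mem_univ, true_and] at hj
    obtain ⟨i, h, hi, hk, rfl⟩ := hj.exists_insert
    exact ⟨⟨i, h, hi, hk⟩, by simpa using Wiring.insert_good_iff.mp hj, rfl⟩
  · rintro ⟨i, h, hi, hk⟩ -
    exact (gen_of_iso (i.insertContract h hi hk) r).symm

end Slots

end QCD

namespace QCD

namespace FeynmanGraph

/-! ## Subgraphs and their complements -/

theorem component_twin_eq_self_iff {Γ : FeynmanGraph} {S : Set Γ.HE}
    (hi : ∀ h ∈ S, Γ.twin h ≠ h) (hS : ∀ h ∈ S, Γ.twin h ∈ S) {c : Γ.Comp S}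
    (h : (component S hS c).HE) : (component S hS c).twin h = h ↔ h.1 ∉ S := by
  by_cases hh : h.1 ∈ S
  · have e : (component S hS c).twin h = ⟨Γ.twin h.1, (compOf_twin hh).trans h.2⟩ := dif_pos hh
    rw [e]
    exact ⟨fun e => absurd (congrArg Subtype.val e) (hi _ hh), fun h => absurd hh h⟩
  · exact ⟨fun _ => hh, fun _ => dif_neg hh⟩

theorem component_twin_of_mem {Γ : FeynmanGraph} {S : Set Γ.HE} (hS : ∀ h ∈ S, Γ.twin h ∈ S)
    {c : Γ.Comp S} (h : (component S hS c).HE) (hh : h.1 ∈ S) :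
    ((component S hS c).twin h).1 = Γ.twin h.1 := by
  simp [hh, component]

namespace Subgraph

variable {Γ : FeynmanGraph} (γ : Γ.Subgraph)

/-- The components of a subgraph, with their external lines as legs. -/
abbrev slots : Slots where
  A := Γ.Comp γ.S
  L := {h // h ∉ γ.S}
  finA := inferInstance
  finL := inferInstance
  res := γ.res
  etype h := Γ.etype h.1
  base h := Γ.compOf γ.S h.1
  valence c k := by
    refine Eq.trans ?_ (γ.legs_eq c k)
    refine Nat.card_eq_of_bijective (fun x => ⟨⟨x.1.1, x.2.1⟩,
      (component_twin_eq_self_iff γ.internal _ _).mpr x.1.2, x.2.2⟩) ⟨?_, ?_⟩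
    · intro x y e
      exact Subtype.ext (Subtype.ext (congrArg (fun z => z.1.1) e))
    · rintro ⟨⟨h, hc⟩, h1, h2⟩
      exact ⟨⟨⟨h, (component_twin_eq_self_iff γ.internal _ _).mp h1⟩, hc, h2⟩, rfl⟩

theorem twin_not_mem {h : Γ.HE} (hh : h ∉ γ.S) : Γ.twin h ∉ γ.S := fun h' => hh (by
  have := γ.twin_mem _ h'
  rwa [Γ.twin_twin] at this)

/-- The edges outside a subgraph. -/
def wiring : γ.slots.Wiring where
  twin h := ⟨Γ.twin h.1, γ.twin_not_mem h.2⟩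
  twin_twin _ := Subtype.ext (Γ.twin_twin _)
  etype_twin _ := Γ.etype_twin _

theorem pass_eq_of_mate {h h' : Γ.HE} (m : γ.Mate h h') : γ.pass h = h' := by
  have hx : ∃ y, γ.Mate h y := ⟨h', m⟩
  unfold pass
  rw [dif_pos hx]
  exact hx.choose_spec.unique m

theorem slots_pass (x : γ.slots.L) : (γ.slots.pass x).1 = γ.pass x.1 := by
  by_cases hx : ∃ y, γ.slots.Mate x y
  · obtain ⟨y, m⟩ := hx
    rw [Slots.pass_eq_of_mate m, γ.pass_eq_of_mate (h' := y.1)]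
    exact ⟨x.2, y.2, fun e => m.2.1 (Subtype.ext e), m.1, m.2.2⟩
  · rw [Slots.pass_eq_self hx]
    have h0 : ¬ ∃ y, γ.Mate x.1 y := by
      rintro ⟨y, m⟩
      exact hx ⟨⟨y, m.2.1⟩, m.2.2.2.1, fun e => m.2.2.1 (congrArg Subtype.val e), m.2.2.2.2⟩
    have e : γ.pass x.1 = x.1 := dif_neg h0
    exact e.symm

/-- `Γ/γ` is obtained from the slots of `γ`. -/
def contractIso : Iso γ.contract γ.wiring.contract where
  onV := Equiv.refl _
  onHE := ⟨fun h => ⟨⟨h.1, h.2.1⟩, h.2.2⟩, fun x => ⟨x.1.1, x.1.2, x.2⟩, fun _ => rfl,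
    fun _ => rfl⟩
  vtype_eq a := rfl
  etype_eq x := rfl
  base_eq x := rfl
  twin_eq x := by
    refine Subtype.ext (Subtype.ext (Eq.symm ?_))
    refine firstReturn_eq (α := Γ.HE) (b := x) ?_
    refine (γ.wiring.contract_twin_reach ⟨⟨x.1, x.2.1⟩, x.2.2⟩).map (β := Γ.HE) Subtype.val
      (fun y => congrArg Γ.twin (γ.slots_pass y).symm) (fun y => ?_)
    exact ⟨fun h => h.2, fun h => ⟨y.2, h⟩⟩

/-- Each component of `γ` that has an edge is itself one-particle irreducible, so cutting one of its
edges does not separate its vertices. -/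
theorem linked_cut {h : Γ.HE} (hh : h ∈ γ.S) {v w : Γ.V} (hvw : Linked Γ.base Γ.twin γ.S v w) :
    Linked Γ.base Γ.twin (γ.S ∩ {x | x ≠ h ∧ x ≠ Γ.twin h}) v w := by
  have key : Linked Γ.base Γ.twin (γ.S ∩ {x | x ≠ h ∧ x ≠ Γ.twin h}) (Γ.base h)
      (Γ.base (Γ.twin h)) := by
    have h1 := (γ.onePI h hh).cut ⟨h, rfl⟩
      (fun e => (component_twin_eq_self_iff γ.internal _ _).mp e hh) ⟨Γ.base h, rfl⟩
      ⟨Γ.base (Γ.twin h), compOf_twin hh⟩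
    refine Linked.lift (base := (component γ.S γ.twin_mem (Γ.compOf γ.S h)).base)
      (twin := (component γ.S γ.twin_mem (Γ.compOf γ.S h)).twin) Subtype.val (fun x hx => ?_) h1
    by_cases hxS : x.1 ∈ γ.S
    · have h2 : Γ.base ((component γ.S γ.twin_mem (Γ.compOf γ.S h)).twin x).1 =
          Γ.base (Γ.twin x.1) := by rw [component_twin_of_mem γ.twin_mem x hxS]
      refine (Linked.edge (h := x.1) (base := Γ.base) (twin := Γ.twin)
        (by
          refine ⟨hxS, fun e => hx.1 (Subtype.ext e), fun e => hx.2 (Subtype.ext ?_)⟩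
          exact e.trans (component_twin_of_mem γ.twin_mem ⟨h, rfl⟩ hh).symm)).trans ?_
      rw [← h2]; exact Linked.refl _
    · rw [(component_twin_eq_self_iff γ.internal γ.twin_mem x).mpr hxS]
      exact Linked.refl _
  refine Linked.lift (V' := Γ.V) id (fun x hx => ?_) hvw
  by_cases e1 : x = h
  · subst e1; exact key
  · by_cases e2 : x = Γ.twin h
    · subst e2; rw [Γ.twin_twin]; exact key.symm
    · exact Linked.edge ⟨hx, e1, e2⟩

theorem total_slots {T : Set Γ.HE} (H : ∀ v w, Linked Γ.base Γ.twin T v w) (a b : γ.slots.A) :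
    Linked γ.slots.base γ.wiring.twin {x | x.1 ∈ T} a b := by
  refine Linked.total_of_retract (base := Γ.base) (twin := Γ.twin) (V' := γ.slots.A)
    (fun v => Quotient.mk _ v) (fun x hx => ?_) (fun y => ?_) H a b
  · by_cases hxS : x ∈ γ.S
    · have := compOf_twin (Γ := Γ) hxS
      unfold compOf at this
      rw [this]; exact Linked.refl _
    · exact Linked.edge (base := γ.slots.base) (twin := γ.wiring.twin) (h := ⟨x, hxS⟩) hx
  · obtain ⟨v, rfl⟩ := Quotient.exists_rep y
    exact ⟨v, Linked.refl _⟩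

theorem total_of_slots {T : Set Γ.HE}
    (hT : ∀ v w, Linked Γ.base Γ.twin γ.S v w → Linked Γ.base Γ.twin T v w)
    (H : ∀ a b, Linked γ.slots.base γ.wiring.twin {x | x.1 ∈ T} a b) (v w : Γ.V) :
    Linked Γ.base Γ.twin T v w := by
  have ho : ∀ v, Linked Γ.base Γ.twin T (Quotient.out (Quotient.mk (Γ.compSetoid γ.S) v)) v :=
    fun v => hT _ _ (Quotient.exact (Quotient.out_eq (Quotient.mk (Γ.compSetoid γ.S) v)))
  refine Linked.total_of_retract (base := γ.slots.base) (twin := γ.wiring.twin)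
    (fun c : Γ.Comp γ.S => c.out) (fun x hx => ?_) (fun v => ⟨Quotient.mk _ v, ho v⟩) H v w
  exact (ho _).trans ((Linked.edge (h := x.1) hx).trans (ho _).symm)

/-- Shrinking connected, bridgeless pieces neither creates nor destroys connectedness or bridges.
Only the existence of an internal edge can be lost, and it is lost exactly when `γ` contains all of
them. A good wiring thus expresses both that `Γ` is one-particle irreducible and that `γ` is proper.
-/
theorem bridgeless_slots_iff : Bridgeless γ.slots.base γ.wiring.twin ↔
    Γ.IsOnePI ∧ γ.S ≠ {h | Γ.twin h ≠ h} := by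
  rw [isOnePI_iff]
  constructor
  · intro H
    refine ⟨⟨H.nonempty.map Quotient.out, γ.total_of_slots (T := Set.univ)
      (fun v w => Linked.mono (Set.subset_univ _)) (by simpa using H.connected), fun h hh => ?_,
      ?_⟩, ?_⟩
    -- An edge of `γ` is bypassed inside its component; any other edge is an edge between slots,
    -- whose cut is controlled by `H`.
    · by_cases hS : h ∈ γ.S
      · refine γ.total_of_slots (fun v w hvw => (γ.linked_cut hS hvw).mono Set.inter_subset_right)
          fun a b => (H.connected a b).mono fun x _ => ?_
        exact ⟨fun e => x.2 (e ▸ hS), fun e => x.2 (e ▸ γ.twin_mem _ hS)⟩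
      · refine γ.total_of_slots (fun v w => Linked.mono fun x hx => ?_) fun a b =>
          (H.cut ⟨h, hS⟩ (fun e => hh (congrArg Subtype.val e)) a b).mono fun x hx => ?_
        · exact ⟨fun e => hS (e ▸ hx), fun e => γ.twin_not_mem hS (e ▸ hx)⟩
        · exact ⟨fun e => hx.1 (Subtype.ext e), fun e => hx.2 (Subtype.ext e)⟩
    · obtain ⟨x, hx⟩ := H.internal
      exact ⟨x.1, fun e => hx (Subtype.ext e)⟩
    · intro e
      obtain ⟨x, hx⟩ := H.internal
      apply x.2
      exact e.symm.subset fun e' => hx (Subtype.ext e')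
  · rintro ⟨H, hS⟩
    refine ⟨H.nonempty.map fun v => Quotient.mk _ v, ?_, fun h hh a b => ?_, ?_⟩
    · simpa using γ.total_slots H.connected
    · refine (γ.total_slots (H.cut h.1 fun e => hh (Subtype.ext e)) a b).mono fun x hx => ?_
      exact ⟨fun e => hx.1 (congrArg Subtype.val e), fun e => hx.2 (congrArg Subtype.val e)⟩
    · by_contra! hall
      apply hS
      refine Set.Subset.antisymm γ.internal fun x hx => ?_
      by_contra hxS
      exact hx (congrArg Subtype.val (hall ⟨x, hxS⟩))

theorem extCount_eq (k : EdgeType) :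
    Γ.extCount k = Nat.card {x // γ.wiring.twin x = x ∧ γ.slots.etype x = k} :=
  Nat.card_eq_of_bijective (fun h => ⟨⟨h.1, fun hS => γ.internal _ hS h.2.1⟩,
      Subtype.ext h.2.1, h.2.2⟩)
    ⟨fun _ _ e => Subtype.ext (congrArg (fun z => z.1.1) e),
      fun x => ⟨⟨x.1.1, congrArg Subtype.val x.2.1, x.2.2⟩, rfl⟩⟩

theorem good_wiring_iff (r : Residue) : γ.wiring.Good r ↔
    (Γ.IsOnePI ∧ ∀ k, Γ.extCount k = legs r k) ∧ γ.S ≠ {h | Γ.twin h ≠ h} := by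
  unfold Slots.Wiring.Good
  rw [bridgeless_slots_iff]
  simp only [extCount_eq γ]
  tauto

end Subgraph

end FeynmanGraph

end QCD

namespace QCD

set_option linter.unusedSectionVars false

theorem Linked.const {V HE X : Type} {base : HE → V} {twin : HE → HE} {S : Set HE} (f : V → X)
    (h : ∀ x ∈ S, f (base x) = f (base (twin x))) {v w : V} (hvw : Linked base twin S v w) :
    f v = f w := by
  induction hvw with
  | rel v w hr =>
    obtain ⟨x, hx, rfl, rfl⟩ := hr
    exact h x hx
  | refl => rfl
  | symm _ _ _ ih => exact ih.symm
  | trans _ _ _ _ _ i1 i2 => exact i1.trans i2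

/-! ## Gluing graphs -/

/-- `Δ` may be put into a slot with residue `r`: it is a single vertex of that type, or a
one-particle irreducible graph with the legs of `r`. -/
structure Fits (Δ : FeynmanGraph) (r : Residue) : Prop where
  nonempty : Nonempty Δ.V
  connected : ∀ v w, Linked Δ.base Δ.twin Set.univ v w
  legs_eq : ∀ k, Δ.extCount k = legs r k
  onePI : (∃ h, Δ.twin h ≠ h) → Δ.IsOnePI
  res_eq : (∀ h, Δ.twin h = h) → ∀ v, r = Sum.inr (Δ.vtype v)

section Glue

variable {A : Type} [Finite A] {δ : A → FeynmanGraph} {ρ : A → Residue}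

/-- The slots filled by the graphs `δ a`, with the external lines of these as legs. -/
abbrev fillSlots (δ : A → FeynmanGraph) (ρ : A → Residue) (hδ : ∀ a, Fits (δ a) (ρ a)) : Slots where
  A := A
  L := {x : Σ a, (δ a).HE // (δ x.1).twin x.2 = x.2}
  finA := inferInstance
  finL := inferInstance
  res := ρ
  etype x := (δ x.1.1).etype x.1.2
  base x := x.1.1
  valence a k := by
    refine Eq.trans ?_ ((hδ a).legs_eq k)
    refine (Nat.card_eq_of_bijective (fun h => ⟨⟨⟨a, h.1⟩, h.2.1⟩, rfl, h.2.2⟩) ⟨?_, ?_⟩).symm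
    · intro x y e
      have h := congrArg Subtype.val (congrArg Subtype.val e)
      exact Subtype.ext (eq_of_heq (Sigma.mk.inj h).2)
    · rintro ⟨⟨⟨b, h⟩, h1⟩, h2, h3⟩
      dsimp only at h2
      subst h2
      exact ⟨⟨h, h1, h3⟩, rfl⟩

variable (hδ : ∀ a, Fits (δ a) (ρ a))

open Classical in
/-- The graph obtained by joining the external lines of the graphs `δ a`. -/
def glue (i : (fillSlots δ ρ hδ).Wiring) : FeynmanGraph where
  V := Σ a, (δ a).V
  HE := Σ a, (δ a).HE
  finV := inferInstance
  finHE := inferInstance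
  vtype v := (δ v.1).vtype v.2
  etype x := (δ x.1).etype x.2
  base x := ⟨x.1, (δ x.1).base x.2⟩
  twin x := if h : (δ x.1).twin x.2 = x.2 then (i.twin ⟨x, h⟩).1 else ⟨x.1, (δ x.1).twin x.2⟩
  twin_twin x := by
    by_cases h : (δ x.1).twin x.2 = x.2
    · have h2 : (δ (i.twin ⟨x, h⟩).1.1).twin (i.twin ⟨x, h⟩).1.2 = (i.twin ⟨x, h⟩).1.2 :=
        (i.twin ⟨x, h⟩).2
      rw [dif_pos h, dif_pos h2]
      exact congrArg Subtype.val (i.twin_twin ⟨x, h⟩)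
    · have h2 : ¬ (δ x.1).twin ((δ x.1).twin x.2) = (δ x.1).twin x.2 := by
        rw [(δ x.1).twin_twin]; exact fun e => h e.symm
      rw [dif_neg h, dif_neg h2, (δ x.1).twin_twin]
  etype_twin x := by
    by_cases h : (δ x.1).twin x.2 = x.2
    · rw [dif_pos h]; exact i.etype_twin ⟨x, h⟩
    · rw [dif_neg h]; exact (δ x.1).etype_twin _
  valence v k := by
    refine Eq.trans ?_ ((δ v.1).valence v.2 k)
    obtain ⟨a, v⟩ := v
    refine (Nat.card_eq_of_bijective
      (fun h => ⟨⟨a, h.1⟩, congrArg (Sigma.mk a) h.2.1, h.2.2⟩) ⟨?_, ?_⟩).symm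
    · intro x y e
      have h := congrArg Subtype.val e
      exact Subtype.ext (eq_of_heq (Sigma.mk.inj h).2)
    · dsimp only
      rintro ⟨⟨b, h⟩, h2, h3⟩
      obtain ⟨rfl, h2⟩ := Sigma.mk.inj h2
      exact ⟨⟨h, eq_of_heq h2, h3⟩, rfl⟩

/-- Ways to assemble `Γ` from the graphs `δ a`. -/
structure Assembly (δ : A → FeynmanGraph) (Γ : FeynmanGraph) where
  onV : (Σ a, (δ a).V) ≃ Γ.V
  onHE : (Σ a, (δ a).HE) ≃ Γ.HE
  vtype_eq : ∀ v, Γ.vtype (onV v) = (δ v.1).vtype v.2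
  etype_eq : ∀ x, Γ.etype (onHE x) = (δ x.1).etype x.2
  base_eq : ∀ x, Γ.base (onHE x) = onV ⟨x.1, (δ x.1).base x.2⟩
  twin_eq : ∀ x, (δ x.1).twin x.2 ≠ x.2 → Γ.twin (onHE x) = onHE ⟨x.1, (δ x.1).twin x.2⟩

variable {Γ : FeynmanGraph}

theorem Assembly.ext {z z' : Assembly δ Γ} (h1 : ∀ v, z.onV v = z'.onV v)
    (h2 : ∀ x, z.onHE x = z'.onHE x) : z = z' := by
  cases z; cases z'
  obtain rfl := Equiv.ext h1
  obtain rfl := Equiv.ext h2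
  rfl

instance : Finite (Assembly δ Γ) :=
  Finite.of_injective (β := ((Σ a, (δ a).V) ≃ Γ.V) × ((Σ a, (δ a).HE) ≃ Γ.HE))
    (fun z => (z.onV, z.onHE)) fun z z' h => Assembly.ext
      (fun v => by rw [(Prod.mk.inj h).1]) (fun v => by rw [(Prod.mk.inj h).2])

instance : Fintype (Assembly δ Γ) := Fintype.ofFinite _

theorem Assembly.twin_external (z : Assembly δ Γ) {x y : Σ a, (δ a).HE}
    (hx : (δ x.1).twin x.2 = x.2) (hy : Γ.twin (z.onHE x) = z.onHE y) :
    (δ y.1).twin y.2 = y.2 := by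
  by_contra h
  have h1 := z.twin_eq y h
  rw [← hy, Γ.twin_twin] at h1
  have h2 := z.onHE.injective h1
  rw [h2] at hx
  exact h ((δ y.1).twin_twin _ ▸ hx).symm

/-- The edges of `Γ` joining different `δ a`. -/
def Assembly.wiring (z : Assembly δ Γ) : (fillSlots δ ρ hδ).Wiring where
  twin x := ⟨z.onHE.symm (Γ.twin (z.onHE x.1)), z.twin_external x.2 (by simp)⟩
  twin_twin x := Subtype.ext (by simp [Γ.twin_twin])
  etype_twin x := by
    change (δ _).etype _ = (δ _).etype _
    rw [← z.etype_eq, Equiv.apply_symm_apply, Γ.etype_twin, z.etype_eq]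

def Assembly.glueIso (z : Assembly δ Γ) : FeynmanGraph.Iso (glue hδ (z.wiring hδ)) Γ where
  onV := z.onV
  onHE := z.onHE
  vtype_eq := z.vtype_eq
  etype_eq := z.etype_eq
  base_eq := z.base_eq
  twin_eq x := by
    by_cases h : (δ x.1).twin x.2 = x.2
    · have : (glue hδ (z.wiring hδ)).twin x = ((z.wiring hδ).twin ⟨x, h⟩).1 := dif_pos h
      rw [this]
      exact (z.onHE.apply_symm_apply _).symm
    · have : (glue hδ (z.wiring hδ)).twin x = ⟨x.1, (δ x.1).twin x.2⟩ := dif_neg h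
      rw [this]
      exact z.twin_eq x h

def Assembly.ofGlue {i : (fillSlots δ ρ hδ).Wiring} (f : FeynmanGraph.Iso (glue hδ i) Γ) :
    Assembly δ Γ where
  onV := f.onV
  onHE := f.onHE
  vtype_eq := f.vtype_eq
  etype_eq := f.etype_eq
  base_eq := f.base_eq
  twin_eq x h := by
    have : (glue hδ i).twin x = ⟨x.1, (δ x.1).twin x.2⟩ := dif_neg h
    rw [← this]
    exact f.twin_eq x

theorem Assembly.wiring_ofGlue {i : (fillSlots δ ρ hδ).Wiring}
    (f : FeynmanGraph.Iso (glue hδ i) Γ) : (Assembly.ofGlue hδ f).wiring hδ = i := by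
  refine Slots.Wiring.ext fun x => Subtype.ext ?_
  have h1 : f.onHE.symm (Γ.twin (f.onHE x.1)) = (glue hδ i).twin x.1 :=
    f.onHE.symm_apply_eq.mpr (f.twin_eq x.1)
  exact h1.trans (dif_pos x.2)

/-- To assemble `Γ` is to choose how the external lines of the pieces are joined and an isomorphism
from the result to `Γ`. In this way assemblies are counted by isomorphisms, wiring by wiring, and
these cancel against symmetry factors. -/
def glueEquiv (Γ : FeynmanGraph) :
    (Σ i : (fillSlots δ ρ hδ).Wiring, FeynmanGraph.Iso (glue hδ i) Γ) ≃ Assembly δ Γ where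
  toFun p := Assembly.ofGlue hδ p.2
  invFun z := ⟨z.wiring hδ, z.glueIso hδ⟩
  left_inv p := by
    obtain ⟨i, f⟩ := p
    refine Sigma.ext (Assembly.wiring_ofGlue hδ f) ?_
    have key : ∀ (j : (fillSlots δ ρ hδ).Wiring) (e : j = i)
        (g : FeynmanGraph.Iso (glue hδ j) Γ), (∀ v, g.onV v = f.onV v) →
        (∀ v, g.onHE v = f.onHE v) → HEq g f := by
      rintro j rfl g h1 h2
      exact heq_of_eq (FeynmanGraph.Iso.ext h1 h2)
    exact key _ (Assembly.wiring_ofGlue hδ f) _ (fun _ => rfl) (fun _ => rfl)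
  right_inv z := rfl

/-- A subgraph of `Γ` whose components are identified with the graphs `δ a`. -/
structure Dissection (δ : A → FeynmanGraph) (ρ : A → Residue) (Γ : FeynmanGraph) where
  sub : Γ.Subgraph
  slot : A ≃ Γ.Comp sub.S
  res_eq : ∀ a, sub.res (slot a) = ρ a
  iso : ∀ a, FeynmanGraph.Iso (δ a) (FeynmanGraph.component sub.S sub.twin_mem (slot a))

namespace Dissection

variable (w : Dissection δ ρ Γ)

def onV : (Σ a, (δ a).V) ≃ Γ.V :=
  (Equiv.sigmaCongr w.slot fun a => (w.iso a).onV).trans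
    (Equiv.sigmaFiberEquiv fun v => (Quotient.mk _ v : Γ.Comp w.sub.S))

def onHE : (Σ a, (δ a).HE) ≃ Γ.HE :=
  (Equiv.sigmaCongr w.slot fun a => (w.iso a).onHE).trans
    (Equiv.sigmaFiberEquiv (Γ.compOf w.sub.S))

theorem onHE_apply (a : A) (h : (δ a).HE) : w.onHE ⟨a, h⟩ = ((w.iso a).onHE h).1 := rfl

theorem onHE_mem_iff (x : Σ a, (δ a).HE) :
    w.onHE x ∈ w.sub.S ↔ (δ x.1).twin x.2 ≠ x.2 := by
  obtain ⟨a, h⟩ := x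
  rw [onHE_apply, ← not_iff_not, not_not,
    ← FeynmanGraph.component_twin_eq_self_iff w.sub.internal w.sub.twin_mem, (w.iso a).twin_eq]
  exact (w.iso a).onHE.injective.eq_iff

def toAssembly : Assembly δ Γ where
  onV := w.onV
  onHE := w.onHE
  vtype_eq v := (w.iso v.1).vtype_eq v.2
  etype_eq x := (w.iso x.1).etype_eq x.2
  base_eq x := congrArg Subtype.val ((w.iso x.1).base_eq x.2)
  twin_eq x h := by
    obtain ⟨a, h'⟩ := x
    have h1 := congrArg Subtype.val ((w.iso a).twin_eq h')
    rw [FeynmanGraph.component_twin_of_mem] at h1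
    · exact h1
    · exact (w.onHE_mem_iff ⟨a, h'⟩).mpr h

/-- The slots of the subgraph are the slots filled by the `δ a`. -/
def slotsIso : Slots.Iso (fillSlots δ ρ hδ) w.sub.slots where
  onA := w.slot
  onL := w.onHE.subtypeEquiv fun x => by rw [w.onHE_mem_iff, not_not]
  res_eq := w.res_eq
  etype_eq x := (w.iso x.1.1).etype_eq x.1.2
  base_eq x := ((w.iso x.1.1).onHE x.1.2).2

theorem slotsIso_twin (x : (fillSlots δ ρ hδ).L) :
    w.sub.wiring.twin ((w.slotsIso hδ).onL x) =
      (w.slotsIso hδ).onL ((w.toAssembly.wiring hδ).twin x) :=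
  Subtype.ext (w.onHE.apply_symm_apply _).symm

theorem good_iff (r : Residue) : w.sub.wiring.Good r ↔ (w.toAssembly.wiring hδ).Good r :=
  (w.slotsIso hδ).good_iff (w.slotsIso_twin hδ) r

theorem gen_contract (r : Residue) :
    gen w.sub.contract r = gen (w.toAssembly.wiring hδ).contract r := by
  rw [← gen_of_iso w.sub.contractIso, gen_of_iso ((w.slotsIso hδ).contract (w.slotsIso_twin hδ))]

/-- The assembly remembers the dissection. The half-edges of the subgraph are the images of the
internal half-edges of the pieces, a slot is located by any vertex of its piece (no piece is empty),
and the residues are prescribed by `ρ`. -/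
theorem toAssembly_injective (hδ : ∀ a, Fits (δ a) (ρ a)) :
    Function.Injective (toAssembly : Dissection δ ρ Γ → Assembly δ Γ) := by
  intro w w' e
  have hS : w.sub.S = w'.sub.S := by
    ext h
    obtain ⟨x, rfl⟩ := w.onHE.surjective h
    have e1 : w.onHE x = w'.onHE x := congrArg (fun z => z.onHE x) e
    rw [w.onHE_mem_iff, e1, w'.onHE_mem_iff]
  have eV : ∀ v, w.onV v = w'.onV v := fun v => congrArg (fun z => z.onV v) e
  have eH : ∀ v, w.onHE v = w'.onHE v := fun v => congrArg (fun z => z.onHE v) e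
  obtain ⟨⟨S, a1, a2, res, a3, a4, a5⟩, slot, a6, iso⟩ := w
  obtain ⟨⟨S', b1, b2, res', b3, b4, b5⟩, slot', b6, iso'⟩ := w'
  dsimp only at hS
  subst hS
  have hs : slot = slot' := by
    ext a
    obtain ⟨v⟩ := (hδ a).nonempty
    have h1 := ((iso a).onV v).2
    have h2 := ((iso' a).onV v).2
    have h3 : ((iso a).onV v).1 = ((iso' a).onV v).1 := eV ⟨a, v⟩
    rw [← h1, ← h2, h3]
  subst hs
  have hr : res = res' := by
    ext1 c
    obtain ⟨a, rfl⟩ := slot.surjective c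
    exact (a6 a).trans (b6 a).symm
  subst hr
  have hi : iso = iso' := by
    ext1 a
    exact FeynmanGraph.Iso.ext (fun v => Subtype.ext (eV ⟨a, v⟩))
      (fun v => Subtype.ext (eH ⟨a, v⟩))
  subst hi
  rfl

end Dissection

namespace Assembly

variable (z : Assembly δ Γ)

/-- The half-edges of `Γ` inside the `δ a`. -/
def inner : Set Γ.HE := {h | (δ (z.onHE.symm h).1).twin (z.onHE.symm h).2 ≠ (z.onHE.symm h).2}

theorem onHE_mem_inner (x : Σ a, (δ a).HE) : z.onHE x ∈ z.inner ↔ (δ x.1).twin x.2 ≠ x.2 := by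
  change (δ (z.onHE.symm (z.onHE x)).1).twin (z.onHE.symm (z.onHE x)).2 ≠ _ ↔ _
  rw [Equiv.symm_apply_apply]

theorem inner_internal : ∀ h ∈ z.inner, Γ.twin h ≠ h := by
  intro h hh
  obtain ⟨x, rfl⟩ := z.onHE.surjective h
  rw [onHE_mem_inner] at hh
  rw [z.twin_eq x hh]
  intro e
  exact hh (eq_of_heq (Sigma.mk.inj (z.onHE.injective e)).2)

theorem inner_twin : ∀ h ∈ z.inner, Γ.twin h ∈ z.inner := by
  intro h hh
  obtain ⟨x, rfl⟩ := z.onHE.surjective h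
  rw [onHE_mem_inner] at hh
  rw [z.twin_eq x hh, onHE_mem_inner]
  dsimp only
  rw [(δ x.1).twin_twin]
  exact hh.symm

/-- Inner edges stay within one piece and each piece is connected, so the components cut out by
`inner` are precisely the pieces. -/
theorem linked_iff (hδ : ∀ a, Fits (δ a) (ρ a)) (v w : Γ.V) :
    Linked Γ.base Γ.twin z.inner v w ↔ (z.onV.symm v).1 = (z.onV.symm w).1 := by
  constructor
  · refine Linked.const (fun v => (z.onV.symm v).1) fun h hh => ?_
    obtain ⟨x, rfl⟩ := z.onHE.surjective h
    rw [onHE_mem_inner] at hh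
    rw [z.twin_eq x hh, z.base_eq, z.base_eq, Equiv.symm_apply_apply, Equiv.symm_apply_apply]
  · intro e
    obtain ⟨⟨a, v⟩, rfl⟩ := z.onV.surjective v
    obtain ⟨⟨b, w⟩, rfl⟩ := z.onV.surjective w
    rw [Equiv.symm_apply_apply, Equiv.symm_apply_apply] at e
    dsimp only at e
    subst e
    refine Linked.lift (V' := Γ.V) (fun v => z.onV ⟨a, v⟩) (fun h _ => ?_) ((hδ a).connected v w)
    by_cases hh : (δ a).twin h = h
    · rw [hh]; exact Linked.refl _
    · have h1 := Linked.edge (base := Γ.base) (twin := Γ.twin)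
        ((z.onHE_mem_inner ⟨a, h⟩).mpr hh)
      rwa [z.twin_eq _ hh, z.base_eq, z.base_eq] at h1

def slot : A ≃ Γ.Comp z.inner :=
  (Equiv.ofBijective (Quotient.lift (fun v => (z.onV.symm v).1)
    fun v w => (z.linked_iff hδ v w).mp) ⟨by
      intro c c'
      induction c using Quotient.inductionOn
      induction c' using Quotient.inductionOn
      exact fun e => Quotient.sound ((z.linked_iff hδ _ _).mpr e), fun a => by
      obtain ⟨v⟩ := (hδ a).nonempty
      refine ⟨Quotient.mk _ (z.onV ⟨a, v⟩), ?_⟩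
      change (z.onV.symm (z.onV ⟨a, v⟩)).1 = a
      rw [Equiv.symm_apply_apply]⟩).symm

theorem slot_symm_mk (v : Γ.V) :
    (z.slot hδ).symm (Quotient.mk _ v : Γ.Comp z.inner) = (z.onV.symm v).1 := rfl

theorem slot_eq_iff (a : A) (v : Γ.V) :
    (Quotient.mk _ v : Γ.Comp z.inner) = z.slot hδ a ↔ (z.onV.symm v).1 = a := by
  rw [← slot_symm_mk hδ z, Equiv.symm_apply_eq]

theorem slot_onV (a : A) (v : (δ a).V) :
    (Quotient.mk _ (z.onV ⟨a, v⟩) : Γ.Comp z.inner) = z.slot hδ a := by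
  rw [slot_eq_iff, Equiv.symm_apply_apply]

theorem slot_onHE (a : A) (h : (δ a).HE) :
    Γ.compOf z.inner (z.onHE ⟨a, h⟩) = z.slot hδ a := by
  unfold FeynmanGraph.compOf
  rw [z.base_eq]
  exact z.slot_onV hδ a _

def componentIso (a : A) :
    FeynmanGraph.Iso (δ a) (FeynmanGraph.component z.inner z.inner_twin (z.slot hδ a)) where
  onV := Equiv.ofBijective (fun v => ⟨z.onV ⟨a, v⟩, z.slot_onV hδ a v⟩) ⟨by
      intro v w e
      exact eq_of_heq (Sigma.mk.inj (z.onV.injective (congrArg Subtype.val e))).2, by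
      rintro ⟨v, hv⟩
      obtain ⟨⟨b, v⟩, rfl⟩ := z.onV.surjective v
      rw [slot_eq_iff, Equiv.symm_apply_apply] at hv
      dsimp only at hv
      subst hv
      exact ⟨v, rfl⟩⟩
  onHE := Equiv.ofBijective (fun h => ⟨z.onHE ⟨a, h⟩, z.slot_onHE hδ a h⟩) ⟨by
      intro v w e
      exact eq_of_heq (Sigma.mk.inj (z.onHE.injective (congrArg Subtype.val e))).2, by
      rintro ⟨h, hh⟩
      obtain ⟨⟨b, h⟩, rfl⟩ := z.onHE.surjective h
      rw [slot_onHE hδ z] at hh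
      obtain rfl := (z.slot hδ).injective hh
      exact ⟨h, rfl⟩⟩
  vtype_eq v := z.vtype_eq ⟨a, v⟩
  etype_eq h := z.etype_eq ⟨a, h⟩
  base_eq h := Subtype.ext (z.base_eq ⟨a, h⟩)
  twin_eq h := by
    by_cases hh : (δ a).twin h = h
    · rw [hh]
      refine (FeynmanGraph.component_twin_eq_self_iff z.inner_internal z.inner_twin _).mpr ?_
      exact fun e => (z.onHE_mem_inner ⟨a, h⟩).mp e hh
    · refine Subtype.ext ?_
      rw [FeynmanGraph.component_twin_of_mem]
      · exact z.twin_eq ⟨a, h⟩ hh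
      · exact (z.onHE_mem_inner ⟨a, h⟩).mpr hh

/-- The subgraph whose components are the `δ a`. -/
def sub : Γ.Subgraph where
  S := z.inner
  internal := z.inner_internal
  twin_mem := z.inner_twin
  res c := ρ ((z.slot hδ).symm c)
  res_trivial v hv := by
    obtain ⟨⟨a, v⟩, rfl⟩ := z.onV.surjective v
    rw [slot_onV hδ, Equiv.symm_apply_apply, z.vtype_eq]
    -- A vertex without inner edges is isolated in its piece. The piece is connected, hence it is
    -- this one vertex and has no internal edge, and its residue is the type of the vertex.
    refine (hδ a).res_eq ?_ v
    by_contra! hex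
    obtain ⟨h, hh⟩ := hex
    have key : ∀ x : (δ a).HE, (δ a).base x = v → (δ a).twin x = x := by
      intro x hx
      by_contra hne
      exact hv (z.onHE ⟨a, x⟩) (by rw [z.base_eq, hx]) ((z.onHE_mem_inner ⟨a, x⟩).mpr hne)
    have h1 := Linked.eq_of_isolated (fun x _ hx => by rw [key x hx, hx])
      (fun x _ hx => by
        have := key _ hx
        rw [(δ a).twin_twin] at this
        rw [this, hx]) ((hδ a).connected v ((δ a).base h))
    exact hh (key h h1)
  onePI h hh := by
    obtain ⟨⟨a, h⟩, rfl⟩ := z.onHE.surjective h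
    rw [slot_onHE hδ z]
    exact ((hδ a).onePI ⟨h, (z.onHE_mem_inner ⟨a, h⟩).mp hh⟩).of_iso (z.componentIso hδ a)
  legs_eq c k := by
    obtain ⟨a, rfl⟩ := (z.slot hδ).surjective c
    rw [FeynmanGraph.extCount_of_iso (z.componentIso hδ a), Equiv.symm_apply_apply]
    exact (hδ a).legs_eq k

def dissection : Dissection δ ρ Γ where
  sub := z.sub hδ
  slot := z.slot hδ
  res_eq a := congrArg ρ ((z.slot hδ).symm_apply_apply a)
  iso := z.componentIso hδ

theorem toAssembly_dissection : (z.dissection hδ).toAssembly = z :=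
  Assembly.ext (fun _ => rfl) (fun _ => rfl)

end Assembly

def dissectionEquiv (Γ : FeynmanGraph) : Dissection δ ρ Γ ≃ Assembly δ Γ :=
  Equiv.ofBijective Dissection.toAssembly ⟨Dissection.toAssembly_injective hδ,
    fun z => ⟨z.dissection hδ, z.toAssembly_dissection hδ⟩⟩

/-- The glued graph is dissected into its pieces in the obvious way, with wiring `i`, so the
criterion for wirings of subgraphs applies. -/
theorem glue_onePI {i : (fillSlots δ ρ hδ).Wiring} {r : Residue} (hi : i.Good r) :
    (glue hδ i).IsOnePI ∧ ∀ k, (glue hδ i).extCount k = legs r k := by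
  let w := (Assembly.ofGlue hδ (FeynmanGraph.Iso.refl (glue hδ i))).dissection hδ
  have h1 : w.sub.wiring.Good r := by
    rw [w.good_iff hδ, Assembly.toAssembly_dissection, Assembly.wiring_ofGlue]
    exact hi
  exact ((w.sub.good_wiring_iff r).mp h1).1

open Classical in
/-- Summation over the dissections of `Γ` is summation over the wirings that give `Γ`. -/
theorem sum_dissection [Fintype (Dissection δ ρ Γ)] (r : Residue) :
    ∑ w : Dissection δ ρ Γ, (if w.sub.wiring.Good r then gen w.sub.contract r else 0) =
      ∑ i : (fillSlots δ ρ hδ).Wiring, if i.Good r then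
        (Nat.card (FeynmanGraph.Iso (glue hδ i) Γ) : ℂ) • gen i.contract r else 0 := by
  have h1 : ∀ i : (fillSlots δ ρ hδ).Wiring, (if i.Good r then
        (Nat.card (FeynmanGraph.Iso (glue hδ i) Γ) : ℂ) • gen i.contract r else 0) =
      ∑ f : FeynmanGraph.Iso (glue hδ i) Γ, if i.Good r then gen i.contract r else 0 := by
    intro i
    rw [Finset.sum_const, Finset.card_univ, ← Nat.card_eq_fintype_card]
    split_ifs
    · rw [Nat.cast_smul_eq_nsmul]
    · simp
  rw [Finset.sum_congr rfl fun i _ => h1 i, ← Fintype.sum_sigma']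
  rw [← Fintype.sum_equiv (glueEquiv hδ Γ).symm (fun z : Assembly δ Γ =>
    if (z.wiring hδ).Good r then gen (z.wiring hδ).contract r else 0) _ (fun z => rfl)]
  refine Fintype.sum_equiv (dissectionEquiv hδ Γ) _ _ fun w => ?_
  simp only [w.good_iff hδ, w.gen_contract hδ]
  rfl

end Glue

end QCD

namespace QCD

/-! ### Type-preserving permutations, and finiteness of the set of graphs with given vertices -/

theorem card_perm_over {α ι : Type} [Finite α] [Fintype ι] (f : α → ι) :
    Nat.card {e : Equiv.Perm α // ∀ a, f (e a) = f a} =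
      ∏ i, (Nat.card {a // f a = i}).factorial := by
  classical
  have := Fintype.ofFinite α
  have h := DomMulAct.stabilizer_card f
  simp only [← Nat.card_eq_fintype_card] at h
  rw [← h]
  exact Nat.card_congr (Equiv.subtypeEquivRight fun e => by simp [funext_iff])

theorem card_equiv_over {α β ι : Type} [Finite α] [Finite β] [Fintype ι] (f : α → ι) (g : β → ι)
    (e₀ : α ≃ β) (he : ∀ a, g (e₀ a) = f a) :
    Nat.card {e : α ≃ β // ∀ a, g (e a) = f a} = ∏ i, (Nat.card {a // f a = i}).factorial := by
  rw [← card_perm_over]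
  refine Nat.card_congr ⟨fun e => ⟨e.1.trans e₀.symm, fun a => ?_⟩,
    fun e => ⟨e.1.trans e₀, fun a => ?_⟩, fun e => ?_, fun e => ?_⟩
  · rw [← he]; simp [e.2]
  · rw [← e.2 a, ← he]; simp
  · ext; simp
  · ext; simp

namespace FeynmanGraph

theorem card_vtype_eq (Γ : FeynmanGraph) (N : Fin 5 →₀ ℕ) (h : Γ.vcount = N) (j : VertexType) :
    Nat.card {v // Γ.vtype v = j} = Nat.card {a : Σ j, Fin (N j) // a.1 = j} := by
  rw [← h]
  refine (Γ.vcount_apply j).symm.trans ?_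
  rw [Nat.card_congr (Equiv.sigmaFiberEquivFst j)]
  simp
where
  Equiv.sigmaFiberEquivFst {N : Fin 5 →₀ ℕ} (j : VertexType) :
      {a : Σ j, Fin (N j) // a.1 = j} ≃ Fin (N j) :=
    { toFun := fun a => a.2 ▸ a.1.2
      invFun := fun x => ⟨⟨j, x⟩, rfl⟩
      left_inv := by rintro ⟨⟨j, x⟩, rfl⟩; rfl
      right_inv := fun x => rfl }

end FeynmanGraph

namespace GraphClass

theorem onePI (g : GraphClass) : g.rep.graph.IsOnePI := g.rep.onePI

theorem extCount_eq (g : GraphClass) (k : EdgeType) : g.rep.graph.extCount k = legs g.res k :=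
  g.rep.legs_eq k

theorem gen_rep (g : GraphClass) : gen g.rep.graph g.res = MvPolynomial.X g := by
  unfold gen
  rw [dif_pos ⟨g.onePI, g.extCount_eq⟩]
  exact congrArg _ (Quotient.out_eq g)

theorem eq_of_iso {g g' : GraphClass} (f : g.rep.graph.Iso g'.rep.graph) (h : g.res = g'.res) :
    g = g' := Quotient.out_equiv_out.mp ⟨⟨f⟩, h⟩

/-- The number of vertices of each type. -/
def vcount (g : GraphClass) : Fin 5 →₀ ℕ := g.rep.graph.vcount

theorem multideg_eq (g : GraphClass) (j : Fin 5) :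
    g.multideg j = (g.vcount j : ℤ) - if g.res = Sum.inr j then 1 else 0 := rfl

theorem exists_of_onePI {Γ : FeynmanGraph} {r : Residue} (h1 : Γ.IsOnePI)
    (h2 : ∀ k, Γ.extCount k = legs r k) :
    ∃ g : GraphClass, g.res = r ∧ Nonempty (g.rep.graph.Iso Γ) := by
  let d : DressedGraph := ⟨Γ, r, h1, h2⟩
  have h : (Quotient.mk dressedSetoid d).out ≈ d := Quotient.mk_out d
  exact ⟨Quotient.mk _ d, h.2, h.1⟩

/-- Once vertices and half-edges are numbered, the types and the attachment of half-edges are fixed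
by `N`. A graph is then given up to isomorphism by a map of one finite set to itself. -/
theorem finite_vcount (r : Residue) (N : Fin 5 →₀ ℕ) :
    {g : GraphClass | g.res = r ∧ g.vcount = N}.Finite := by
  let V := Σ j, Fin (N j)
  let HE := Σ v : V, Σ k : EdgeType, Fin (vertexLegs v.1 k)
  have key : ∀ g : {g : GraphClass | g.res = r ∧ g.vcount = N}, ∃ (t : HE → HE)
      (eV : g.1.rep.graph.V ≃ V) (eH : g.1.rep.graph.HE ≃ HE),
      (∀ v, (eV v).1 = g.1.rep.graph.vtype v) ∧ (∀ h, (eH h).2.1 = g.1.rep.graph.etype h) ∧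
      (∀ h, (eH h).1 = eV (g.1.rep.graph.base h)) ∧
      ∀ h, eH (g.1.rep.graph.twin h) = t (eH h) := by
    rintro ⟨g, hr, hN⟩
    obtain ⟨eV, hV⟩ := exists_equiv_over g.rep.graph.vtype (fun v : V => v.1)
      (g.rep.graph.card_vtype_eq N hN)
    obtain ⟨eH, hH⟩ := exists_equiv_over (fun h => (eV (g.rep.graph.base h), g.rep.graph.etype h))
      (fun x : HE => (x.1, x.2.1)) (by
        rintro ⟨v, k⟩
        have h1 := g.rep.graph.valence (eV.symm v) k
        rw [← hV, Equiv.apply_symm_apply] at h1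
        refine Eq.trans (Nat.card_congr (Equiv.subtypeEquivRight fun x => ?_)) (h1.trans ?_)
        · rw [Prod.mk.injEq, Equiv.eq_symm_apply]
        · refine (Nat.card_fin _).symm.trans (Nat.card_eq_of_bijective
            (fun x => ⟨⟨v, k, x⟩, rfl⟩) ⟨?_, ?_⟩)
          · intro x y e
            exact eq_of_heq (Sigma.mk.inj (eq_of_heq (Sigma.mk.inj
              (congrArg Subtype.val e)).2)).2
          · rintro ⟨⟨v', k', x⟩, e⟩
            obtain ⟨rfl, rfl⟩ := Prod.mk.inj e
            exact ⟨x, rfl⟩)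
    exact ⟨fun x => eH (g.rep.graph.twin (eH.symm x)), eV, eH, hV,
      fun h => (Prod.mk.inj (hH h)).2, fun h => (Prod.mk.inj (hH h)).1, fun h => by simp⟩
  choose t eV eH h1 h2 h3 h4 using key
  refine Set.finite_coe_iff.mp ?_
  refine Finite.of_injective t fun g g' e => Subtype.ext (eq_of_iso ?_ (g.2.1.trans g'.2.1.symm))
  exact
    { onV := (eV g).trans (eV g').symm
      onHE := (eH g).trans (eH g').symm
      vtype_eq := fun v => by rw [← h1]; simp [h1]
      etype_eq := fun v => by
        rw [← h2 g', ← h2 g]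
        exact congrArg (fun x : HE => x.2.1) (Equiv.apply_symm_apply _ _)
      base_eq := fun h => by
        apply (eV g').injective
        rw [← h3]; simp [h3]
      twin_eq := fun h => by
        apply (eH g').injective
        rw [h4]; simp [h4, e] }

end GraphClass

/-- The classes of graphs with residue `r` and `N j` vertices of type `j`. -/
def classes (r : Residue) (N : Fin 5 →₀ ℕ) : Finset GraphClass :=
  (GraphClass.finite_vcount r N).toFinset

theorem mem_classes {r : Residue} {N : Fin 5 →₀ ℕ} {g : GraphClass} :
    g ∈ classes r N ↔ g.res = r ∧ g.vcount = N := by simp [classes]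

/-! ## Corollas and pieces -/

/-- A single vertex. -/
def corolla (j : VertexType) : FeynmanGraph where
  V := Unit
  HE := Σ k : EdgeType, Fin (vertexLegs j k)
  finV := inferInstance
  finHE := inferInstance
  vtype _ := j
  etype h := h.1
  base _ := ()
  twin h := h
  twin_twin _ := rfl
  etype_twin _ := rfl
  valence v k := by
    refine Eq.trans (Nat.card_eq_of_bijective (fun x => ⟨⟨k, x⟩, rfl, rfl⟩) ⟨?_, ?_⟩).symm
      (Nat.card_fin _)
    · intro x y e
      simpa using e
    · rintro ⟨⟨k', x⟩, -, e⟩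
      dsimp only at e
      subst e
      exact ⟨x, rfl⟩

theorem corolla_card_etype (j : VertexType) (k : EdgeType) :
    Nat.card {h : (corolla j).HE // (corolla j).etype h = k} = vertexLegs j k := by
  refine Eq.trans ?_ ((corolla j).valence () k)
  exact Nat.card_congr (Equiv.subtypeEquivRight fun h => ⟨fun h => ⟨rfl, h⟩, fun h => h.2⟩)

theorem corolla_card_iso (j : VertexType) :
    Nat.card ((corolla j).Iso (corolla j)) = ∏ k, (legs (Sum.inr j) k).factorial := by
  have h := card_perm_over (corolla j).etype
  simp only [corolla_card_etype] at h
  refine Eq.trans (Nat.card_congr ⟨fun f => ⟨f.onHE, f.etype_eq⟩, fun e =>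
    ⟨Equiv.refl _, e.1, fun _ => rfl, e.2, fun _ => rfl, fun _ => rfl⟩, fun f => ?_,
      fun _ => rfl⟩) h
  exact FeynmanGraph.Iso.ext (fun _ => rfl) (fun _ => rfl)

theorem corolla_fits (j : VertexType) : Fits (corolla j) (Sum.inr j) where
  nonempty := ⟨()⟩
  connected := fun _ _ => Linked.refl _
  legs_eq k := by
    rw [legs, ← corolla_card_etype]
    exact Nat.card_congr (Equiv.subtypeEquivRight fun h => ⟨fun h => h.2, fun h => ⟨rfl, h⟩⟩)
  onePI := fun ⟨_, h⟩ => absurd rfl h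
  res_eq := fun _ _ => rfl

theorem fits_of_onePI {Γ : FeynmanGraph} {r : Residue} (h : Γ.IsOnePI)
    (hr : ∀ k, Γ.extCount k = legs r k) : Fits Γ r where
  nonempty := h.connected.1
  connected := h.connected.2
  legs_eq := hr
  onePI := fun _ => h
  res_eq := fun h' => by
    obtain ⟨x, hx⟩ := h.not_tree
    exact absurd (h' x) hx

/-- A component that contains no edge of the subgraph is a single vertex, and `res_trivial` fixes
its residue. All others are one-particle irreducible by the definition of a subgraph. -/
theorem component_fits {Γ : FeynmanGraph} (γ : Γ.Subgraph) (c : Γ.Comp γ.S) :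
    Fits (FeynmanGraph.component γ.S γ.twin_mem c) (γ.res c) := by
  have h1 : (∃ h, (FeynmanGraph.component γ.S γ.twin_mem c).twin h ≠ h) →
      (FeynmanGraph.component γ.S γ.twin_mem c).IsOnePI := by
    rintro ⟨h, hh⟩
    have hS : h.1 ∈ γ.S := by
      by_contra hS
      exact hh ((FeynmanGraph.component_twin_eq_self_iff γ.internal γ.twin_mem h).mpr hS)
    have := γ.onePI h.1 hS
    rwa [h.2] at this
  have h2 : (∀ h, (FeynmanGraph.component γ.S γ.twin_mem c).twin h = h) →
      ∀ h, Γ.compOf γ.S h = c → h ∉ γ.S := fun h' h hc =>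
    (FeynmanGraph.component_twin_eq_self_iff γ.internal γ.twin_mem ⟨h, hc⟩).mp (h' _)
  refine ⟨?_, ?_, γ.legs_eq c, h1, ?_⟩
  · obtain ⟨v, rfl⟩ := Quotient.exists_rep c
    exact ⟨⟨v, rfl⟩⟩
  · by_cases hex : ∃ h, (FeynmanGraph.component γ.S γ.twin_mem c).twin h ≠ h
    · exact (h1 hex).connected.2
    · push Not at hex
      rintro ⟨v, rfl⟩ ⟨w, hw⟩
      have : w = v := by
        refine Linked.eq_of_isolated (base := Γ.base) (twin := Γ.twin) (S := γ.S) ?_ ?_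
          (Quotient.exact hw.symm)
        · intro h hS hv
          exact absurd hS (h2 hex h (congrArg _ hv))
        · intro h hS hv
          exact absurd (γ.twin_mem _ hS) (h2 hex _ (congrArg _ hv))
      subst this
      exact Linked.refl _
  · rintro h' ⟨v, rfl⟩
    exact γ.res_trivial v fun h hv => h2 h' h (congrArg _ hv)

/-- What may be put into a slot: a vertex, or a class of one-particle irreducible graphs. -/
abbrev Piece : Type 1 := VertexType ⊕ GraphClass

namespace Piece

def res : Piece → Residue
  | Sum.inl j => Sum.inr j
  | Sum.inr g => g.res

def graph : Piece → FeynmanGraph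
  | Sum.inl j => corolla j
  | Sum.inr g => g.rep.graph

/-- The element of `H_CK` given by a piece. -/
def val : Piece → HCK
  | Sum.inl _ => 1
  | Sum.inr g => MvPolynomial.X g

/-- The order of the automorphism group. -/
def aut (p : Piece) : ℕ := Nat.card (p.graph.Iso p.graph)

def vcount (p : Piece) : Fin 5 →₀ ℕ := p.graph.vcount

theorem aut_ne_zero (p : Piece) : (p.aut : ℂ) ≠ 0 :=
  Nat.cast_ne_zero.mpr (FeynmanGraph.Iso.card_pos (FeynmanGraph.Iso.refl _)).ne'

theorem fits (p : Piece) : Fits p.graph p.res := by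
  rcases p with j | g
  · exact corolla_fits j
  · exact fits_of_onePI g.onePI g.extCount_eq

theorem eq_of_iso {p q : Piece} (f : p.graph.Iso q.graph) (h : p.res = q.res) : p = q := by
  rcases p with i | g <;> rcases q with j | g'
  · exact congrArg Sum.inl (Sum.inr.inj h)
  · obtain ⟨x, hx⟩ := (g'.onePI.of_iso f.symm).not_tree
    exact absurd rfl hx
  · obtain ⟨x, hx⟩ := (g.onePI.of_iso f).not_tree
    exact absurd rfl hx
  · exact congrArg Sum.inr (GraphClass.eq_of_iso f h)

/-- Without an internal edge, connectedness leaves one vertex with all its half-edges external,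
which is a corolla. Together with `eq_of_iso`, the pieces represent each possible filling of a slot
exactly once. -/
theorem exists_of_fits {Δ : FeynmanGraph} {r : Residue} (h : Fits Δ r) :
    ∃ p : Piece, p.res = r ∧ Nonempty (p.graph.Iso Δ) := by
  by_cases hex : ∃ x, Δ.twin x ≠ x
  · obtain ⟨g, h1, h2⟩ := GraphClass.exists_of_onePI (h.onePI hex) h.legs_eq
    exact ⟨Sum.inr g, h1, h2⟩
  · push Not at hex
    obtain ⟨v⟩ := h.nonempty
    have hV : ∀ w, w = v := fun w =>
      (Linked.const id (fun x _ => by rw [hex]) (h.connected w v) : id w = id v)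
    refine ⟨Sum.inl (Δ.vtype v), (h.res_eq hex v).symm, ?_⟩
    obtain ⟨e, he⟩ := exists_equiv_over (corolla (Δ.vtype v)).etype Δ.etype fun k => by
      rw [corolla_card_etype, ← Δ.valence v k]
      exact Nat.card_congr (Equiv.subtypeEquivRight fun x => by
        rw [hV (Δ.base x)]; simp)
    exact ⟨{ onV := ⟨fun _ => v, fun _ => (), fun _ => rfl, fun w => (hV w).symm⟩
             onHE := e
             vtype_eq := fun _ => rfl
             etype_eq := he
             base_eq := fun x => hV _
             twin_eq := fun x => hex _ }⟩

theorem finite_upTo (r : Residue) (N : Fin 5 →₀ ℕ) :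
    {p : Piece | p.res = r ∧ p.vcount ≤ N}.Finite := by
  refine ((Set.finite_range (Sum.inl : VertexType → Piece)).union
    (((Finset.Iic N).finite_toSet.biUnion fun M _ => (classes r M).finite_toSet).image
      Sum.inr)).subset ?_
  rintro (j | g) ⟨h1, h2⟩
  · exact Or.inl ⟨j, rfl⟩
  · exact Or.inr ⟨g, Set.mem_biUnion (Finset.mem_coe.mpr (Finset.mem_Iic.mpr h2))
      (Finset.mem_coe.mpr (mem_classes.mpr ⟨h1, rfl⟩)), rfl⟩

/-- The pieces with residue `r` and at most `N j` vertices of type `j`. -/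
def upTo (r : Residue) (N : Fin 5 →₀ ℕ) : Finset Piece := (finite_upTo r N).toFinset

theorem mem_upTo {r : Residue} {N : Fin 5 →₀ ℕ} {p : Piece} :
    p ∈ upTo r N ↔ p.res = r ∧ p.vcount ≤ N := by simp [upTo]

end Piece

end QCD

namespace QCD

/-! ### Cancellation of automorphisms in sums over isomorphism classes -/

namespace GraphClass

/-- Only the class of `Γ` itself contributes, and there the number of isomorphisms is the order of
the automorphism group. It cancels against the one in the symmetry factor and leaves the
permutations of the external lines. -/
theorem sum_classes_iso {Γ : FeynmanGraph} {r : Residue} (h1 : Γ.IsOnePI)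
    (h2 : ∀ k, Γ.extCount k = legs r k) (N : Fin 5 →₀ ℕ) [Decidable (Γ.vcount = N)] :
    ∑ g ∈ classes r N, g.sym⁻¹ * (Nat.card (Γ.Iso g.rep.graph) : ℂ) =
      if Γ.vcount = N then ∏ k, ((legs r k).factorial : ℂ) else 0 := by
  obtain ⟨g₀, hr, ⟨f⟩⟩ := exists_of_onePI h1 h2
  have hne : ∀ g ∈ classes r N, g ≠ g₀ →
      g.sym⁻¹ * (Nat.card (Γ.Iso g.rep.graph) : ℂ) = 0 := by
    intro g hg hgg
    have : IsEmpty (Γ.Iso g.rep.graph) := ⟨fun e =>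
      hgg (eq_of_iso (f.trans e) (hr.trans (mem_classes.mp hg).1.symm)).symm⟩
    rw [Nat.card_of_isEmpty, Nat.cast_zero, mul_zero]
  have hv : g₀.vcount = Γ.vcount := (FeynmanGraph.vcount_of_iso f).symm
  split_ifs with hN
  · rw [Finset.sum_eq_single_of_mem g₀ (mem_classes.mpr ⟨hr, hv.trans hN⟩) hne, sym, hr,
      inv_div]
    have e : Nat.card (Γ.Iso g₀.rep.graph) = Nat.card (g₀.rep.graph.Iso g₀.rep.graph) :=
      Nat.card_congr ⟨fun a => f.trans a, fun a => f.symm.trans a,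
        fun a => FeynmanGraph.Iso.ext (fun v => congrArg a.onV (f.onV.apply_symm_apply v))
          (fun v => congrArg a.onHE (f.onHE.apply_symm_apply v)),
        fun a => FeynmanGraph.Iso.ext (fun v => congrArg a.onV (f.onV.symm_apply_apply v))
          (fun v => congrArg a.onHE (f.onHE.symm_apply_apply v))⟩
    rw [e, div_mul_cancel₀]
    exact Nat.cast_ne_zero.mpr (FeynmanGraph.Iso.card_pos (FeynmanGraph.Iso.refl _)).ne'
  · refine Finset.sum_eq_zero fun g hg => hne g hg ?_
    rintro rfl
    exact hN (hv.symm.trans (mem_classes.mp hg).2)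

end GraphClass

open Classical in
/-- The factor that a component contributes to a subgraph. -/
def pieceVal (Δ : FeynmanGraph) (r : Residue) : HCK := if ∃ h, Δ.twin h ≠ h then gen Δ r else 1

theorem Piece.val_eq_of_iso (p : Piece) {Δ : FeynmanGraph} (f : p.graph.Iso Δ) :
    p.val = pieceVal Δ p.res := by
  rcases p with j | g
  · have : ¬ ∃ h, Δ.twin h ≠ h := by
      rintro ⟨h, hh⟩
      obtain ⟨x, rfl⟩ := f.onHE.surjective h
      exact hh (f.twin_eq x)
    exact (if_neg this).symm
  · have : ∃ h, Δ.twin h ≠ h := (g.onePI.of_iso f).not_tree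
    refine Eq.trans ?_ (if_pos this).symm
    rw [gen_of_iso f]
    exact g.gen_rep.symm

/-- Exactly one piece is isomorphic to `Δ`, and its isomorphisms to `Δ` are as many as its
automorphisms. This allows the factor of one component to be replaced by a sum over all pieces that
does not mention the component's graph beyond counting isomorphisms. -/
theorem Piece.sum_upTo {Δ : FeynmanGraph} {r : Residue} (hΔ : Fits Δ r) {N : Fin 5 →₀ ℕ}
    (hN : Δ.vcount ≤ N) :
    ∑ p ∈ upTo r N, ((Nat.card (p.graph.Iso Δ) : ℂ) * (p.aut : ℂ)⁻¹) • p.val = pieceVal Δ r := by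
  obtain ⟨p, rfl, ⟨f⟩⟩ := exists_of_fits hΔ
  have hp : p ∈ upTo p.res N := mem_upTo.mpr ⟨rfl, (FeynmanGraph.vcount_of_iso f).symm.trans_le hN⟩
  rw [Finset.sum_eq_single_of_mem p hp, f.card_eq]
  · change ((p.aut : ℂ) * (p.aut : ℂ)⁻¹) • _ = _
    rw [mul_inv_cancel₀ p.aut_ne_zero, one_smul, p.val_eq_of_iso f]
  · intro q hq hqp
    have : IsEmpty (q.graph.Iso Δ) := ⟨fun e => hqp (eq_of_iso (e.trans f.symm) (mem_upTo.mp hq).1)⟩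
    rw [Nat.card_of_isEmpty, Nat.cast_zero, zero_mul, zero_smul]

namespace FeynmanGraph

theorem component_vcount_le {Γ : FeynmanGraph} {S : Set Γ.HE} (hS : ∀ h ∈ S, Γ.twin h ∈ S)
    (c : Γ.Comp S) : (component S hS c).vcount ≤ Γ.vcount := fun j =>
  Nat.card_le_card_of_injective (fun v : {v // (component S hS c).vtype v = j} =>
      (⟨v.1.1, v.2⟩ : {v // Γ.vtype v = j})) fun _ _ e =>
    Subtype.ext (Subtype.ext (Subtype.mk.inj e))

theorem card_V (Γ : FeynmanGraph) : Nat.card Γ.V = Γ.vcount.degree := by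
  have := Fintype.ofFinite Γ.V
  rw [Finsupp.degree_eq_sum, ← Nat.card_congr (Equiv.sigmaFiberEquiv Γ.vtype), Nat.card_sigma]
  rfl

theorem vcount_glue {A : Type} [Fintype A] {δ : A → FeynmanGraph} {ρ : A → Residue}
    (hδ : ∀ a, Fits (δ a) (ρ a)) (i : (fillSlots δ ρ hδ).Wiring) :
    (glue hδ i).vcount = ∑ a, (δ a).vcount := by
  ext j
  rw [Finsupp.finsetSum_apply, vcount_apply]
  simp only [vcount_apply]
  rw [← Nat.card_sigma]
  refine (Nat.card_eq_of_bijective (fun x => ⟨⟨x.1, x.2.1⟩, x.2.2⟩) ⟨?_, ?_⟩).symm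
  · rintro ⟨a, x⟩ ⟨b, y⟩ e
    obtain ⟨rfl, e⟩ := Sigma.mk.inj (congrArg Subtype.val e)
    exact congrArg _ (Subtype.ext (eq_of_heq e))
  · rintro ⟨⟨a, v⟩, h⟩
    exact ⟨⟨a, v, h⟩, rfl⟩

theorem Subgraph.toHCK_eq_prod {Γ : FeynmanGraph} (γ : Γ.Subgraph) [Fintype (Γ.Comp γ.S)] :
    γ.toHCK = ∏ c : Γ.Comp γ.S, pieceVal (component γ.S γ.twin_mem c) (γ.res c) := by
  classical
  unfold toHCK
  have h1 : ∀ c, (∃ h, (component γ.S γ.twin_mem c).twin h ≠ h) ↔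
      ∃ h ∈ γ.S, Γ.compOf γ.S h = c := fun c => by
    refine ⟨fun ⟨h, hh⟩ => ⟨h.1, ?_, h.2⟩, fun ⟨h, hS, hc⟩ => ⟨⟨h, hc⟩, ?_⟩⟩
    · by_contra hS
      exact hh ((component_twin_eq_self_iff γ.internal γ.twin_mem h).mpr hS)
    · exact fun e => (component_twin_eq_self_iff γ.internal γ.twin_mem ⟨h, hc⟩).mp e hS
  simp only [pieceVal, h1]
  rw [finprod_eq_prod_of_fintype, ← Finset.prod_filter]
  exact (Finset.prod_subtype _ (fun c => by simp)
    (fun c => gen (component γ.S γ.twin_mem c) (γ.res c))).symm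

end FeynmanGraph

/-! ## Summation over placements -/

/-- `n ρ` slots with residue `ρ`, for each `ρ`. -/
abbrev Slot (n : Residue → ℕ) : Type := Σ ρ : Residue, Fin (n ρ)

theorem card_slot_fst (n : Residue → ℕ) (ρ : Residue) :
    Nat.card {a : Slot n // a.1 = ρ} = n ρ := by
  refine Eq.trans (Nat.card_eq_of_bijective (fun x => ⟨⟨ρ, x⟩, rfl⟩) ⟨?_, ?_⟩).symm
    (Nat.card_fin _)
  · intro x y e
    exact eq_of_heq (Sigma.mk.inj (congrArg Subtype.val e)).2
  · rintro ⟨⟨ρ, x⟩, rfl⟩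
    exact ⟨x, rfl⟩

/-- The placements of slots on a set of components with given residues. -/
abbrev Placement (n : Residue → ℕ) {C : Type} (res : C → Residue) : Type :=
  {e : Slot n ≃ C // ∀ a, res (e a) = a.1}

instance {n : Residue → ℕ} {C : Type} [Finite C] {res : C → Residue} :
    Fintype (Placement n res) := Fintype.ofFinite _

/-- Placements exist only if `n` counts the components of each residue, and then there is one for
each family of permutations of slots with equal residue. The bound `d` keeps the sum over `n`
finite. -/
theorem sum_placement {C : Type} [Finite C] (res : C → Residue) {d : ℕ} (hd : Nat.card C ≤ d) :
    ∑ n : Residue → Fin (d + 1), ((∏ ρ, ((n ρ : ℕ).factorial : ℂ)))⁻¹ *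
      (Fintype.card (Placement (fun ρ => n ρ) res) : ℂ) = 1 := by
  let n₀ : Residue → Fin (d + 1) := fun ρ => ⟨Nat.card {c // res c = ρ},
    Nat.lt_succ_of_le ((Finite.card_subtype_le _).trans hd)⟩
  rw [Finset.sum_eq_single n₀]
  · obtain ⟨e, he⟩ := exists_equiv_over (fun a : Slot (fun ρ => n₀ ρ) => a.1) res
      (card_slot_fst _)
    have h := card_equiv_over (fun a : Slot (fun ρ => n₀ ρ) => a.1) res e he
    simp only [card_slot_fst] at h
    rw [← Nat.card_eq_fintype_card, h, Nat.cast_prod, inv_mul_cancel₀]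
    exact Finset.prod_ne_zero_iff.mpr fun ρ _ => Nat.cast_ne_zero.mpr (Nat.factorial_ne_zero _)
  · intro n _ hn
    have : IsEmpty (Placement (fun ρ => n ρ) res) := ⟨fun e => hn (funext fun ρ => Fin.ext (by
      refine (card_slot_fst (fun ρ => n ρ) ρ).symm.trans (Nat.card_congr (e.1.subtypeEquiv ?_))
      intro a
      rw [e.2]))⟩
    rw [Fintype.card_of_isEmpty, Nat.cast_zero, mul_zero]
  · exact fun h => absurd (Finset.mem_univ _) h

section

variable {A : Type} [Finite A] {δ : A → FeynmanGraph} {ρ : A → Residue} {Γ : FeynmanGraph}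

def Dissection.equivSigma : Dissection δ ρ Γ ≃ Σ γ : Γ.Subgraph,
    Σ e : {e : A ≃ Γ.Comp γ.S // ∀ a, γ.res (e a) = ρ a},
      ∀ a, FeynmanGraph.Iso (δ a) (FeynmanGraph.component γ.S γ.twin_mem (e.1 a)) where
  toFun w := ⟨w.sub, ⟨w.slot, w.res_eq⟩, w.iso⟩
  invFun w := ⟨w.1, w.2.1.1, w.2.1.2, w.2.2⟩
  left_inv _ := rfl
  right_inv _ := rfl

instance : Finite (Dissection δ ρ Γ) := Finite.of_equiv _ Dissection.equivSigma.symm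

instance : Fintype (Dissection δ ρ Γ) := Fintype.ofFinite _

theorem Dissection.sum_eq {M : Type*} [AddCommGroup M] [Module ℂ M] [Fintype A]
    [∀ γ : Γ.Subgraph, Fintype {e : A ≃ Γ.Comp γ.S // ∀ a, γ.res (e a) = ρ a}]
    (F : Γ.Subgraph → M) :
    ∑ w : Dissection δ ρ Γ, F w.sub = ∑ γ : Γ.Subgraph,
      ∑ e : {e : A ≃ Γ.Comp γ.S // ∀ a, γ.res (e a) = ρ a},
        (∏ a, (Nat.card (FeynmanGraph.Iso (δ a)
          (FeynmanGraph.component γ.S γ.twin_mem (e.1 a))) : ℂ)) • F γ := by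
  classical
  refine (Fintype.sum_equiv Dissection.equivSigma (fun w => F w.sub) (fun w => F w.1)
    (fun _ => rfl)).trans ?_
  rw [Fintype.sum_sigma]
  refine Finset.sum_congr rfl fun γ _ => ?_
  rw [Fintype.sum_sigma]
  refine Finset.sum_congr rfl fun e _ => ?_
  change ∑ _ : (∀ a, FeynmanGraph.Iso (δ a) _), F γ = _
  rw [Finset.sum_const, Finset.card_univ, Fintype.card_pi, ← Nat.cast_prod, Nat.cast_smul_eq_nsmul]
  simp only [Nat.card_eq_fintype_card]

end

/-- The abstract slots given by `n ρ` slots for each residue `ρ`. -/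
abbrev slotsOf (n : Residue → ℕ) : Slots where
  A := Slot n
  L := Σ a : Slot n, Σ k : EdgeType, Fin (legs a.1 k)
  finA := inferInstance
  finL := inferInstance
  res a := a.1
  etype x := x.2.1
  base x := x.1
  valence a k := by
    refine Eq.trans (Nat.card_eq_of_bijective (fun x => ⟨⟨a, k, x⟩, rfl, rfl⟩) ⟨?_, ?_⟩).symm
      (Nat.card_fin _)
    · intro x y e
      exact eq_of_heq (Sigma.mk.inj (eq_of_heq (Sigma.mk.inj (congrArg Subtype.val e)).2)).2
    · rintro ⟨⟨b, l, x⟩, h1, h2⟩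
      dsimp only at h1 h2
      subst h1 h2
      exact ⟨x, rfl⟩

theorem slotsOf_count (n : Residue → ℕ) (ρ : Residue) : (slotsOf n).count ρ = n ρ :=
  card_slot_fst n ρ

/-- The sum of the graphs obtained by wiring `n ρ` slots of each residue `ρ`. -/
def wirings (n : Residue → ℕ) (r : Residue) : HCK := (slotsOf n).wiringSum r

/-- Two sums equal to one are inserted: over the ways to number the components (`sum_placement`),
and for each component over the piece it is isomorphic to (`Piece.sum_upTo`). -/
theorem FeynmanGraph.Subgraph.toHCK_eq_sum {Γ : FeynmanGraph} (γ : Γ.Subgraph) {N : Fin 5 →₀ ℕ}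
    (hN : Γ.vcount ≤ N) {d : ℕ} (hd : Nat.card Γ.V ≤ d) :
    γ.toHCK = ∑ n : Residue → Fin (d + 1), ((∏ ρ, ((n ρ : ℕ).factorial : ℂ)))⁻¹ •
      ∑ e : Placement (fun ρ => n ρ) γ.res,
        ∑ q ∈ Fintype.piFinset fun a : Slot fun ρ => n ρ => Piece.upTo a.1 N,
          (∏ a, (Nat.card ((q a).graph.Iso
            (FeynmanGraph.component γ.S γ.twin_mem (e.1 a))) : ℂ)) •
            ∏ a, ((q a).aut : ℂ)⁻¹ • (q a).val := by
  classical
  have := Fintype.ofFinite (Γ.Comp γ.S)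
  have key : ∀ n : Residue → Fin (d + 1), ∀ e : Placement (fun ρ => n ρ) γ.res,
      ∑ q ∈ Fintype.piFinset fun a : Slot fun ρ => n ρ => Piece.upTo a.1 N,
          (∏ a, (Nat.card ((q a).graph.Iso
            (FeynmanGraph.component γ.S γ.twin_mem (e.1 a))) : ℂ)) •
            ∏ a, ((q a).aut : ℂ)⁻¹ • (q a).val = γ.toHCK := by
    intro n e
    rw [γ.toHCK_eq_prod, ← Fintype.prod_equiv e.1 (fun a => pieceVal
      (FeynmanGraph.component γ.S γ.twin_mem (e.1 a)) a.1) _ (fun a => by rw [e.2])]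
    rw [Finset.prod_congr rfl fun a _ => (Piece.sum_upTo (N := N) (e.2 a ▸ component_fits γ (e.1 a))
      ((FeynmanGraph.component_vcount_le γ.twin_mem _).trans hN)).symm]
    rw [Finset.prod_univ_sum]
    refine Finset.sum_congr rfl fun q _ => ?_
    rw [← Finset.prod_smul]
    simp only [smul_smul]
  simp only [key, Finset.sum_const, Finset.card_univ]
  simp only [← Nat.cast_smul_eq_nsmul ℂ, smul_smul]
  rw [← Finset.sum_smul, sum_placement, one_smul]
  exact (Nat.card_le_card_of_surjective _ Quotient.mk_surjective).trans hd

/-- A subgraph with a numbering of its components and identifications of these with pieces is a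
dissection. After the order of summation is exchanged, the first tensor factor depends only on the
pieces. -/
theorem FeynmanGraph.sum_subgraph {M : Type*} [AddCommGroup M] [Module ℂ M] {Γ : FeynmanGraph}
    {N : Fin 5 →₀ ℕ} (hN : Γ.vcount ≤ N) {d : ℕ} (hd : Nat.card Γ.V ≤ d) (G : Γ.Subgraph → M) :
    ∑ γ : Γ.Subgraph, γ.toHCK ⊗ₜ[ℂ] G γ =
      ∑ n : Residue → Fin (d + 1), ((∏ ρ, ((n ρ : ℕ).factorial : ℂ)))⁻¹ •
        ∑ q ∈ Fintype.piFinset fun a : Slot fun ρ => n ρ => Piece.upTo a.1 N,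
          (∏ a, ((q a).aut : ℂ)⁻¹ • (q a).val) ⊗ₜ
            ∑ w : Dissection (fun a => (q a).graph) (fun a => a.1) Γ, G w.sub := by
  classical
  simp only [Dissection.sum_eq]
  simp only [TensorProduct.tmul_sum, TensorProduct.tmul_smul, Finset.smul_sum]
  rw [Finset.sum_congr rfl fun γ _ => by rw [γ.toHCK_eq_sum hN hd]]
  simp only [TensorProduct.sum_tmul, ← TensorProduct.smul_tmul', Finset.smul_sum]
  rw [Finset.sum_comm]
  refine Finset.sum_congr rfl fun n _ => ?_
  exact Eq.trans (Finset.sum_congr rfl fun γ _ => Finset.sum_comm) Finset.sum_comm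

-- With the pieces fixed, dissections of all graphs with `N` vertices run through the wirings of the
-- pieces. For each good wiring only the class of the glued graph counts, and its symmetry factor
-- cancels. What remains depends on the pieces only through the total number of vertices, since
-- contraction sees nothing but residues.
open Classical in
theorem sum_classes_dissection (n : Residue → ℕ) (r : Residue) (N : Fin 5 →₀ ℕ) (q : Slot n → Piece)
    (hq : ∀ a, (q a).res = a.1) :
    ∑ g ∈ classes r N, g.sym⁻¹ • ∑ w : Dissection (fun a => (q a).graph) (fun a => a.1)
      g.rep.graph, (if w.sub.wiring.Good r then gen w.sub.contract r else 0) =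
      if ∑ a, (q a).vcount = N then
        (∏ k, ((legs r k).factorial : ℂ)) • wirings n r else 0 := by
  have hδ : ∀ a, Fits (q a).graph a.1 := fun a => hq a ▸ (q a).fits
  have h1 : ∀ g : GraphClass, ∑ w : Dissection (fun a => (q a).graph) (fun a => a.1) g.rep.graph,
      (if w.sub.wiring.Good r then gen w.sub.contract r else 0) = _ := fun g =>
    sum_dissection hδ r
  have h2 : ∀ i : (fillSlots _ _ hδ).Wiring, i.Good r →
      ∑ g ∈ classes r N, g.sym⁻¹ * (Nat.card ((glue hδ i).Iso g.rep.graph) : ℂ) =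
        if ∑ a, (q a).vcount = N then ∏ k, ((legs r k).factorial : ℂ) else 0 := fun i hi => by
    rw [GraphClass.sum_classes_iso (glue_onePI hδ hi).1 (glue_onePI hδ hi).2,
      FeynmanGraph.vcount_glue]
    rfl
  simp only [h1, Finset.smul_sum]
  rw [Finset.sum_comm]
  have h4 : wirings n r = (fillSlots _ _ hδ).wiringSum r :=
    Slots.wiringSum_eq_of_count (s := slotsOf n) (s' := fillSlots _ _ hδ)
      (fun _ => rfl) r
  have h5 : ∀ i : (fillSlots _ _ hδ).Wiring, ∑ g ∈ classes r N, g.sym⁻¹ • (if i.Good r then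
      (Nat.card ((glue hδ i).Iso g.rep.graph) : ℂ) • gen i.contract r else 0) =
      (if ∑ a, (q a).vcount = N then ∏ k, ((legs r k).factorial : ℂ) else 0) •
        if i.Good r then gen i.contract r else 0 := by
    intro i
    by_cases hi : i.Good r
    · simp only [if_pos hi, smul_smul]
      rw [← Finset.sum_smul, h2 i hi]
    · simp only [if_neg hi, smul_zero, Finset.sum_const_zero]
  simp only [h5]
  rw [← Finset.smul_sum, h4, Slots.wiringSum]
  split_ifs
  · rfl
  · rw [zero_smul]

open Classical in
/-- The expansion of the sum of all subgraphs of all graphs with `N j` vertices of type `j`, by the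
way in which the components of the subgraph are placed and wired. -/
theorem sum_classes_subgraph (r : Residue) (N : Fin 5 →₀ ℕ) :
    ∑ g ∈ classes r N, g.sym⁻¹ • ∑ γ : g.rep.graph.Subgraph,
      γ.toHCK ⊗ₜ[ℂ] (if γ.wiring.Good r then gen γ.contract r else 0) =
      ∑ n : Residue → Fin (N.degree + 1), ((∏ ρ, ((n ρ : ℕ).factorial : ℂ)))⁻¹ •
        ∑ q ∈ Fintype.piFinset fun a : Slot fun ρ => n ρ => Piece.upTo a.1 N,
          if ∑ a, (q a).vcount = N then (∏ a, ((q a).aut : ℂ)⁻¹ • (q a).val) ⊗ₜ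
            ((∏ k, ((legs r k).factorial : ℂ)) • wirings (fun ρ => n ρ) r) else 0 := by
  rw [Finset.sum_congr rfl fun g hg => by
    rw [g.rep.graph.sum_subgraph (mem_classes.mp hg).2.le (d := N.degree)
      ((g.rep.graph.card_V.trans (congrArg _ (mem_classes.mp hg).2)).le)]]
  simp only [Finset.smul_sum]
  rw [Finset.sum_comm]
  refine Finset.sum_congr rfl fun n _ => ?_
  rw [Finset.sum_comm]
  refine Finset.sum_congr rfl fun q hq => ?_
  have h3 := sum_classes_dissection (fun ρ => n ρ) r N q fun a =>
    (Piece.mem_upTo.mp (Fintype.mem_piFinset.mp hq a)).1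
  rw [Finset.sum_congr rfl fun g _ => smul_comm _ _ _]
  rw [← Finset.smul_sum]
  simp only [← TensorProduct.tmul_smul, ← TensorProduct.tmul_sum]
  rw [h3]
  split_ifs
  · rw [TensorProduct.tmul_smul]
  · rw [smul_zero, TensorProduct.tmul_zero, smul_zero]

end QCD

namespace QCD

namespace FeynmanGraph

/-! ## The empty subgraph -/

theorem mk_eq_mk_of_empty {Γ : FeynmanGraph} {v w : Γ.V}
    (h : (Quotient.mk _ v : Γ.Comp ∅) = Quotient.mk _ w) : v = w :=
  Linked.const (base := Γ.base) (twin := Γ.twin) (S := ∅) id (fun _ h => absurd h id)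
    (Quotient.exact h)

/-- The subgraph without edges. -/
def emptySubgraph (Γ : FeynmanGraph) : Γ.Subgraph where
  S := ∅
  internal _ h := absurd h id
  twin_mem _ h := absurd h id
  res := Quotient.lift (fun v => Sum.inr (Γ.vtype v)) fun v w h =>
    congrArg (fun v => (Sum.inr (Γ.vtype v) : Residue)) (mk_eq_mk_of_empty (Quotient.sound h))
  res_trivial _ _ := rfl
  onePI _ h := absurd h id
  legs_eq c k := by
    obtain ⟨v, rfl⟩ := Quotient.exists_rep c
    refine Eq.trans (Nat.card_congr ⟨fun x => ⟨x.1.1, mk_eq_mk_of_empty x.1.2, x.2.2⟩,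
      fun x => ⟨⟨x.1, congrArg _ x.2.1⟩, ?_, x.2.2⟩, fun _ => rfl, fun _ => rfl⟩) (Γ.valence v k)
    exact (component_twin_eq_self_iff (fun _ h => absurd h id) (fun _ h => absurd h id) _).mpr id

namespace Subgraph

variable {Γ : FeynmanGraph} {γ : Γ.Subgraph}

theorem res_mk_of_empty (h : γ.S = ∅) (v : Γ.V) : γ.res (Quotient.mk _ v) = Sum.inr (Γ.vtype v) :=
  γ.res_trivial v fun x _ hx => by
    rw [h] at hx
    exact hx

theorem eq_emptySubgraph (h : γ.S = ∅) : γ = Γ.emptySubgraph := by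
  have h2 := res_mk_of_empty h
  obtain ⟨S, a1, a2, res, a3, a4, a5⟩ := γ
  dsimp only at h
  subst h
  have : res = Γ.emptySubgraph.res := by
    funext c
    obtain ⟨v, rfl⟩ := Quotient.exists_rep c
    exact h2 v
  subst this
  rfl

theorem toHCK_of_empty (h : γ.S = ∅) : γ.toHCK = 1 := by
  unfold toHCK
  refine finprod_eq_one_of_forall_eq_one ?_
  rintro ⟨c, x, hx, -⟩
  rw [h] at hx
  exact absurd hx id

/-- Contracting the empty subgraph does not change the graph. -/
def contractIsoOfEmpty (h : γ.S = ∅) : Iso Γ γ.contract where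
  onV := Equiv.ofBijective (fun v => ⟨Quotient.mk _ v, by rw [res_mk_of_empty h]; rfl⟩) ⟨by
      intro v w e
      have e := congrArg Subtype.val e
      dsimp only at e
      clear * - e h
      obtain ⟨S, a1, a2, res, a3, a4, a5⟩ := γ
      dsimp only at h
      subst h
      exact mk_eq_mk_of_empty e, by
      rintro ⟨c, hc⟩
      obtain ⟨v, rfl⟩ := Quotient.exists_rep c
      exact ⟨v, rfl⟩⟩
  onHE := ⟨fun x => ⟨x, by rw [h]; exact id, by
      change (γ.res (Quotient.mk _ (Γ.base x))).isRight
      rw [res_mk_of_empty h]; rfl⟩, fun x => x.1, fun _ => rfl, fun _ => rfl⟩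
  vtype_eq v := by
    refine Sum.inr_injective (α := EdgeType) ?_
    exact (getRight_eq _).trans (res_mk_of_empty h v)
  etype_eq _ := rfl
  base_eq _ := rfl
  twin_eq x := by
    have hk : ∀ x, x ∈ γ.keep := fun x => ⟨by rw [h]; exact id, by
      change (γ.res (Quotient.mk _ (Γ.base x))).isRight
      rw [res_mk_of_empty h]; rfl⟩
    have hp : (twinPerm Γ * γ.passPerm) x = Γ.twin x :=
      congrArg Γ.twin (γ.pass_of_keep x (hk x))
    refine Subtype.ext (firstReturn_eq (b := ⟨x, hk x⟩) ?_)
    rw [← hp]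
    exact Reach.last (hk _)

end Subgraph

end FeynmanGraph

-- The term 1 ⊗ Γ is that of the empty subgraph, and the full subgraph is excluded because its
-- wiring is not good. So apart from Γ ⊗ 1 the coproduct is a uniform sum over all subgraphs.
open Classical in
theorem coproductGen_eq (g : GraphClass) : coproductGen g = MvPolynomial.X g ⊗ₜ 1 +
    ∑ γ : g.rep.graph.Subgraph,
      γ.toHCK ⊗ₜ[ℂ] (if γ.wiring.Good g.res then gen γ.contract g.res else 0) := by
  have hfull : ∃ h, g.rep.graph.twin h ≠ h := g.onePI.not_tree
  have hgood : ∀ γ : g.rep.graph.Subgraph, γ.wiring.Good g.res ↔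
      γ.S ≠ {h | g.rep.graph.twin h ≠ h} := fun γ =>
    (γ.good_wiring_iff g.res).trans (and_iff_right ⟨g.onePI, g.extCount_eq⟩)
  rw [coproductGen, finsum_eq_sum_of_fintype, add_assoc]
  congr 1
  rw [← Finset.sum_erase_add _ _ (Finset.mem_univ g.rep.graph.emptySubgraph), add_comm]
  congr 1
  · simp only [hgood]
    rw [← Finset.sum_subset (s₁ := Finset.univ.filter fun γ : g.rep.graph.Subgraph =>
      γ.S ≠ ∅ ∧ γ.S ≠ {h | g.rep.graph.twin h ≠ h})]
    · refine (Finset.sum_subtype _ (fun γ => by simp) (fun γ : g.rep.graph.Subgraph =>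
        γ.toHCK ⊗ₜ[ℂ] gen γ.contract g.res)).symm.trans
          (Finset.sum_congr rfl fun γ hγ => ?_)
      rw [if_pos (Finset.mem_filter.mp hγ).2.2]
    · intro γ hγ
      refine Finset.mem_erase.mpr ⟨?_, Finset.mem_univ _⟩
      rintro rfl
      exact (Finset.mem_filter.mp hγ).2.1 rfl
    · intro γ h1 h2
      have h3 : γ.S ≠ ∅ := fun h => (Finset.mem_erase.mp h1).1
        (FeynmanGraph.Subgraph.eq_emptySubgraph h)
      rw [if_neg, TensorProduct.tmul_zero]
      exact fun h4 => h2 (Finset.mem_filter.mpr ⟨Finset.mem_univ _, h3, h4⟩)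
  · rw [if_pos, FeynmanGraph.Subgraph.toHCK_of_empty rfl,
      gen_of_iso (FeynmanGraph.Subgraph.contractIsoOfEmpty rfl), g.gen_rep]
    rw [hgood]
    obtain ⟨h, hh⟩ := hfull
    exact fun e => Set.ext_iff.mp e h |>.mpr hh

/-! ## Wirings with edge slots -/

theorem Slots.legCount_eq (s : Slots) [Fintype s.A] (k : EdgeType) :
    s.legCount k = ∑ a, legs (s.res a) k := by
  rw [legCount, ← Nat.card_congr (Equiv.sigmaFiberEquiv fun x : {x // s.etype x = k} => s.base x.1),
    Nat.card_sigma]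
  refine Finset.sum_congr rfl fun a _ => (Nat.card_congr ?_).trans (s.valence a k)
  exact ⟨fun x => ⟨x.1.1, x.2, x.1.2⟩, fun x => ⟨⟨x.1, x.2.2⟩, x.2.1⟩, fun _ => rfl, fun _ => rfl⟩

theorem Slots.count_addEdge (s : Slots) (k : EdgeType) (ρ : Residue) :
    (s.addEdge k).count ρ = s.count ρ + if ρ = Sum.inl k then 1 else 0 := by
  have h : Nat.card {_u : Unit // ρ = Sum.inl k} = if ρ = Sum.inl k then 1 else 0 := by
    split_ifs with h
    · simp [h]
    · simp [h]
  rw [← h, Slots.count, Slots.count, ← Nat.card_sum]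
  refine (Nat.card_eq_of_bijective (Sum.elim (fun a => ⟨some a.1, a.2⟩)
    fun u => ⟨none, u.2.symm⟩) ⟨?_, ?_⟩).symm
  · rintro (a | a) (b | b) e
    · exact congrArg Sum.inl (Subtype.ext (Option.some.inj (congrArg Subtype.val e)))
    · cases congrArg Subtype.val e
    · cases congrArg Subtype.val e
    · exact congrArg Sum.inr (Subtype.ext rfl)
  · rintro ⟨a | a, h⟩
    · exact ⟨Sum.inr ⟨(), h.symm⟩, rfl⟩
    · exact ⟨Sum.inl ⟨a, h⟩, rfl⟩

theorem sum_slot {M : Type*} [AddCommMonoid M] (n : Residue → ℕ) (f : Residue → M) :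
    ∑ a : Slot n, f a.1 = ∑ ρ, n ρ • f ρ := by
  rw [Fintype.sum_sigma]
  simp

theorem prod_slot {M : Type*} [CommMonoid M] (n : Residue → ℕ) (f : Residue → M) :
    ∏ a : Slot n, f a.1 = ∏ ρ, f ρ ^ n ρ := by
  rw [Fintype.prod_sigma]
  simp

theorem legCount_slotsOf (n : Residue → ℕ) (k : EdgeType) :
    (slotsOf n).legCount k = ∑ ρ, n ρ * legs ρ k := by
  rw [Slots.legCount_eq (slotsOf n), sum_slot n fun ρ => legs ρ k]
  rfl

theorem wirings_succ (n n' : Residue → ℕ) (k : EdgeType) (r : Residue)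
    (h : ∀ ρ, n' ρ = n ρ + if ρ = Sum.inl k then 1 else 0) :
    wirings n' r = ((∑ ρ, n ρ * legs ρ k : ℕ) - legs r k : ℂ) • wirings n r := by
  rw [wirings, wirings, ← legCount_slotsOf, ← Slots.wiringSum_addEdge]
  refine Slots.wiringSum_eq_of_count (fun ρ => ?_) r
  rw [slotsOf_count, Slots.count_addEdge, slotsOf_count, h]

/-- The sum of the graphs with residue `r` and `N j` vertices of type `j`, each divided by its
symmetry factor. -/
def greenCoeff (r : Residue) (N : Fin 5 →₀ ℕ) : HCK :=
  ∑ g ∈ classes r N, g.sym⁻¹ • MvPolynomial.X g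

theorem corolla_vcount (j : VertexType) : (corolla j).vcount = Finsupp.single j 1 := by
  ext i
  rw [FeynmanGraph.vcount_apply, Finsupp.single_apply]
  change Nat.card {_v : Unit // j = i} = _
  split_ifs with h <;> simp [h]

/-- The ways of cutting a graph into its vertices. -/
theorem sum_dissection_corolla (g : GraphClass) (q : Slot (Sum.elim 0 g.vcount) → Piece)
    (hq : ∀ j x, q ⟨Sum.inr j, x⟩ = Sum.inl j) (G : g.rep.graph.Subgraph → HCK) :
    ∑ w : Dissection (fun a => (q a).graph) (fun a => a.1) g.rep.graph, G w.sub =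
      ((∏ j, ((g.vcount j).factorial : ℂ)) *
        ∏ j, (∏ k, ((legs (Sum.inr j) k).factorial : ℂ)) ^ g.vcount j) •
          G g.rep.graph.emptySubgraph := by
  classical
  set Γ := g.rep.graph
  have hq' : ∀ a, ∃ j, a.1 = Sum.inr j ∧ q a = Sum.inl j := by
    rintro ⟨k | j, x⟩
    · exact x.elim0
    · exact ⟨j, rfl, hq j x⟩
  rw [Dissection.sum_eq, Finset.sum_eq_single Γ.emptySubgraph]
  · have h1 : ∀ e : Placement (Sum.elim 0 g.vcount) Γ.emptySubgraph.res, ∀ a,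
        (Nat.card ((q a).graph.Iso (FeynmanGraph.component Γ.emptySubgraph.S
          Γ.emptySubgraph.twin_mem (e.1 a))) : ℂ) = ∏ k, ((legs a.1 k).factorial : ℂ) := by
      intro e a
      obtain ⟨j, hj, ha⟩ := hq' a
      obtain ⟨p, hp, ⟨f⟩⟩ := Piece.exists_of_fits (component_fits Γ.emptySubgraph (e.1 a))
      rw [e.2] at hp
      rcases p with i | g'
      · have : i = j := Sum.inr.inj (hp.trans hj)
        subst this
        rw [ha, hj, ← Nat.cast_prod, ← corolla_card_iso]
        exact congrArg _ (FeynmanGraph.Iso.card_eq f)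
      · obtain ⟨x, hx⟩ := (g'.onePI.of_iso f).not_tree
        exact absurd ((FeynmanGraph.component_twin_eq_self_iff Γ.emptySubgraph.internal
          Γ.emptySubgraph.twin_mem x).mpr id) hx
    have h2 : Nat.card (Placement (Sum.elim 0 g.vcount) Γ.emptySubgraph.res) =
        ∏ j, (g.vcount j).factorial := by
      obtain ⟨e, he⟩ := exists_equiv_over (fun a : Slot (Sum.elim 0 g.vcount) => a.1)
        Γ.emptySubgraph.res (fun ρ => by
          rw [card_slot_fst]
          rcases ρ with k | j
          · refine (Finite.card_eq_zero_iff.mpr ⟨?_⟩).symm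
            rintro ⟨c, hc⟩
            obtain ⟨v, rfl⟩ := Quotient.exists_rep c
            cases hc
          · refine (Nat.card_eq_of_bijective (fun v : {v // Γ.vtype v = j} =>
              ⟨Quotient.mk _ v.1, congrArg Sum.inr v.2⟩) ⟨?_, ?_⟩)
            · exact fun v w h => Subtype.ext
                (FeynmanGraph.mk_eq_mk_of_empty (Subtype.mk.inj h))
            · rintro ⟨c, hc⟩
              obtain ⟨v, rfl⟩ := Quotient.exists_rep c
              exact ⟨⟨v, Sum.inr.inj hc⟩, rfl⟩)
      rw [card_equiv_over _ _ e he, Fintype.prod_sum_type]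
      simp only [card_slot_fst]
      simp
    simp only [h1]
    rw [Finset.sum_const, Finset.card_univ, ← Nat.card_eq_fintype_card, h2,
      ← Nat.cast_smul_eq_nsmul ℂ, smul_smul, prod_slot (Sum.elim 0 g.vcount) fun ρ => ∏ k, ((legs ρ k).factorial : ℂ),
      Fintype.prod_sum_type]
    simp [Γ]
  -- Any other subgraph has a component with an internal edge. No corolla is isomorphic to it, so a
  -- factor of the product is zero.
  · intro γ _ hγ
    refine Finset.sum_eq_zero fun e _ => ?_
    have hS : γ.S.Nonempty := Set.nonempty_iff_ne_empty.mpr fun h =>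
      hγ (FeynmanGraph.Subgraph.eq_emptySubgraph h)
    obtain ⟨x, hx⟩ := hS
    rw [Finset.prod_eq_zero (Finset.mem_univ (e.1.symm (Γ.compOf γ.S x))), zero_smul]
    rw [Nat.cast_eq_zero, Finite.card_eq_zero_iff]
    refine ⟨fun f => ?_⟩
    rw [Equiv.apply_symm_apply] at f
    obtain ⟨j, -, hj⟩ := hq' (e.1.symm (Γ.compOf γ.S x))
    rw [hj] at f
    obtain ⟨y, hy⟩ := f.onHE.surjective ⟨x, rfl⟩
    have h3 := f.twin_eq y
    rw [hy] at h3
    exact (FeynmanGraph.component_twin_eq_self_iff γ.internal γ.twin_mem _).mp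
      (h3.trans hy) hx
  · exact fun h => absurd (Finset.mem_univ _) h

/-- This is `sum_classes_dissection` with every slot filled by a single vertex. The only subgraph
all of whose components are vertices is the empty one, and its contraction is the graph itself. The
constants count the numberings of the vertices and the permutations of the half-edges at each of
them. -/
theorem wirings_vertices (r : Residue) (N : Fin 5 →₀ ℕ) :
    (∏ k, ((legs r k).factorial : ℂ)) • wirings (Sum.elim 0 N) r =
      ((∏ j, ((N j).factorial : ℂ)) *
        ∏ j, (∏ k, ((legs (Sum.inr j) k).factorial : ℂ)) ^ N j) • greenCoeff r N := by
  classical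
  let q : Slot (Sum.elim 0 N) → Piece := fun a => Sum.elim (fun _ => Sum.inl 0) Sum.inl a.1
  have hq : ∀ a, (q a).res = a.1 := by
    rintro ⟨k | j, x⟩
    · exact x.elim0
    · rfl
  have h1 := sum_classes_dissection _ r N q hq
  have hN : ∑ a, (q a).vcount = N := by
    have : ∀ j, Piece.vcount (Sum.inl j) = Finsupp.single j 1 := corolla_vcount
    rw [sum_slot (Sum.elim 0 N) fun ρ => Piece.vcount (Sum.elim (fun _ => Sum.inl 0) Sum.inl ρ),
      Fintype.sum_sum_type]
    ext i
    simp [this]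
  rw [if_pos hN] at h1
  rw [← h1, greenCoeff, Finset.smul_sum]
  refine Finset.sum_congr rfl fun g hg => ?_
  obtain ⟨rfl, rfl⟩ := mem_classes.mp hg
  rw [smul_comm]
  congr 1
  have hgood : g.rep.graph.emptySubgraph.wiring.Good g.res := by
    refine (FeynmanGraph.Subgraph.good_wiring_iff _ _).mpr ⟨⟨g.onePI, g.extCount_eq⟩, fun e => ?_⟩
    obtain ⟨h, hh⟩ := g.onePI.not_tree
    exact Set.ext_iff.mp e h |>.mpr hh
  refine (sum_dissection_corolla g q (fun _ _ => rfl)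
    fun γ => if γ.wiring.Good g.res then gen γ.contract g.res else 0).trans ?_
  rw [if_pos hgood, gen_of_iso (FeynmanGraph.Subgraph.contractIsoOfEmpty rfl), g.gen_rep]

end QCD

namespace QCD

/-! ## Real powers of power series -/

section RealPower

set_option linter.unusedSectionVars false

variable {σ : Type*} {R : Type*} [CommRing R] [Algebra ℂ R]

/-- Real powers of a series with constant term `1`, by the binomial series. -/
def pw (F : MvPowerSeries σ R) (α : ℝ) : MvPowerSeries σ R :=
  (PowerSeries.binomialSeries ℂ α).subst (F - 1)

theorem rpow_eq_pw (F : HCKHat) (α : ℝ) : rpow F α = pw F α := rfl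

variable {F : MvPowerSeries σ R} 

theorem hasSubst_sub_one (hF : MvPowerSeries.constantCoeff F = 1) : PowerSeries.HasSubst (F - 1) :=
  PowerSeries.HasSubst.of_constantCoeff_zero (by rw [map_sub, hF, map_one, sub_self])

theorem pw_add (hF : MvPowerSeries.constantCoeff F = 1) (α β : ℝ) :
    pw F (α + β) = pw F α * pw F β := by
  rw [pw, PowerSeries.binomialSeries_add, PowerSeries.subst_mul (hasSubst_sub_one hF)]
  rfl

theorem pw_zero (hF : MvPowerSeries.constantCoeff F = 1) : pw F 0 = 1 := by
  rw [pw, PowerSeries.binomialSeries_zero, ← PowerSeries.coe_substAlgHom (hasSubst_sub_one hF),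
    map_one]

theorem pw_one (hF : MvPowerSeries.constantCoeff F = 1) : pw F 1 = F := by
  have : PowerSeries.binomialSeries ℂ (1 : ℝ) = 1 + PowerSeries.X := by
    simpa using PowerSeries.binomialSeries_nat (R := ℝ) (A := ℂ) 1
  rw [pw, this, ← PowerSeries.coe_substAlgHom (hasSubst_sub_one hF), map_add, map_one,
    PowerSeries.substAlgHom_X, add_sub_cancel]

theorem pw_nat_mul (hF : MvPowerSeries.constantCoeff F = 1) (n : ℕ) (α : ℝ) :
    pw F (n * α) = pw F α ^ n := by
  induction n with
  | zero => rw [Nat.cast_zero, zero_mul, pw_zero hF, pow_zero]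
  | succ n ih => rw [Nat.cast_succ, add_one_mul, pw_add hF, ih, pow_succ]

theorem pw_half_sq (hF : MvPowerSeries.constantCoeff F = 1) : pw F (1 / 2) ^ 2 = F := by
  rw [← pw_nat_mul hF, show ((2 : ℕ) : ℝ) * (1 / 2) = 1 by norm_num, pw_one hF]

theorem pw_half_mul (hF : MvPowerSeries.constantCoeff F = 1) :
    pw F (1 / 2) * pw F (-(1 / 2)) = 1 := by
  rw [← pw_add hF, add_neg_cancel, pw_zero hF]

theorem constantCoeff_pw (hF : MvPowerSeries.constantCoeff F = 1) (α : ℝ) :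
    MvPowerSeries.constantCoeff (pw F α) = 1 := by
  rw [pw, PowerSeries.constantCoeff_subst (hasSubst_sub_one hF), finsum_eq_single _ 0]
  · simp
  · intro n hn
    rw [map_pow, map_sub, hF, map_one, sub_self, zero_pow hn, smul_zero]

/-- The sum `a + b` has constant term 2, hence is a unit over a complex algebra, and it annihilates
`a - b`. Uniqueness of roots later replaces any computation with binomial series under ring maps and
coproducts. -/
theorem eq_of_sq_eq_sq {a b : MvPowerSeries σ R} (ha : MvPowerSeries.constantCoeff a = 1)
    (hb : MvPowerSeries.constantCoeff b = 1) (h : a ^ 2 = b ^ 2) : a = b := by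
  have h2 : IsUnit (a + b) := by
    rw [MvPowerSeries.isUnit_iff_constantCoeff, map_add, ha, hb]
    have : (1 : R) + 1 = algebraMap ℂ R 2 := by rw [map_ofNat]; norm_num
    rw [this]
    exact (IsUnit.mk0 (2 : ℂ) two_ne_zero).map _
  have h3 : (a + b) * (a - b) = 0 := by linear_combination h
  exact sub_eq_zero.mp (h2.mul_right_eq_zero.mp h3)

/-- The square root of a series with constant term `1` is unique. -/
theorem eq_pw_half (hF : MvPowerSeries.constantCoeff F = 1) {a : MvPowerSeries σ R}
    (ha : MvPowerSeries.constantCoeff a = 1) (h : a ^ 2 = F) : a = pw F (1 / 2) :=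
  eq_of_sq_eq_sq ha (constantCoeff_pw hF _) (h.trans (pw_half_sq hF).symm)

end RealPower

/-! ## Equality of power series up to a degree -/

section EqUpTo

variable {σ : Type*} {R : Type*} [CommRing R]

/-- The coefficients up to degree `d` are the same. -/
def EqUpTo (d : ℕ) (f g : MvPowerSeries σ R) : Prop :=
  ∀ M : σ →₀ ℕ, M.degree ≤ d → MvPowerSeries.coeff M f = MvPowerSeries.coeff M g

variable {d : ℕ} {f g f' g' : MvPowerSeries σ R}

theorem EqUpTo.refl (f : MvPowerSeries σ R) : EqUpTo d f f := fun _ _ => rfl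

theorem EqUpTo.mul (h : EqUpTo d f g) (h' : EqUpTo d f' g') : EqUpTo d (f * f') (g * g') := by
  classical
  intro M hM
  rw [MvPowerSeries.coeff_mul, MvPowerSeries.coeff_mul]
  refine Finset.sum_congr rfl fun p hp => ?_
  rw [← Finset.HasAntidiagonal.mem_antidiagonal.mp hp, map_add] at hM
  rw [h _ (le_self_add.trans hM), h' _ (le_add_self.trans hM)]

theorem EqUpTo.prod {ι : Type*} {s : Finset ι} {f g : ι → MvPowerSeries σ R}
    (h : ∀ i ∈ s, EqUpTo d (f i) (g i)) : EqUpTo d (∏ i ∈ s, f i) (∏ i ∈ s, g i) := by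
  classical
  induction s using Finset.induction_on with
  | empty => exact .refl _
  | insert i s hi ih =>
    rw [Finset.prod_insert hi, Finset.prod_insert hi]
    exact (h i (Finset.mem_insert_self _ _)).mul (ih fun j hj => h j (Finset.mem_insert_of_mem hj))

theorem coeff_prod_pow_eq_zero {ι : Type*} (s : Finset ι) (a : ι → MvPowerSeries σ R)
    (ha : ∀ i ∈ s, MvPowerSeries.constantCoeff (a i) = 0) (n : ι → ℕ) (M : σ →₀ ℕ)
    (hM : M.degree < ∑ i ∈ s, n i) : MvPowerSeries.coeff M (∏ i ∈ s, a i ^ n i) = 0 := by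
  refine MvPowerSeries.coeff_of_lt_order (lt_of_lt_of_le (Nat.cast_lt.mpr hM) ?_)
  refine le_trans ?_ (MvPowerSeries.le_order_prod _ _)
  rw [Nat.cast_sum]
  refine Finset.sum_le_sum fun i hi => ?_
  refine le_trans ?_ (MvPowerSeries.le_order_pow _)
  have h1 : 1 ≤ (a i).order := MvPowerSeries.one_le_order_iff_constCoeff_eq_zero.mpr (ha i hi)
  calc (n i : ℕ∞) = n i • 1 := by simp
    _ ≤ n i • (a i).order := nsmul_le_nsmul_right h1 _

/-- A real power is given up to degree `d` by finitely many terms of the binomial series. -/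
theorem pw_eqUpTo [Algebra ℂ R] {F : MvPowerSeries σ R}
    (hF : MvPowerSeries.constantCoeff F = 1) (α : ℝ) (d : ℕ) :
    EqUpTo d (pw F α) (∑ m : Fin (d + 1), ((Ring.choose α (m : ℕ) : ℝ) : ℂ) • (F - 1) ^ (m : ℕ)) := by
  intro M hM
  have hF' : MvPowerSeries.constantCoeff (F - 1) = 0 := by rw [map_sub, hF, map_one, sub_self]
  rw [pw, PowerSeries.coeff_subst (hasSubst_sub_one hF),
    finsum_eq_sum_of_support_subset (s := Finset.range (d + 1)), map_sum, Finset.sum_range]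
  · refine Finset.sum_congr rfl fun m _ => ?_
    rw [PowerSeries.binomialSeries_coeff, Complex.real_smul, mul_one]
    rfl
  · intro m hm
    by_contra hmd
    refine hm ?_
    have h := coeff_prod_pow_eq_zero (Finset.univ (α := Unit)) (fun _ => F - 1) (fun _ _ => hF')
      (fun _ => m) M (by
        simp at hmd ⊢
        omega)
    simp only [Finset.univ_unique, Finset.prod_singleton] at h
    change _ • MvPowerSeries.coeff M ((F - 1) ^ m) = 0
    rw [h, smul_zero]

/-- The recursion of the binomial coefficients, rescaled by `-2`. -/
theorem choose_rescale (t : ℝ) (m : ℕ) :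
    (Ring.choose (-t / 2) m : ℝ) * (-2) ^ m = (∏ i ∈ Finset.range m, (t + 2 * i)) / m.factorial := by
  have h : ∀ a : ℝ, (descPochhammer ℤ m).smeval a = ∏ i ∈ Finset.range m, (a - i) := fun a => by
    induction m with
    | zero => simp
    | succ m ih =>
      rw [descPochhammer_succ_right, Polynomial.smeval_mul, ih, Finset.prod_range_succ,
        Polynomial.smeval_sub, Polynomial.smeval_X, Polynomial.smeval_natCast]
      simp
  rw [Ring.choose_eq_smul, h, smul_eq_mul, mul_assoc, mul_comm, div_eq_mul_inv]
  congr 1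
  rw [← Finset.card_range m, ← Finset.prod_const, Finset.card_range, ← Finset.prod_mul_distrib]
  exact Finset.prod_congr rfl fun i _ => by ring

/-- Substitution is given up to degree `d` by finitely many terms. -/
theorem subst_eqUpTo {n : ℕ} {S : Type*} [CommRing S] {c : Fin n → MvPowerSeries σ S}
    (hc : ∀ i, MvPowerSeries.constantCoeff (c i) = 0) (f : MvPowerSeries (Fin n) S) (d : ℕ) :
    EqUpTo d (f.subst c) (∑ m : Fin n → Fin (d + 1), MvPowerSeries.C (MvPowerSeries.coeff
      (Finsupp.equivFunOnFinite.symm fun i => (m i : ℕ)) f) * ∏ i, c i ^ (m i : ℕ)) := by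
  classical
  intro M hM
  rw [MvPowerSeries.coeff_subst (MvPowerSeries.hasSubst_of_constantCoeff_zero hc), map_sum]
  have hinj : Function.Injective fun m : Fin n → Fin (d + 1) =>
      (Finsupp.equivFunOnFinite.symm fun i => (m i : ℕ)) := fun a b h => by
    funext i
    exact Fin.ext (DFunLike.congr_fun h i)
  rw [finsum_eq_sum_of_support_subset (s := Finset.univ.image fun m : Fin n → Fin (d + 1) =>
      (Finsupp.equivFunOnFinite.symm fun i => (m i : ℕ))), Finset.sum_image hinj.injOn]
  · refine Finset.sum_congr rfl fun m _ => ?_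
    rw [MvPowerSeries.coeff_C_mul, Finsupp.prod_fintype _ _ (fun _ => pow_zero _)]
    rfl
  · intro e he
    by_contra hmd
    refine he ?_
    have h := coeff_prod_pow_eq_zero Finset.univ c (fun i _ => hc i) e M (by
      by_contra hlt
      refine hmd ?_
      have h1 : ∀ i, e i < d + 1 := fun i => Nat.lt_succ_of_le
        ((Finset.single_le_sum (fun _ _ => Nat.zero_le _) (Finset.mem_univ i)).trans
          ((not_lt.mp hlt).trans hM))
      rw [Finset.coe_image]
      exact ⟨fun i => ⟨e i, h1 i⟩, Finset.mem_coe.mpr (Finset.mem_univ _), Finsupp.ext fun _ => rfl⟩)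
    change _ • MvPowerSeries.coeff M _ = 0
    rw [Finsupp.prod_fintype _ _ (fun _ => pow_zero _), h, smul_zero]

end EqUpTo

end QCD

namespace QCD

/-! ## The Green's functions as power series in the couplings -/

theorem FeynmanGraph.vcount_ne_zero {Γ : FeynmanGraph} (h : Nonempty Γ.V) : Γ.vcount ≠ 0 := by
  intro h0
  have := Γ.card_V
  rw [h0, map_zero] at this
  exact Nat.card_pos.ne' this

theorem GraphClass.vcount_ne_zero (g : GraphClass) : g.vcount ≠ 0 :=
  FeynmanGraph.vcount_ne_zero g.onePI.connected.1

theorem greenCoeff_zero (r : Residue) : greenCoeff r 0 = 0 :=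
  Finset.sum_eq_zero fun g hg => absurd (mem_classes.mp hg).2 g.vcount_ne_zero

/-- The sum of all graphs with residue `r`, as a power series in the couplings. -/
def graphSeries (r : Residue) : MvPowerSeries (Fin 5) HCK := fun N => greenCoeff r N

theorem coeff_graphSeries (r : Residue) (N : Fin 5 →₀ ℕ) :
    MvPowerSeries.coeff N (graphSeries r) = greenCoeff r N := rfl

theorem constantCoeff_graphSeries (r : Residue) :
    MvPowerSeries.constantCoeff (graphSeries r) = 0 := greenCoeff_zero r

/-- The Green's function of `r`, as a power series in the couplings; that of a vertex is multiplied
by its coupling. -/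
def greenSeries : Residue → MvPowerSeries (Fin 5) HCK
  | Sum.inl k => 1 - graphSeries (Sum.inl k)
  | Sum.inr j => MvPowerSeries.X j + graphSeries (Sum.inr j)

theorem constantCoeff_greenSeries_edge (k : EdgeType) :
    MvPowerSeries.constantCoeff (greenSeries (Sum.inl k)) = 1 := by
  rw [greenSeries, map_sub, constantCoeff_graphSeries, map_one, sub_zero]

theorem constantCoeff_greenSeries_vertex (j : VertexType) :
    MvPowerSeries.constantCoeff (greenSeries (Sum.inr j)) = 0 := by
  rw [greenSeries, map_add, constantCoeff_graphSeries, add_zero, MvPowerSeries.constantCoeff_X]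

open Classical in
/-- The sum of all pieces with residue `r`, weighted by their automorphisms. -/
def pieceSeries (r : Residue) : MvPowerSeries (Fin 5) HCK := fun M =>
  ∑ p ∈ Piece.upTo r M with p.vcount = M, (p.aut : ℂ)⁻¹ • p.val

open Classical in
theorem coeff_pieceSeries (r : Residue) (M : Fin 5 →₀ ℕ) :
    MvPowerSeries.coeff M (pieceSeries r) =
      ∑ p ∈ Piece.upTo r M with p.vcount = M, (p.aut : ℂ)⁻¹ • p.val := rfl

/-- The symmetry factor is the order of the automorphism group divided by the permutations of the
external lines, so this constant turns automorphism weights into symmetry weights. For a corolla the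
automorphisms are exactly these permutations, and it contributes the bare coupling with coefficient
1. -/
theorem smul_pieceSeries (r : Residue) :
    (∏ k, ((legs r k).factorial : ℂ)) • pieceSeries r =
      Sum.elim (fun _ => 0) MvPowerSeries.X r + graphSeries r := by
  classical
  ext1 M
  change (∏ k, ((legs r k).factorial : ℂ)) • MvPowerSeries.coeff M (pieceSeries r) = _
  rw [coeff_pieceSeries, map_add, coeff_graphSeries]
  rw [← Finset.toLeft_disjSum_toRight (u := Finset.filter (fun p => Piece.vcount p = M) (Piece.upTo r M)),
    Finset.sum_disjSum, smul_add]
  congr 1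
  · rcases r with k | j
    · rw [Finset.sum_eq_zero, smul_zero, Sum.elim_inl, map_zero]
      intro j hj
      have := (Piece.mem_upTo.mp (Finset.mem_filter.mp (Finset.mem_toLeft.mp hj)).1).1
      cases this
    · have h1 : Finset.toLeft (Finset.filter (fun p => Piece.vcount p = M) (Piece.upTo (Sum.inr j) M)) =
          if M = Finsupp.single j 1 then {j} else ∅ := by
        ext i
        rw [Finset.mem_toLeft, Finset.mem_filter, Piece.mem_upTo]
        have h2 : Piece.vcount (Sum.inl i) = Finsupp.single i 1 := corolla_vcount i
        rw [h2]
        split_ifs with h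
        · rw [Finset.mem_singleton]
          refine ⟨fun h3 => Sum.inr.inj h3.1.1, ?_⟩
          rintro rfl
          exact ⟨⟨rfl, h.ge⟩, h.symm⟩
        · refine ⟨fun h3 => absurd ?_ h, fun h3 => absurd h3 (Finset.notMem_empty _)⟩
          rw [← h3.2, Sum.inr.inj h3.1.1]
      rw [h1, Sum.elim_inr, MvPowerSeries.coeff_X]
      split_ifs with h
      · rw [Finset.sum_singleton, smul_smul]
        have h3 : (Piece.aut (Sum.inl j) : ℂ) = ∏ k, ((legs (Sum.inr j) k).factorial : ℂ) := by
          rw [← Nat.cast_prod, ← corolla_card_iso]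
          rfl
        rw [← h3, mul_inv_cancel₀ (Piece.aut_ne_zero _), one_smul]
        rfl
      · rw [Finset.sum_empty, smul_zero]
  · have h1 : Finset.toRight (Finset.filter (fun p => Piece.vcount p = M) (Piece.upTo r M)) = classes r M := by
      ext g
      rw [Finset.mem_toRight, Finset.mem_filter, Piece.mem_upTo, mem_classes]
      exact ⟨fun h => ⟨h.1.1, h.2⟩, fun h => ⟨⟨h.1, h.2.le⟩, h.2⟩⟩
    rw [h1, Finset.smul_sum, greenCoeff]
    refine Finset.sum_congr rfl fun g hg => ?_
    rw [smul_smul, GraphClass.sym, inv_div, (mem_classes.mp hg).1]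
    rfl

theorem pieceSeries_eqUpTo (r : Residue) (N : Fin 5 →₀ ℕ) (M : Fin 5 →₀ ℕ) (hM : M ≤ N) :
    MvPowerSeries.coeff M (pieceSeries r) = MvPowerSeries.coeff M
      (∑ p ∈ Piece.upTo r N, MvPowerSeries.monomial p.vcount ((p.aut : ℂ)⁻¹ • p.val)) := by
  classical
  rw [coeff_pieceSeries, map_sum]
  simp only [MvPowerSeries.coeff_monomial]
  rw [← Finset.sum_filter]
  refine Finset.sum_congr (Finset.ext fun p => ?_) fun _ _ => rfl
  simp only [Finset.mem_filter, Piece.mem_upTo]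
  constructor
  · rintro ⟨⟨h1, h2⟩, rfl⟩
    exact ⟨⟨h1, hM⟩, rfl⟩
  · rintro ⟨⟨h1, h2⟩, rfl⟩
    exact ⟨⟨h1, le_rfl⟩, rfl⟩

/-- Expanding the product of series chooses one piece for each slot. Pieces with more than `N`
vertices of some type cannot contribute to the coefficient at `N`, so each series may be replaced by
a finite sum. -/
theorem sum_pieces_eq_coeff (n : Residue → ℕ) (N : Fin 5 →₀ ℕ)
    [∀ q : Slot n → Piece, Decidable (∑ a, (q a).vcount = N)] :
    ∑ q ∈ Fintype.piFinset fun a : Slot n => Piece.upTo a.1 N,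
        (if ∑ a, (q a).vcount = N then ∏ a, ((q a).aut : ℂ)⁻¹ • (q a).val else 0) =
      MvPowerSeries.coeff N (∏ ρ, pieceSeries ρ ^ n ρ) := by
  classical
  rw [← prod_slot n pieceSeries]
  have key : ∀ (s : Finset (Slot n)) (M : Fin 5 →₀ ℕ), M ≤ N →
      MvPowerSeries.coeff M (∏ a ∈ s, pieceSeries a.1) = MvPowerSeries.coeff M (∏ a ∈ s,
        ∑ p ∈ Piece.upTo a.1 N, MvPowerSeries.monomial p.vcount ((p.aut : ℂ)⁻¹ • p.val)) := by
    intro s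
    induction s using Finset.induction_on with
    | empty => exact fun _ _ => rfl
    | insert a s ha ih =>
      intro M hM
      rw [Finset.prod_insert ha, Finset.prod_insert ha, MvPowerSeries.coeff_mul,
        MvPowerSeries.coeff_mul]
      refine Finset.sum_congr rfl fun p hp => ?_
      rw [← Finset.HasAntidiagonal.mem_antidiagonal.mp hp] at hM
      rw [pieceSeries_eqUpTo _ N _ (le_self_add.trans hM), ih _ (le_add_self.trans hM)]
  rw [key _ _ le_rfl, Finset.prod_univ_sum, map_sum]
  refine Finset.sum_congr rfl fun q _ => ?_
  rw [MvPowerSeries.prod_monomial, MvPowerSeries.coeff_monomial]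
  simp only [eq_comm]

/-! ## The coproduct of the Green's functions -/

/-- Slots with two lines are inserted one by one into the edges. -/
theorem wirings_edges (r : Residue) (N : Fin 5 →₀ ℕ) (m : EdgeType → ℕ) :
    wirings (Sum.elim m N) r = (∏ k, ∏ i ∈ Finset.range (m k),
      ((∑ j, N j * vertexLegs j k : ℕ) - legs r k + 2 * i : ℂ)) • wirings (Sum.elim 0 N) r := by
  induction h : ∑ k, m k generalizing m with
  | zero =>
    have : m = 0 := funext fun k => (Finset.sum_eq_zero_iff.mp h) k (Finset.mem_univ k)
    subst this
    simp
  | succ s ih =>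
    obtain ⟨k, -, hk⟩ : ∃ k ∈ Finset.univ, 0 < m k := by
      by_contra! hc
      rw [Finset.sum_eq_zero fun k hk => Nat.le_zero.mp (hc k hk)] at h
      cases h
    obtain ⟨m', hm'⟩ : ∃ m' : EdgeType → ℕ, m = m' + Pi.single k 1 :=
      ⟨m - Pi.single k 1, funext fun i => by
        by_cases hi : i = k
        · subst hi; simp; omega
        · simp [Pi.single_eq_of_ne hi]⟩
    have hs : ∑ i, m' i = s := by
      rw [hm'] at h
      simp only [Pi.add_apply, Finset.sum_add_distrib] at h
      rw [Finset.sum_pi_single' ] at h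
      simpa using h
    -- The slot removed accounts for the last factor of the product for `k`: each of the `m' k`
    -- slots of type `k` still present adds two legs of type `k`, whence the term `2 * i`.
    rw [wirings_succ (Sum.elim m' N) _ k, ih m' hs, smul_smul]
    · congr 1
      rw [← Finset.mul_prod_erase _ _ (Finset.mem_univ k), ← Finset.mul_prod_erase _ _
        (Finset.mem_univ k), hm', ← mul_assoc]
      congr 1
      · rw [Pi.add_apply, Pi.single_eq_same, Finset.prod_range_succ, mul_comm]
        congr 1
        rw [Fintype.sum_sum_type]
        simp [legs]
        ring
      · refine Finset.prod_congr rfl fun i hi => ?_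
        rw [Pi.add_apply, Pi.single_eq_of_ne (Finset.ne_of_mem_erase hi), add_zero]
    · rintro (i | j)
      · rw [hm']
        by_cases hi : i = k
        · subst hi; simp
        · simp [hi]
      · simp

end QCD

namespace QCD

/-! ### Wave function factors, running couplings and resummation over edge slots -/

/-- The square root of the Green's function of an edge. -/
def waveSeries (k : EdgeType) : MvPowerSeries (Fin 5) HCK := pw (greenSeries (Sum.inl k)) (1 / 2)

/-- The inverse of `waveSeries k`. -/
def waveInv (k : EdgeType) : MvPowerSeries (Fin 5) HCK := pw (greenSeries (Sum.inl k)) (-(1 / 2))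

/-- The running coupling. -/
def couplingSeries (j : VertexType) : MvPowerSeries (Fin 5) HCK :=
  greenSeries (Sum.inr j) * ∏ k, waveInv k ^ vertexLegs j k

theorem waveSeries_mul_waveInv (k : EdgeType) : waveSeries k * waveInv k = 1 :=
  pw_half_mul (constantCoeff_greenSeries_edge k)

theorem waveSeries_sq (k : EdgeType) : waveSeries k ^ 2 = greenSeries (Sum.inl k) :=
  pw_half_sq (constantCoeff_greenSeries_edge k)

theorem constantCoeff_waveSeries (k : EdgeType) :
    MvPowerSeries.constantCoeff (waveSeries k) = 1 :=
  constantCoeff_pw (constantCoeff_greenSeries_edge k) _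

theorem constantCoeff_couplingSeries (j : VertexType) :
    MvPowerSeries.constantCoeff (couplingSeries j) = 0 := by
  rw [couplingSeries, map_mul, constantCoeff_greenSeries_vertex, zero_mul]

/-- Every running coupling carries one inverse root for each of its lines. The exponents of the
Green's function of an edge add up to half of the legs of `r` minus the legs of all vertex slots. -/
theorem wave_mul_coupling (r : Residue) (n : VertexType → ℕ) :
    (∏ k, waveSeries k ^ legs r k) * ∏ j, couplingSeries j ^ n j =
      (∏ k, pw (greenSeries (Sum.inl k))
        (-((∑ j, n j * vertexLegs j k : ℕ) - legs r k : ℝ) / 2)) *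
          ∏ j, greenSeries (Sum.inr j) ^ n j := by
  have h1 : ∀ k, pw (greenSeries (Sum.inl k))
      (-((∑ j, n j * vertexLegs j k : ℕ) - legs r k : ℝ) / 2) =
        waveSeries k ^ legs r k * ∏ j, (waveInv k ^ vertexLegs j k) ^ n j := fun k => by
    have hc := constantCoeff_greenSeries_edge k
    rw [waveSeries, waveInv, ← pw_nat_mul hc]
    simp only [← pow_mul]
    rw [Finset.prod_pow_eq_pow_sum, ← pw_nat_mul hc, ← pw_add hc]
    congr 1
    push_cast
    simp only [mul_comm (n _ : ℝ)]
    ring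
  simp only [h1, couplingSeries, mul_pow, Finset.prod_mul_distrib]
  rw [Finset.prod_comm]
  simp only [Finset.prod_pow]
  ring

theorem greenSeries_edge_sub_one (k : EdgeType) :
    greenSeries (Sum.inl k) - 1 = (-2 : ℂ) • pieceSeries (Sum.inl k) := by
  have h := smul_pieceSeries (Sum.inl k)
  have h2 : (∏ k', ((legs (Sum.inl k) k').factorial : ℂ)) = 2 := by
    rw [Finset.prod_eq_single k]
    · simp [legs]
    · intro b _ hb
      simp [legs, hb]
    · simp
  rw [h2, Sum.elim_inl, zero_add] at h
  rw [greenSeries, ← h, neg_smul]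
  ring

theorem greenSeries_vertex (j : VertexType) : greenSeries (Sum.inr j) =
    (∏ k, ((legs (Sum.inr j) k).factorial : ℂ)) • pieceSeries (Sum.inr j) :=
  (smul_pieceSeries (Sum.inr j)).symm

-- The slots are split into edge slots `m` and vertex slots `n`. For fixed `n`, the wirings with `m`
-- edge slots are a product of terms t + 2i times those without edge slots. With the 1/m! this
-- product is the binomial coefficient of -t/2 times (-2)^m, and the Green's function of an edge is
-- 1 minus twice its series of pieces. Hence the sum over `m` is the binomial series of a power of
-- that function, and `wave_mul_coupling` identifies the result. The vertex slots alone give the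
-- graphs with `n` vertices, and the factorials cancel.
open Classical in
theorem sum_classes_subgraph_eq (r : Residue) (N : Fin 5 →₀ ℕ) :
    ∑ g ∈ classes r N, g.sym⁻¹ • ∑ γ : g.rep.graph.Subgraph,
      γ.toHCK ⊗ₜ[ℂ] (if γ.wiring.Good r then gen γ.contract r else 0) =
      ∑ n : VertexType → Fin (N.degree + 1),
        MvPowerSeries.coeff N
          ((∏ k, waveSeries k ^ legs r k) * ∏ j, couplingSeries j ^ (n j : ℕ)) ⊗ₜ
          greenCoeff r (Finsupp.equivFunOnFinite.symm fun j => (n j : ℕ)) := by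
  have h1 : ∀ n : Residue → Fin (N.degree + 1),
      ∑ q ∈ Fintype.piFinset fun a : Slot fun ρ => n ρ => Piece.upTo a.1 N,
          (if ∑ a, (q a).vcount = N then (∏ a, ((q a).aut : ℂ)⁻¹ • (q a).val) ⊗ₜ[ℂ]
            ((∏ k, ((legs r k).factorial : ℂ)) • wirings (fun ρ => n ρ) r) else 0) =
      MvPowerSeries.coeff N (∏ ρ, pieceSeries ρ ^ (n ρ : ℕ)) ⊗ₜ
        ((∏ k, ((legs r k).factorial : ℂ)) • wirings (fun ρ => n ρ) r) := fun n => by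
    rw [← sum_pieces_eq_coeff (fun ρ => n ρ), TensorProduct.sum_tmul]
    refine Finset.sum_congr rfl fun q _ => ?_
    split_ifs
    · rfl
    · rw [TensorProduct.zero_tmul]
  rw [sum_classes_subgraph]
  simp only [h1]
  rw [← (Equiv.sumArrowEquivProdArrow EdgeType VertexType (Fin (N.degree + 1))).symm.sum_comp,
    Fintype.sum_prod_type_right]
  refine Finset.sum_congr rfl fun n _ => ?_
  set n' : Fin 5 →₀ ℕ := Finsupp.equivFunOnFinite.symm fun j => (n j : ℕ) with hn'
  have hn : ∀ j, n' j = n j := fun j => rfl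
  -- Truncation of the binomial series at the total degree of `N` is harmless, since the series that
  -- is raised to powers has no constant term.
  have h2 : EqUpTo N.degree ((∏ k, waveSeries k ^ legs r k) * ∏ j, couplingSeries j ^ (n j : ℕ))
      (∑ m : EdgeType → Fin (N.degree + 1), (∏ k, ((Ring.choose
        (-((∑ j, n j * vertexLegs j k : ℕ) - legs r k : ℝ) / 2) (m k : ℕ) : ℝ) : ℂ) •
          (greenSeries (Sum.inl k) - 1) ^ (m k : ℕ)) *
            ∏ j, greenSeries (Sum.inr j) ^ (n j : ℕ)) := by
    rw [wave_mul_coupling, ← Finset.sum_mul]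
    refine EqUpTo.mul ?_ (.refl _)
    rw [← Fintype.piFinset_univ, ← Finset.prod_univ_sum (fun _ : EdgeType => Finset.univ)
      (fun k (i : Fin (N.degree + 1)) => ((Ring.choose
        (-((∑ j, n j * vertexLegs j k : ℕ) - legs r k : ℝ) / 2) (i : ℕ) : ℝ) : ℂ) •
          (greenSeries (Sum.inl k) - 1) ^ (i : ℕ))]
    exact EqUpTo.prod fun k _ => pw_eqUpTo (constantCoeff_greenSeries_edge k) _ _
  rw [h2 N le_rfl, map_sum, TensorProduct.sum_tmul]
  refine Finset.sum_congr rfl fun m _ => ?_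
  have h3 : (fun ρ : Residue => (((Equiv.sumArrowEquivProdArrow EdgeType VertexType
      (Fin (N.degree + 1))).symm (m, n) ρ : Fin _) : ℕ)) = Sum.elim (fun k => (m k : ℕ)) n' := by
    funext ρ
    rcases ρ with k | j <;> rfl
  have h3' : ∀ ρ : Residue, (((Equiv.sumArrowEquivProdArrow EdgeType VertexType
      (Fin (N.degree + 1))).symm (m, n) ρ : Fin _) : ℕ) = Sum.elim (fun k => (m k : ℕ)) n' ρ :=
    congrFun h3
  rw [h3]
  simp only [h3']
  rw [wirings_edges, smul_comm, wirings_vertices, smul_smul, TensorProduct.tmul_smul, smul_smul]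
  have h4 : ∀ k, ((Ring.choose (-((∑ j, n j * vertexLegs j k : ℕ) - legs r k : ℝ) / 2)
      (m k : ℕ) : ℝ) : ℂ) • (greenSeries (Sum.inl k) - 1) ^ (m k : ℕ) =
      ((∏ i ∈ Finset.range (m k), ((∑ j, n' j * vertexLegs j k : ℕ) - legs r k + 2 * i : ℂ)) /
        (m k : ℕ).factorial) • pieceSeries (Sum.inl k) ^ (m k : ℕ) := fun k => by
    rw [greenSeries_edge_sub_one, smul_pow, smul_smul]
    congr 1
    have h5 := congrArg (fun x : ℝ => (x : ℂ)) (choose_rescale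
      ((∑ j, n j * vertexLegs j k : ℕ) - legs r k : ℝ) (m k))
    push_cast at h5 ⊢
    simp only [hn]
    exact h5
  simp only [h4, greenSeries_vertex, smul_pow, Finset.prod_smul]
  rw [smul_mul_smul_comm]
  have h6 : ∀ (z : ℂ) (F : MvPowerSeries (Fin 5) HCK),
      MvPowerSeries.coeff N (z • F) = z • MvPowerSeries.coeff N F := fun _ _ => rfl
  rw [h6, ← TensorProduct.smul_tmul', Fintype.prod_sum_type, Fintype.prod_sum_type]
  congr 1
  simp only [Sum.elim_inl, Sum.elim_inr, Finset.prod_div_distrib, hn]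
  have h7 : ∏ j, ((n j : ℕ).factorial : ℂ) ≠ 0 :=
    Finset.prod_ne_zero_iff.mpr fun j _ => Nat.cast_ne_zero.mpr (Nat.factorial_ne_zero _)
  have h8 : ∏ j, ((m j : ℕ).factorial : ℂ) ≠ 0 :=
    Finset.prod_ne_zero_iff.mpr fun j _ => Nat.cast_ne_zero.mpr (Nat.factorial_ne_zero _)
  field_simp

/-- The inclusion of the first factor, on coefficients. -/
def inclL {B : Type*} [CommRing B] [Algebra ℂ B] :
    MvPowerSeries (Fin 5) B →+* MvPowerSeries (Fin 5) (B ⊗[ℂ] B) :=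
  MvPowerSeries.map (Algebra.TensorProduct.includeLeft (R := ℂ) (S := ℂ) (A := B) (B := B)).toRingHom

/-- The inclusion of the second factor, on coefficients. -/
def inclR {B : Type*} [CommRing B] [Algebra ℂ B] :
    MvPowerSeries (Fin 5) B →+* MvPowerSeries (Fin 5) (B ⊗[ℂ] B) :=
  MvPowerSeries.map (Algebra.TensorProduct.includeRight (R := ℂ) (A := B) (B := B)).toRingHom

theorem coeff_inclL {B : Type*} [CommRing B] [Algebra ℂ B] (M : Fin 5 →₀ ℕ)
    (f : MvPowerSeries (Fin 5) B) :
    MvPowerSeries.coeff M (inclL f) = MvPowerSeries.coeff M f ⊗ₜ 1 := rfl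

theorem coeff_inclR {B : Type*} [CommRing B] [Algebra ℂ B] (M : Fin 5 →₀ ℕ)
    (f : MvPowerSeries (Fin 5) B) :
    MvPowerSeries.coeff M (inclR f) = 1 ⊗ₜ MvPowerSeries.coeff M f := rfl

/-- The sum over `n` is the substitution of the running couplings in the second factor, again
truncated at a degree that is sufficient for the coefficient at `N`. -/
theorem comul_greenCoeff (r : Residue) (N : Fin 5 →₀ ℕ) :
    comulCK (greenCoeff r N) = greenCoeff r N ⊗ₜ 1 +
      MvPowerSeries.coeff N (inclL (∏ k, waveSeries k ^ legs r k) *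
        (inclR (graphSeries r)).subst fun j => inclL (couplingSeries j)) := by
  classical
  have h1 : comulCK (greenCoeff r N) = greenCoeff r N ⊗ₜ 1 +
      ∑ g ∈ classes r N, g.sym⁻¹ • ∑ γ : g.rep.graph.Subgraph,
        γ.toHCK ⊗ₜ[ℂ] (if γ.wiring.Good r then gen γ.contract r else 0) := by
    rw [greenCoeff, map_sum, TensorProduct.sum_tmul, ← Finset.sum_add_distrib]
    refine Finset.sum_congr rfl fun g hg => ?_
    obtain ⟨rfl, -⟩ := mem_classes.mp hg
    rw [map_smul, comulCK, MvPolynomial.aeval_X, coproductGen_eq, smul_add,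
      TensorProduct.smul_tmul']
  rw [h1, sum_classes_subgraph_eq]
  congr 1
  have h2 := (EqUpTo.refl (d := N.degree) (inclL (∏ k, waveSeries k ^ legs r k))).mul
    (subst_eqUpTo (c := fun j => inclL (couplingSeries j)) (fun j => by
      rw [inclL, MvPowerSeries.constantCoeff_map, constantCoeff_couplingSeries, map_zero])
      (inclR (graphSeries r)) N.degree)
  rw [h2 N le_rfl, Finset.mul_sum, map_sum]
  refine Finset.sum_congr rfl fun n _ => ?_
  rw [mul_left_comm, MvPowerSeries.coeff_C_mul, coeff_inclR, coeff_graphSeries]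
  simp only [← map_pow, ← map_prod]
  rw [← map_mul, coeff_inclL, Algebra.TensorProduct.tmul_mul_tmul, one_mul, mul_one]

/-- The coproduct of the Green's functions. -/
theorem comul_greenSeries (r : Residue) :
    MvPowerSeries.map comulCK.toRingHom (greenSeries r) =
      inclL (∏ k, waveSeries k ^ legs r k) *
        (inclR (greenSeries r)).subst fun j => inclL (couplingSeries j) := by
  have hc : MvPowerSeries.HasSubst fun j => inclL (couplingSeries j) :=
    MvPowerSeries.hasSubst_of_constantCoeff_zero fun j => by
      rw [inclL, MvPowerSeries.constantCoeff_map, constantCoeff_couplingSeries, map_zero]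
  have h1 : MvPowerSeries.map comulCK.toRingHom (graphSeries r) = inclL (graphSeries r) +
      inclL (∏ k, waveSeries k ^ legs r k) *
        (inclR (graphSeries r)).subst fun j => inclL (couplingSeries j) := by
    ext1 N
    rw [MvPowerSeries.coeff_map, map_add, coeff_inclL]
    exact comul_greenCoeff r N
  rcases r with k | j
  · have h2 : ∏ k', waveSeries k' ^ legs (Sum.inl k) k' = greenSeries (Sum.inl k) := by
      rw [Finset.prod_eq_single k]
      · rw [legs, if_pos rfl, waveSeries_sq]
      · intro b _ hb
        rw [legs, if_neg hb, pow_zero]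
      · exact fun h => absurd (Finset.mem_univ k) h
    rw [h2] at h1 ⊢
    have h3 : greenSeries (Sum.inl k) = 1 - graphSeries (Sum.inl k) := rfl
    rw [h3] at h1 ⊢
    rw [map_sub, map_one, h1]
    rw [map_sub inclR, map_one inclR, ← MvPowerSeries.coe_substAlgHom hc, map_sub, map_one]
    rw [map_sub, map_one]
    ring
  · have h3 : greenSeries (Sum.inr j) = MvPowerSeries.X j + graphSeries (Sum.inr j) := rfl
    -- The wave factors cancel the denominators of the running coupling. So the image of the leading
    -- term `X j` under the substitution supplies both the bare coupling and the terms Γ ⊗ 1.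
    have h4 : (∏ k, waveSeries k ^ legs (Sum.inr j) k) * couplingSeries j =
        MvPowerSeries.X j + graphSeries (Sum.inr j) := by
      rw [couplingSeries, mul_left_comm, ← Finset.prod_mul_distrib, ← h3]
      simp only [legs, ← mul_pow, waveSeries_mul_waveInv, one_pow, Finset.prod_const_one, mul_one]
    rw [h3, map_add, h1, map_add inclR]
    have h5 : (inclR (MvPowerSeries.X j) : MvPowerSeries (Fin 5) (HCK ⊗[ℂ] HCK)) =
        MvPowerSeries.X j := MvPowerSeries.map_X _ _
    have h6 : (inclL (MvPowerSeries.X j) : MvPowerSeries (Fin 5) (HCK ⊗[ℂ] HCK)) =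
        MvPowerSeries.X j := MvPowerSeries.map_X _ _
    rw [h5, MvPowerSeries.subst_add hc, MvPowerSeries.subst_X hc, mul_add, ← map_mul, h4, map_add,
      h6, MvPowerSeries.map_X, add_assoc]

end QCD

namespace QCD

/-! ## The multidegree -/

theorem monomialDeg_zero (j : Fin 5) : monomialDeg 0 j = 0 := Finsupp.sum_zero_index

theorem monomialDeg_add (m m' : GraphClass →₀ ℕ) (j : Fin 5) :
    monomialDeg (m + m') j = monomialDeg m j + monomialDeg m' j :=
  Finsupp.sum_add_index' (by simp) (by intros; push_cast; ring)

theorem monomialDeg_single (g : GraphClass) (j : Fin 5) :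
    monomialDeg (Finsupp.single g 1) j = g.multideg j := by
  rw [monomialDeg, Finsupp.sum_single_index (by simp), Nat.cast_one, one_mul]

/-- The coupling of a vertex, as an exponent; `0` for edges. -/
def shift : Residue → (Fin 5 →₀ ℕ) := Sum.elim (fun _ => 0) fun j => Finsupp.single j 1

theorem GraphClass.shift_add_multideg (g : GraphClass) (j : Fin 5) :
    (shift g.res j : ℤ) + g.multideg j = g.vcount j := by
  rw [g.multideg_eq]
  rcases g.res with k | i
  · simp [shift]
  · by_cases h : i = j <;> simp [shift, h]

/-- Polynomials as formal series. -/
def toHat : HCK →ₐ[ℂ] HCKHat := MvPolynomial.coeToMvPowerSeries.algHom ℂ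

theorem toHat_apply (x : HCK) : toHat x = (x : HCKHat) := by
  simp [toHat]

theorem coeff_toHat (m : GraphClass →₀ ℕ) (x : HCK) :
    MvPowerSeries.coeff m (toHat x) = MvPolynomial.coeff m x := by
  rw [toHat_apply, MvPolynomial.coeff_coe]

/-- `f` is the expansion of `y` by multidegree, shifted by `s`. -/
def Expands (s : Fin 5 →₀ ℕ) (y : HCKHat) (f : MvPowerSeries (Fin 5) HCKHat) : Prop :=
  ∀ m : GraphClass →₀ ℕ,
    (∀ M : Fin 5 →₀ ℕ, (∀ j, (M j : ℤ) = s j + monomialDeg m j) →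
      MvPowerSeries.coeff m (MvPowerSeries.coeff M f) = MvPowerSeries.coeff m y) ∧
    (∀ M : Fin 5 →₀ ℕ, ¬ (∀ j, (M j : ℤ) = s j + monomialDeg m j) →
      MvPowerSeries.coeff m (MvPowerSeries.coeff M f) = 0) ∧
    ((∃ j, (s j : ℤ) + monomialDeg m j < 0) → MvPowerSeries.coeff m y = 0)

namespace Expands

variable {s s' : Fin 5 →₀ ℕ} {y y' : HCKHat} {f f' : MvPowerSeries (Fin 5) HCKHat}

theorem unique (h : Expands s y f) (h' : Expands s y f') : f = f' := by
  ext M m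
  by_cases hM : ∀ j, (M j : ℤ) = s j + monomialDeg m j
  · rw [(h m).1 M hM, (h' m).1 M hM]
  · rw [(h m).2.1 M hM, (h' m).2.1 M hM]

theorem exponent (h : Expands s y f) {m : GraphClass →₀ ℕ} (hm : MvPowerSeries.coeff m y ≠ 0) :
    ∃ M : Fin 5 →₀ ℕ, ∀ j, (M j : ℤ) = s j + monomialDeg m j := by
  have h1 : ∀ j, 0 ≤ (s j : ℤ) + monomialDeg m j := fun j => by
    by_contra hj
    exact hm ((h m).2.2 ⟨j, not_le.mp hj⟩)
  exact ⟨Finsupp.equivFunOnFinite.symm fun j => ((s j : ℤ) + monomialDeg m j).toNat,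
    fun j => Int.toNat_of_nonneg (h1 j)⟩

/-- A monomial occurs in an expansion at one exponent only, the one dictated by its degree. For a
fixed splitting of a monomial the convolution over exponents therefore has at most one nonzero term,
and exponents add because degrees do. -/
theorem mul (h : Expands s y f) (h' : Expands s' y' f') : Expands (s + s') (y * y') (f * f') := by
  classical
  have key : ∀ p q : GraphClass →₀ ℕ, ∀ M : Fin 5 →₀ ℕ,
      ∑ P ∈ Finset.HasAntidiagonal.antidiagonal M, MvPowerSeries.coeff p (MvPowerSeries.coeff P.1 f) *
        MvPowerSeries.coeff q (MvPowerSeries.coeff P.2 f') =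
      if ∀ j, (M j : ℤ) = (s + s') j + monomialDeg (p + q) j then
        MvPowerSeries.coeff p y * MvPowerSeries.coeff q y' else 0 := by
    intro p q M
    have hz : ∀ P : (Fin 5 →₀ ℕ) × (Fin 5 →₀ ℕ), MvPowerSeries.coeff p y = 0 ∨
        MvPowerSeries.coeff q y' = 0 → MvPowerSeries.coeff p (MvPowerSeries.coeff P.1 f) *
          MvPowerSeries.coeff q (MvPowerSeries.coeff P.2 f') = 0 := by
      rintro P (hp | hq)
      · by_cases hM : ∀ j, (P.1 j : ℤ) = s j + monomialDeg p j
        · rw [(h p).1 _ hM, hp, zero_mul]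
        · rw [(h p).2.1 _ hM, zero_mul]
      · by_cases hM : ∀ j, (P.2 j : ℤ) = s' j + monomialDeg q j
        · rw [(h' q).1 _ hM, hq, mul_zero]
        · rw [(h' q).2.1 _ hM, mul_zero]
    by_cases hp : MvPowerSeries.coeff p y = 0
    · rw [Finset.sum_eq_zero fun P _ => hz P (Or.inl hp), hp, zero_mul, ite_self]
    by_cases hq : MvPowerSeries.coeff q y' = 0
    · rw [Finset.sum_eq_zero fun P _ => hz P (Or.inr hq), hq, mul_zero, ite_self]
    obtain ⟨P, hP⟩ := h.exponent hp
    obtain ⟨Q, hQ⟩ := h'.exponent hq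
    have hPQ : (∀ j, (M j : ℤ) = (s + s') j + monomialDeg (p + q) j) ↔ P + Q = M := by
      constructor
      · intro hM
        ext j
        have := hM j
        rw [monomialDeg_add, Finsupp.add_apply] at this
        rw [Finsupp.add_apply]
        push_cast at this
        linarith [hP j, hQ j]
      · rintro rfl j
        rw [monomialDeg_add, Finsupp.add_apply, Finsupp.add_apply]
        push_cast
        linarith [hP j, hQ j]
    have hne : ∀ X : (Fin 5 →₀ ℕ) × (Fin 5 →₀ ℕ), X ≠ (P, Q) →
        MvPowerSeries.coeff p (MvPowerSeries.coeff X.1 f) *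
          MvPowerSeries.coeff q (MvPowerSeries.coeff X.2 f') = 0 := by
      intro X hX
      by_cases h1 : ∀ j, (X.1 j : ℤ) = s j + monomialDeg p j
      · by_cases h2 : ∀ j, (X.2 j : ℤ) = s' j + monomialDeg q j
        · refine absurd (Prod.ext ?_ ?_) hX
          · ext j
            exact_mod_cast (h1 j).trans (hP j).symm
          · ext j
            exact_mod_cast (h2 j).trans (hQ j).symm
        · rw [(h' q).2.1 _ h2, mul_zero]
      · rw [(h p).2.1 _ h1, zero_mul]
    simp only [hPQ]
    split_ifs with hM
    · rw [Finset.sum_eq_single_of_mem (P, Q)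
        (Finset.HasAntidiagonal.mem_antidiagonal.mpr hM) fun X _ => hne X,
        (h p).1 _ hP, (h' q).1 _ hQ]
    · refine Finset.sum_eq_zero fun X hX => hne X ?_
      rintro rfl
      exact hM (Finset.HasAntidiagonal.mem_antidiagonal.mp hX)
  have key2 : ∀ m M, MvPowerSeries.coeff m (MvPowerSeries.coeff M (f * f')) =
      if ∀ j, (M j : ℤ) = (s + s') j + monomialDeg m j then
        MvPowerSeries.coeff m (y * y') else 0 := by
    intro m M
    rw [MvPowerSeries.coeff_mul, map_sum]
    simp only [MvPowerSeries.coeff_mul]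
    rw [Finset.sum_comm]
    have h1 : ∀ p ∈ Finset.HasAntidiagonal.antidiagonal m, _ := fun p hp => by
      have h2 := key p.1 p.2 M
      rw [Finset.HasAntidiagonal.mem_antidiagonal.mp hp] at h2
      exact h2
    rw [Finset.sum_congr rfl h1]
    split_ifs
    · rfl
    · exact Finset.sum_const_zero
  refine fun m => ⟨fun M hM => by rw [key2, if_pos hM], fun M hM => by rw [key2, if_neg hM], ?_⟩
  rintro ⟨j, hj⟩
  rw [MvPowerSeries.coeff_mul]
  refine Finset.sum_eq_zero fun p hp => ?_
  rw [← Finset.HasAntidiagonal.mem_antidiagonal.mp hp, monomialDeg_add, Finsupp.add_apply] at hj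
  push_cast at hj
  by_cases h1 : (s j : ℤ) + monomialDeg p.1 j < 0
  · rw [(h p.1).2.2 ⟨j, h1⟩, zero_mul]
  · rw [(h' p.2).2.2 ⟨j, by linarith⟩, mul_zero]

theorem one : Expands 0 1 1 := by
  classical
  intro m
  simp only [MvPowerSeries.coeff_one]
  refine ⟨fun M hM => ?_, fun M hM => ?_, ?_⟩
  · by_cases hm : m = 0
    · subst hm
      have : M = 0 := by
        ext j
        have := hM j
        rw [monomialDeg_zero] at this
        exact_mod_cast this
      rw [if_pos this, MvPowerSeries.coeff_one]
    · split_ifs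
      · rw [MvPowerSeries.coeff_one, if_neg hm]
      · simp
  · by_cases hm : m = 0
    · subst hm
      have : M ≠ 0 := by
        rintro rfl
        exact hM fun j => by rw [monomialDeg_zero]; rfl
      rw [if_neg this, map_zero]
    · split_ifs
      · rw [MvPowerSeries.coeff_one, if_neg hm]
      · rw [map_zero]
  · rintro ⟨j, hj⟩
    rw [if_neg]
    rintro rfl
    rw [monomialDeg_zero] at hj
    exact lt_irrefl _ hj

theorem pow (h : Expands 0 y f) (n : ℕ) : Expands 0 (y ^ n) (f ^ n) := by
  induction n with
  | zero => rw [pow_zero, pow_zero]; exact one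
  | succ n ih =>
    rw [pow_succ, pow_succ]
    have := ih.mul h
    rwa [add_zero] at this

theorem prod {ι : Type*} {t : Finset ι} {y : ι → HCKHat}
    {f : ι → MvPowerSeries (Fin 5) HCKHat} (h : ∀ i ∈ t, Expands 0 (y i) (f i)) :
    Expands 0 (∏ i ∈ t, y i) (∏ i ∈ t, f i) := by
  classical
  induction t using Finset.induction_on with
  | empty => exact one
  | insert i t hi ih =>
    rw [Finset.prod_insert hi, Finset.prod_insert hi]
    have := (h i (Finset.mem_insert_self _ _)).mul (ih fun j hj => h j (Finset.mem_insert_of_mem hj))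
    rwa [add_zero] at this

theorem coeff_eq_proj (h : Expands s y f) {n : Fin 5 → ℤ} {M : Fin 5 →₀ ℕ}
    (hM : ∀ j, (M j : ℤ) = s j + n j) : MvPowerSeries.coeff M f = proj n y := by
  ext m
  change MvPowerSeries.coeff m _ = if monomialDeg m = n then _ else 0
  have h1 : (∀ j, (M j : ℤ) = s j + monomialDeg m j) ↔ monomialDeg m = n :=
    ⟨fun h2 => funext fun j => by linarith [hM j, h2 j], fun h2 j => by rw [h2]; exact hM j⟩
  split_ifs with h2
  · exact (h m).1 M (h1.mpr h2)
  · exact (h m).2.1 M fun h3 => h2 (h1.mp h3)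

theorem proj_eq_zero (h : Expands s y f) {n : Fin 5 → ℤ} (hn : ∃ j, (s j : ℤ) + n j < 0) :
    proj n y = 0 := by
  ext m
  change (if monomialDeg m = n then MvPowerSeries.coeff m y else 0) = 0
  split_ifs with h2
  · subst h2
    exact (h m).2.2 hn
  · rfl

theorem toIsExpansion (h : Expands s y f) {F : MvPowerSeries (Fin 5) greenAlg}
    (hF : ∀ M, toHat ((MvPowerSeries.coeff M F : greenAlg) : HCK) = MvPowerSeries.coeff M f) :
    IsExpansion s y F where
  coeff_eq n M hM := by rw [← toHat_apply, hF, h.coeff_eq_proj hM]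
  proj_eq_zero n hn := h.proj_eq_zero hn

end Expands

/-- The monomials of non-negative multidegree, among which only `1` has degree zero. -/
def posMonomials : AddSubmonoid (GraphClass →₀ ℕ) where
  carrier := {m | (∀ j, 0 ≤ monomialDeg m j) ∧ ((∀ j, monomialDeg m j = 0) → m = 0)}
  zero_mem' := ⟨fun j => (monomialDeg_zero j).ge, fun _ => rfl⟩
  add_mem' := by
    rintro a b ⟨a1, a2⟩ ⟨b1, b2⟩
    refine ⟨fun j => by rw [monomialDeg_add]; exact add_nonneg (a1 j) (b1 j), fun h => ?_⟩
    have h1 : ∀ j, monomialDeg a j = 0 ∧ monomialDeg b j = 0 := fun j => by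
      have := h j
      rw [monomialDeg_add] at this
      exact ⟨by linarith [a1 j, b1 j], by linarith [a1 j, b1 j]⟩
    rw [a2 fun j => (h1 j).1, b2 fun j => (h1 j).2, add_zero]

/-- The series in monomials of a given set. -/
def supported (S : AddSubmonoid (GraphClass →₀ ℕ)) : Subring HCKHat where
  carrier := {y | ∀ m, m ∉ S → MvPowerSeries.coeff m y = 0}
  zero_mem' := fun m _ => map_zero _
  one_mem' := fun m hm => by
    classical
    rw [MvPowerSeries.coeff_one, if_neg]
    rintro rfl
    exact hm S.zero_mem
  add_mem' := fun {a b} ha hb m hm => by rw [map_add, ha m hm, hb m hm, add_zero]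
  neg_mem' := fun {a} ha m hm => by rw [map_neg, ha m hm, neg_zero]
  mul_mem' := fun {a b} ha hb m hm => by
    classical
    rw [MvPowerSeries.coeff_mul]
    refine Finset.sum_eq_zero fun p hp => ?_
    by_cases h1 : p.1 ∈ S
    · by_cases h2 : p.2 ∈ S
      · rw [← Finset.HasAntidiagonal.mem_antidiagonal.mp hp] at hm
        exact absurd (S.add_mem h1 h2) hm
      · rw [hb _ h2, mul_zero]
    · rw [ha _ h1, zero_mul]

theorem pw_mem_supported {S : AddSubmonoid (GraphClass →₀ ℕ)} {y : HCKHat} (hy : y ∈ supported S)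
    (h1 : MvPowerSeries.constantCoeff y = 1) (α : ℝ) : pw y α ∈ supported S := by
  intro m hm
  rw [pw, PowerSeries.coeff_subst (hasSubst_sub_one h1)]
  refine finsum_eq_zero_of_forall_eq_zero fun d => ?_
  rw [(supported S).pow_mem ((supported S).sub_mem hy (supported S).one_mem) d m hm, smul_zero]

/-- Non-negative degrees serve directly as exponents. As 1 is the only monomial of degree zero in
`posMonomials`, the term at λ^0 is a scalar, which is needed for the uniqueness of square roots. -/
theorem exists_expands {y : HCKHat} (hy : y ∈ supported posMonomials) :
    ∃ f, Expands 0 y f ∧ MvPowerSeries.constantCoeff f =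
      MvPowerSeries.C (MvPowerSeries.constantCoeff y) := by
  classical
  let f : MvPowerSeries (Fin 5) HCKHat := fun M => fun m =>
    if ∀ j, (M j : ℤ) = monomialDeg m j then MvPowerSeries.coeff m y else 0
  have hf : ∀ m M, MvPowerSeries.coeff m (MvPowerSeries.coeff M f) =
    if ∀ j, (M j : ℤ) = monomialDeg m j then MvPowerSeries.coeff m y else 0 := fun _ _ => rfl
  refine ⟨f, fun m => ⟨fun M hM => ?_, fun M hM => ?_, ?_⟩, ?_⟩
  · rw [hf, if_pos]
    simpa using hM
  · rw [hf, if_neg]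
    simpa using hM
  · rintro ⟨j, hj⟩
    refine hy m fun h => ?_
    have := h.1 j
    simp at hj
    linarith
  · rw [← MvPowerSeries.coeff_zero_eq_constantCoeff_apply]
    ext m
    rw [hf, MvPowerSeries.coeff_C]
    by_cases hm : m = 0
    · subst hm
      rw [if_pos fun j => by rw [monomialDeg_zero]; rfl, if_pos rfl]
      rfl
    · rw [if_neg hm]
      split_ifs with h
      · refine hy m fun h2 => hm (h2.2 fun j => by rw [← h j]; rfl)
      · rfl

/-! ## The Green's functions in each multidegree -/

open Classical in
theorem coeff_green (r : Residue) (m : GraphClass →₀ ℕ) : MvPowerSeries.coeff m (green r) =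
    if m = 0 then 1
    else if h : ∃ g : GraphClass, g.res = r ∧ m = Finsupp.single g 1 then
      (if r.isLeft then -1 else 1) / h.choose.sym else 0 := rfl

theorem coeff_green_zero (r : Residue) : MvPowerSeries.coeff 0 (green r) = 1 := by
  classical
  rw [coeff_green, if_pos rfl]

theorem single_graph_ne_zero (g : GraphClass) : Finsupp.single g 1 ≠ (0 : GraphClass →₀ ℕ) :=
  Finsupp.single_ne_zero.mpr one_ne_zero

theorem coeff_green_single (g : GraphClass) :
    MvPowerSeries.coeff (Finsupp.single g 1) (green g.res) =
      (if g.res.isLeft then -1 else 1) / g.sym := by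
  classical
  have h : ∃ g' : GraphClass, g'.res = g.res ∧ Finsupp.single g (1 : ℕ) = Finsupp.single g' 1 :=
    ⟨g, rfl, rfl⟩
  rw [coeff_green, if_neg (single_graph_ne_zero g), dif_pos h,
    ← (Finsupp.single_left_inj one_ne_zero).mp h.choose_spec.2]

theorem coeff_green_of_ne {r : Residue} {m : GraphClass →₀ ℕ} (h0 : m ≠ 0)
    (h : ¬ ∃ g : GraphClass, g.res = r ∧ m = Finsupp.single g 1) :
    MvPowerSeries.coeff m (green r) = 0 := by
  classical
  rw [coeff_green, if_neg h0, dif_neg h]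

theorem coeff_greenCoeff (r : Residue) (M : Fin 5 →₀ ℕ) (m : GraphClass →₀ ℕ)
    [DecidableEq (GraphClass →₀ ℕ)] :
    MvPolynomial.coeff m (greenCoeff r M) =
      ∑ g ∈ classes r M, if Finsupp.single g 1 = m then g.sym⁻¹ else 0 := by
  classical
  rw [greenCoeff, MvPolynomial.coeff_sum]
  refine Finset.sum_congr rfl fun g _ => ?_
  rw [MvPolynomial.coeff_smul, MvPolynomial.coeff_X, smul_eq_mul, mul_ite, mul_one, mul_zero]
  split_ifs <;> rfl

theorem coeff_greenCoeff_single (g : GraphClass) (r : Residue) (M : Fin 5 →₀ ℕ)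
    [Decidable (g ∈ classes r M)] :
    MvPolynomial.coeff (Finsupp.single g 1) (greenCoeff r M) =
      if g ∈ classes r M then g.sym⁻¹ else 0 := by
  classical
  rw [coeff_greenCoeff]
  simp only [Finsupp.single_left_inj (one_ne_zero (α := ℕ))]
  rw [Finset.sum_ite_eq']
  split_ifs <;> rfl

theorem coeff_greenCoeff_of_ne {r : Residue} {M : Fin 5 →₀ ℕ} {m : GraphClass →₀ ℕ}
    (h : ¬ ∃ g : GraphClass, g.res = r ∧ m = Finsupp.single g 1) :
    MvPolynomial.coeff m (greenCoeff r M) = 0 := by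
  classical
  rw [coeff_greenCoeff]
  refine Finset.sum_eq_zero fun g hg => if_neg ?_
  rintro rfl
  exact h ⟨g, (mem_classes.mp hg).1, rfl⟩

theorem coeff_greenSeries (r : Residue) (M : Fin 5 →₀ ℕ) [Decidable (M = shift r)] :
    MvPowerSeries.coeff M (greenSeries r) = (if M = shift r then 1 else 0) +
      (if r.isLeft then -1 else 1 : ℂ) • greenCoeff r M := by
  classical
  rcases r with k | j
  · rw [greenSeries, map_sub, MvPowerSeries.coeff_one, coeff_graphSeries]
    by_cases h : M = 0 <;> simp [shift, sub_eq_add_neg, h]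
  · rw [greenSeries, map_add, MvPowerSeries.coeff_X, coeff_graphSeries]
    by_cases h : M = Finsupp.single j 1 <;> simp [shift, h]

/-- Degree plus shift is the number of vertices, by which the coefficients are indexed. For a vertex
the shift also moves the constant 1 of the Green's function to the bare coupling, and it makes the
negative degrees that could occur harmless. -/
theorem expands_green (r : Residue) :
    Expands (shift r) (green r) (MvPowerSeries.map toHat.toRingHom (greenSeries r)) := by
  classical
  have key : ∀ m M, MvPowerSeries.coeff m (MvPowerSeries.coeff M
      (MvPowerSeries.map toHat.toRingHom (greenSeries r))) =
      if ∀ j, (M j : ℤ) = shift r j + monomialDeg m j then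
        MvPowerSeries.coeff m (green r) else 0 := by
    intro m M
    rw [MvPowerSeries.coeff_map]
    change MvPowerSeries.coeff m (toHat _) = _
    rw [coeff_toHat, coeff_greenSeries, MvPolynomial.coeff_add, MvPolynomial.coeff_smul]
    have h1 : MvPolynomial.coeff m (if M = shift r then (1 : HCK) else 0) =
        if m = 0 ∧ M = shift r then 1 else 0 := by
      split_ifs with h1 h2 h2
      · rw [h2.1, MvPolynomial.coeff_zero_one]
      · rw [MvPolynomial.coeff_one, if_neg fun h => h2 ⟨h.symm, h1⟩]
      · exact absurd h2.2 h1
      · rw [MvPolynomial.coeff_zero]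
    rw [h1]
    by_cases h0 : m = 0
    · subst h0
      have h2 : (∀ j, (M j : ℤ) = shift r j + monomialDeg 0 j) ↔ M = shift r := by
        simp only [monomialDeg_zero, add_zero, Nat.cast_inj]
        exact ⟨fun h => Finsupp.ext h, fun h j => by rw [h]⟩
      rw [coeff_greenCoeff_of_ne, smul_zero, add_zero, coeff_green_zero]
      · simp only [h2, true_and]
      · rintro ⟨g, -, hg⟩
        exact single_graph_ne_zero g hg.symm
    · rw [if_neg fun h => h0 h.1, zero_add]
      by_cases h : ∃ g : GraphClass, g.res = r ∧ m = Finsupp.single g 1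
      · obtain ⟨g, rfl, rfl⟩ := h
        rw [coeff_greenCoeff_single, coeff_green_single]
        have h2 : (∀ j, (M j : ℤ) = shift g.res j + monomialDeg (Finsupp.single g 1) j) ↔
            g ∈ classes g.res M := by
          simp only [monomialDeg_single, g.shift_add_multideg, mem_classes, true_and, Nat.cast_inj]
          exact ⟨fun h => Finsupp.ext fun j => (h j).symm, fun h j => by rw [h]⟩
        simp only [h2]
        split_ifs <;> simp [neg_div]
      · rw [coeff_greenCoeff_of_ne h, coeff_green_of_ne h0 h, smul_zero, ite_self]
  refine fun m => ⟨fun M hM => by rw [key, if_pos hM], fun M hM => by rw [key, if_neg hM], ?_⟩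
  rintro ⟨j, hj⟩
  by_cases h0 : m = 0
  · subst h0
    rw [monomialDeg_zero, add_zero] at hj
    exact absurd hj (not_lt.mpr (Nat.cast_nonneg _))
  · refine coeff_green_of_ne h0 ?_
    rintro ⟨g, rfl, rfl⟩
    rw [monomialDeg_single, g.shift_add_multideg] at hj
    exact absurd hj (not_lt.mpr (Nat.cast_nonneg _))

theorem green_edge_mem (k : EdgeType) : green (Sum.inl k) ∈ supported posMonomials := by
  intro m hm
  by_cases h0 : m = 0
  · subst h0
    exact absurd posMonomials.zero_mem hm
  · refine coeff_green_of_ne h0 ?_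
    rintro ⟨g, hg, rfl⟩
    refine hm ?_
    have h1 : ∀ j, monomialDeg (Finsupp.single g 1) j = g.vcount j := fun j => by
      have := g.shift_add_multideg j
      rw [hg] at this
      rw [monomialDeg_single, ← this]
      simp [shift]
    refine ⟨fun j => by rw [h1]; exact Nat.cast_nonneg _, fun h => absurd ?_ g.vcount_ne_zero⟩
    ext j
    have := (h1 j).symm.trans (h j)
    exact_mod_cast this

theorem constantCoeff_green (r : Residue) : MvPowerSeries.constantCoeff (green r) = 1 :=
  coeff_green_zero r

/-- The root in the formal series of graphs has some expansion, whose square expands the Green's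
function and is thus known. Both candidates for the root have constant term 1, so they agree. -/
theorem expands_sqrt (k : EdgeType) :
    Expands 0 (sqrtG k) (MvPowerSeries.map toHat.toRingHom (waveSeries k)) := by
  have hg := constantCoeff_green (Sum.inl k)
  obtain ⟨f, hf, hf1⟩ := exists_expands (pw_mem_supported (green_edge_mem k) hg (1 / 2))
  rw [constantCoeff_pw hg, map_one] at hf1
  have h2 : MvPowerSeries.map toHat.toRingHom (waveSeries k) = f := by
    refine eq_of_sq_eq_sq ?_ hf1 ?_
    · rw [MvPowerSeries.constantCoeff_map, constantCoeff_waveSeries, map_one]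
    · rw [← map_pow, waveSeries_sq]
      have := hf.pow 2
      rw [pw_half_sq hg] at this
      exact (expands_green (Sum.inl k)).unique this
  rw [h2]
  exact hf

theorem expands_inv_sqrt (k : EdgeType) : Expands 0 (pw (green (Sum.inl k)) (-(1 / 2)))
    (MvPowerSeries.map toHat.toRingHom (waveInv k)) := by
  have hg := constantCoeff_green (Sum.inl k)
  obtain ⟨f, hf, hf1⟩ := exists_expands (pw_mem_supported (green_edge_mem k) hg (-(1 / 2)))
  have h1 := (expands_sqrt k).mul hf
  have h3 : sqrtG k * pw (green (Sum.inl k)) (-(1 / 2)) = 1 := pw_half_mul hg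
  rw [h3] at h1
  have h2 := h1.unique (by rw [add_zero]; exact Expands.one)
  have h4 := congrArg (MvPowerSeries.map toHat.toRingHom) (waveSeries_mul_waveInv k)
  rw [map_mul, map_one] at h4
  have h5 : MvPowerSeries.map toHat.toRingHom (waveInv k) = f := by
    have h6 := congrArg (· * f) h4
    rw [one_mul, mul_right_comm, h2, one_mul] at h6
    exact h6
  rw [h5]
  exact hf

theorem expands_Yv (j : VertexType) :
    Expands (Finsupp.single j 1) (Yv j) (MvPowerSeries.map toHat.toRingHom (couplingSeries j)) := by
  have h1 : Yv j = green (Sum.inr j) *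
      ∏ k, pw (green (Sum.inl k)) (-(1 / 2)) ^ vertexLegs j k := by
    rw [Yv]
    congr 1
    refine Finset.prod_congr rfl fun k _ => ?_
    rw [rpow_eq_pw, ← pw_nat_mul (constantCoeff_green _)]
    congr 1
    simp only [legs]
    ring
  rw [h1, couplingSeries, map_mul, map_prod]
  simp only [map_pow]
  have := (expands_green (Sum.inr j)).mul (Expands.prod (t := Finset.univ) fun k _ =>
    (expands_inv_sqrt k).pow (vertexLegs j k))
  rwa [add_zero] at this

end QCD

namespace QCD

/-! ## Power series over algebras -/

section SeriesMap

variable {R S T : Type*} [CommRing R] [CommRing S] [CommRing T] [Algebra ℂ R] [Algebra ℂ S]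
  [Algebra ℂ T]

/-- An algebra map, applied to the coefficients. -/
abbrev smap (φ : R →ₐ[ℂ] S) : MvPowerSeries (Fin 5) R →ₐ[ℂ] MvPowerSeries (Fin 5) S :=
  MvPowerSeries.mapAlgHom φ

theorem coeff_smap (φ : R →ₐ[ℂ] S) (M : Fin 5 →₀ ℕ) (f : MvPowerSeries (Fin 5) R) :
    MvPowerSeries.coeff M (smap φ f) = φ (MvPowerSeries.coeff M f) := rfl

theorem constantCoeff_smap (φ : R →ₐ[ℂ] S) (f : MvPowerSeries (Fin 5) R) :
    MvPowerSeries.constantCoeff (smap φ f) = φ (MvPowerSeries.constantCoeff f) := rfl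

theorem smap_smap (φ : R →ₐ[ℂ] S) (ψ : S →ₐ[ℂ] T) (f : MvPowerSeries (Fin 5) R) :
    smap ψ (smap φ f) = smap (ψ.comp φ) f := rfl

theorem smap_X (φ : R →ₐ[ℂ] S) (j : Fin 5) :
    smap φ (MvPowerSeries.X j) = MvPowerSeries.X j := MvPowerSeries.map_X _ _

theorem smap_id (f : MvPowerSeries (Fin 5) R) : smap (AlgHom.id ℂ R) f = f := rfl

theorem smap_injective {φ : R →ₐ[ℂ] S} (h : Function.Injective φ) :
    Function.Injective (smap φ) := fun f g e => by
  ext M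
  exact h (congrArg (MvPowerSeries.coeff M) e)

theorem smap_subst (φ : R →ₐ[ℂ] S) {c : Fin 5 → MvPowerSeries (Fin 5) R}
    (hc : ∀ j, MvPowerSeries.constantCoeff (c j) = 0) (f : MvPowerSeries (Fin 5) R) :
    smap φ (f.subst c) = (smap φ f).subst fun j => smap φ (c j) :=
  MvPowerSeries.map_subst (h := φ.toRingHom) (MvPowerSeries.hasSubst_of_constantCoeff_zero hc) f

theorem smap_pw_half (φ : R →ₐ[ℂ] S) {F : MvPowerSeries (Fin 5) R}
    (hF : MvPowerSeries.constantCoeff F = 1) : smap φ (pw F (1 / 2)) = pw (smap φ F) (1 / 2) := by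
  refine eq_pw_half (by rw [constantCoeff_smap, hF, map_one]) ?_ ?_
  · rw [constantCoeff_smap, constantCoeff_pw hF, map_one]
  · rw [← map_pow, pw_half_sq hF]

theorem eq_pw_neg_half {F a : MvPowerSeries (Fin 5) R} (hF : MvPowerSeries.constantCoeff F = 1)
    (h : pw F (1 / 2) * a = 1) : a = pw F (-(1 / 2)) := by
  have h1 := pw_half_mul hF
  linear_combination (pw F (-(1 / 2))) * h - a * h1

theorem smap_pw_neg_half (φ : R →ₐ[ℂ] S) {F : MvPowerSeries (Fin 5) R}
    (hF : MvPowerSeries.constantCoeff F = 1) :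
    smap φ (pw F (-(1 / 2))) = pw (smap φ F) (-(1 / 2)) := by
  refine eq_pw_neg_half (by rw [constantCoeff_smap, hF, map_one]) ?_
  rw [← smap_pw_half φ hF, ← map_mul, pw_half_mul hF, map_one]

theorem inclL_eq (f : MvPowerSeries (Fin 5) R) :
    inclL f = smap (Algebra.TensorProduct.includeLeft (S := ℂ) (B := R)) f := rfl

theorem inclR_eq (f : MvPowerSeries (Fin 5) R) :
    inclR f = smap (Algebra.TensorProduct.includeRight (A := R)) f := rfl

end SeriesMap

/-- Substitution of series without constant term, as a map of algebras. -/
def substHom {R : Type*} [CommRing R] (c : Fin 5 → MvPowerSeries (Fin 5) R)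
    (hc : ∀ j, MvPowerSeries.constantCoeff (c j) = 0) :
    MvPowerSeries (Fin 5) R →ₐ[R] MvPowerSeries (Fin 5) R :=
  MvPowerSeries.substAlgHom (MvPowerSeries.hasSubst_of_constantCoeff_zero hc)

theorem substHom_apply {R : Type*} [CommRing R] (c : Fin 5 → MvPowerSeries (Fin 5) R)
    (hc : ∀ j, MvPowerSeries.constantCoeff (c j) = 0) (f : MvPowerSeries (Fin 5) R) :
    substHom c hc f = f.subst c := by
  rw [substHom, MvPowerSeries.coe_substAlgHom]

/-! ## The algebra generated by the Green's functions -/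

theorem coeff_greenSeries_mem (r : Residue) (M : Fin 5 →₀ ℕ) :
    MvPowerSeries.coeff M (greenSeries r) ∈ greenAlg := by
  refine Algebra.subset_adjoin ⟨r, fun j => (M j : ℤ) - shift r j, ?_⟩
  rw [← (expands_green r).coeff_eq_proj (M := M) fun j => by ring, ← toHat_apply]
  rfl

/-- A projection `p_n` of a Green's function is either a coefficient of `greenSeries` or zero, the
latter when its shifted exponent has a negative entry. So the coefficients of these series generate
the algebra. -/
theorem greenAlg_le {B : Subalgebra ℂ HCK}
    (h : ∀ r M, MvPowerSeries.coeff M (greenSeries r) ∈ B) : greenAlg ≤ B := by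
  refine Algebra.adjoin_le ?_
  rintro x ⟨r, n, hx⟩
  by_cases hn : ∃ j, (shift r j : ℤ) + n j < 0
  · rw [(expands_green r).proj_eq_zero hn] at hx
    have : x = 0 := by
      refine MvPolynomial.coe_injective _ _ ?_
      rw [hx, MvPolynomial.coe_zero]
    rw [this]
    exact B.zero_mem
  · push Not at hn
    let M : Fin 5 →₀ ℕ := Finsupp.equivFunOnFinite.symm fun j => ((shift r j : ℤ) + n j).toNat
    have hM : ∀ j, (M j : ℤ) = shift r j + n j := fun j => Int.toNat_of_nonneg (hn j)
    have : x = MvPowerSeries.coeff M (greenSeries r) := by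
      refine MvPolynomial.coe_injective _ _ ?_
      rw [hx, ← (expands_green r).coeff_eq_proj hM, ← toHat_apply]
      rfl
    rw [this]
    exact h r M

/-- The Green's functions, as series over `H`. -/
def greenH (r : Residue) : MvPowerSeries (Fin 5) greenAlg :=
  fun M => ⟨MvPowerSeries.coeff M (greenSeries r), coeff_greenSeries_mem r M⟩

theorem val_greenH (r : Residue) : smap greenAlg.val (greenH r) = greenSeries r := rfl

theorem greenAlg_hom_ext {C : Type*} [CommRing C] [Algebra ℂ C] {φ ψ : greenAlg →ₐ[ℂ] C}
    (h : ∀ r, smap φ (greenH r) = smap ψ (greenH r)) : φ = ψ := by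
  have h1 : greenAlg ≤ (AlgHom.equalizer φ ψ).map greenAlg.val := greenAlg_le fun r M =>
    ⟨MvPowerSeries.coeff M (greenH r), congrArg (MvPowerSeries.coeff M) (h r), rfl⟩
  ext x
  obtain ⟨y, hy, hxy⟩ := h1 x.2
  rw [← Subtype.ext hxy]
  exact hy

theorem val_injective : Function.Injective greenAlg.val := Subtype.val_injective

theorem constantCoeff_greenH_edge (k : EdgeType) :
    MvPowerSeries.constantCoeff (greenH (Sum.inl k)) = 1 :=
  Subtype.ext (constantCoeff_greenSeries_edge k)

theorem constantCoeff_greenH_vertex (j : VertexType) :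
    MvPowerSeries.constantCoeff (greenH (Sum.inr j)) = 0 :=
  Subtype.ext (constantCoeff_greenSeries_vertex j)

/-- `waveSeries` over `H`. -/
def waveH (k : EdgeType) : MvPowerSeries (Fin 5) greenAlg := pw (greenH (Sum.inl k)) (1 / 2)

/-- `waveInv` over `H`. -/
def waveInvH (k : EdgeType) : MvPowerSeries (Fin 5) greenAlg := pw (greenH (Sum.inl k)) (-(1 / 2))

/-- `couplingSeries` over `H`. -/
def couplingH (j : VertexType) : MvPowerSeries (Fin 5) greenAlg :=
  greenH (Sum.inr j) * ∏ k, waveInvH k ^ vertexLegs j k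

theorem val_waveH (k : EdgeType) : smap greenAlg.val (waveH k) = waveSeries k :=
  smap_pw_half _ (constantCoeff_greenH_edge k)

theorem val_waveInvH (k : EdgeType) : smap greenAlg.val (waveInvH k) = waveInv k :=
  smap_pw_neg_half _ (constantCoeff_greenH_edge k)

theorem val_couplingH (j : VertexType) : smap greenAlg.val (couplingH j) = couplingSeries j := by
  rw [couplingH, map_mul, map_prod, val_greenH]
  simp only [map_pow, val_waveInvH]
  rfl

theorem waveH_sq (k : EdgeType) : waveH k ^ 2 = greenH (Sum.inl k) :=
  pw_half_sq (constantCoeff_greenH_edge k)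

theorem waveH_mul_inv (k : EdgeType) : waveH k * waveInvH k = 1 :=
  pw_half_mul (constantCoeff_greenH_edge k)

theorem constantCoeff_waveH (k : EdgeType) : MvPowerSeries.constantCoeff (waveH k) = 1 :=
  constantCoeff_pw (constantCoeff_greenH_edge k) _

theorem constantCoeff_couplingH (j : VertexType) :
    MvPowerSeries.constantCoeff (couplingH j) = 0 := by
  rw [couplingH, map_mul, constantCoeff_greenH_vertex, zero_mul]

theorem coupling_mul_wave (j : VertexType) :
    couplingH j * ∏ k, waveH k ^ vertexLegs j k = greenH (Sum.inr j) := by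
  rw [couplingH, mul_assoc, ← Finset.prod_mul_distrib]
  simp only [← mul_pow, mul_comm (waveInvH _), waveH_mul_inv, one_pow, Finset.prod_const_one,
    mul_one]

/-- Two algebra maps on `H` are equal if they have the same values on the coefficients of the
couplings and of the wave function factors. -/
theorem greenAlg_hom_ext' {C : Type*} [CommRing C] [Algebra ℂ C] {φ ψ : greenAlg →ₐ[ℂ] C}
    (h1 : ∀ k, smap φ (waveH k) = smap ψ (waveH k))
    (h2 : ∀ j, smap φ (couplingH j) = smap ψ (couplingH j)) : φ = ψ := by
  refine greenAlg_hom_ext fun r => ?_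
  rcases r with k | j
  · rw [← waveH_sq, map_pow, map_pow, h1]
  · rw [← coupling_mul_wave, map_mul, map_mul, map_prod, map_prod]
    simp only [map_pow, h1, h2]

/-! ## The coproduct on the algebra generated by the Green's functions -/

/-- The inclusion of `H ⊗ H`. -/
abbrev valTensor : greenAlg ⊗[ℂ] greenAlg →ₐ[ℂ] HCK ⊗[ℂ] HCK :=
  Algebra.TensorProduct.map greenAlg.val greenAlg.val

theorem valTensor_injective : Function.Injective valTensor :=
  TensorProduct.map_injective_of_flat_flat _ _ val_injective val_injective

theorem constantCoeff_inclL_couplingH (j : VertexType) :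
    MvPowerSeries.constantCoeff (inclL (couplingH j)) = 0 := by
  rw [inclL_eq, constantCoeff_smap, constantCoeff_couplingH, map_zero]

theorem valTensor_formula (F f : MvPowerSeries (Fin 5) greenAlg) :
    smap valTensor (inclL F * (inclR f).subst fun j => inclL (couplingH j)) =
      inclL (smap greenAlg.val F) *
        (inclR (smap greenAlg.val f)).subst fun j => inclL (couplingSeries j) := by
  have h1 : ∀ F : MvPowerSeries (Fin 5) greenAlg,
      smap valTensor (inclL F) = inclL (smap greenAlg.val F) := fun F => by
    rw [inclL_eq, inclL_eq, smap_smap, smap_smap]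
    congr 1
  have h2 : ∀ F : MvPowerSeries (Fin 5) greenAlg,
      smap valTensor (inclR F) = inclR (smap greenAlg.val F) := fun F => by
    rw [inclR_eq, inclR_eq, smap_smap, smap_smap]
    congr 1
  rw [map_mul, h1, smap_subst _ constantCoeff_inclL_couplingH, h2]
  simp only [h1, val_couplingH]

/-- The right-hand side of the coproduct formula is formed by multiplication and substitution from
series over `greenAlg`, so its coefficients lie in the tensor square of this subalgebra. -/
theorem comulCK_mem (x : HCK) (hx : x ∈ greenAlg) : comulCK x ∈ valTensor.range := by
  have h : greenAlg ≤ valTensor.range.comap comulCK := greenAlg_le fun r M => by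
    refine ⟨MvPowerSeries.coeff M (inclL (∏ k, waveH k ^ legs r k) *
      (inclR (greenH r)).subst fun j => inclL (couplingH j)), ?_⟩
    have h1 := congrArg (MvPowerSeries.coeff M) (valTensor_formula (∏ k, waveH k ^ legs r k)
      (greenH r))
    rw [map_prod (smap greenAlg.val)] at h1
    simp only [map_pow (smap greenAlg.val), val_waveH, val_greenH] at h1
    rw [← comul_greenSeries] at h1
    exact h1
  exact h hx

/-- The coproduct of `H`. -/
def comulH : greenAlg →ₐ[ℂ] greenAlg ⊗[ℂ] greenAlg :=
  (AlgEquiv.ofInjective valTensor valTensor_injective).symm.toAlgHom.comp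
    ((comulCK.comp greenAlg.val).codRestrict valTensor.range fun x => comulCK_mem x x.2)

theorem valTensor_comulH (x : greenAlg) : valTensor (comulH x) = comulCK x :=
  congrArg Subtype.val ((AlgEquiv.ofInjective valTensor valTensor_injective).apply_symm_apply
    ⟨comulCK x, comulCK_mem x x.2⟩)

theorem comulH_greenH (r : Residue) : smap comulH (greenH r) =
    inclL (∏ k, waveH k ^ legs r k) * (inclR (greenH r)).subst fun j => inclL (couplingH j) := by
  refine smap_injective valTensor_injective ?_
  rw [valTensor_formula, map_prod (smap greenAlg.val)]
  simp only [map_pow (smap greenAlg.val), val_waveH]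
  rw [val_greenH, ← comul_greenSeries]
  ext1 M
  exact valTensor_comulH _

/-- Substitution of the couplings in the first factor. -/
def substL : MvPowerSeries (Fin 5) (greenAlg ⊗[ℂ] greenAlg) →ₐ[greenAlg ⊗[ℂ] greenAlg]
    MvPowerSeries (Fin 5) (greenAlg ⊗[ℂ] greenAlg) :=
  substHom (fun j => inclL (couplingH j)) constantCoeff_inclL_couplingH

theorem substL_apply (f : MvPowerSeries (Fin 5) (greenAlg ⊗[ℂ] greenAlg)) :
    substL f = f.subst fun j => inclL (couplingH j) := substHom_apply _ _ _

theorem constantCoeff_substHom {R : Type*} [CommRing R]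
    {c : Fin 5 → MvPowerSeries (Fin 5) R}
    (hc : ∀ j, MvPowerSeries.constantCoeff (c j) = 0) (f : MvPowerSeries (Fin 5) R) :
    MvPowerSeries.constantCoeff (substHom c hc f) = MvPowerSeries.constantCoeff f := by
  have h : f = MvPowerSeries.C (MvPowerSeries.constantCoeff f) +
      (f - MvPowerSeries.C (MvPowerSeries.constantCoeff f)) := by ring
  conv_lhs => rw [h]
  rw [map_add, map_add, substHom_apply, substHom_apply, MvPowerSeries.subst_C,
    MvPowerSeries.constantCoeff_subst_eq_zero (MvPowerSeries.hasSubst_of_constantCoeff_zero hc) hc,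
    add_zero, MvPowerSeries.constantCoeff_C]
  rw [map_sub, MvPowerSeries.constantCoeff_C, sub_self]

/-- Both sides have constant term 1, and the coproduct formula for an edge says that their squares
agree. -/
theorem comulH_waveH (k : EdgeType) :
    smap comulH (waveH k) = inclL (waveH k) * substL (inclR (waveH k)) := by
  refine eq_of_sq_eq_sq ?_ ?_ ?_
  · rw [constantCoeff_smap, constantCoeff_waveH, map_one]
  · rw [map_mul, substL, constantCoeff_substHom, inclL_eq, inclR_eq, constantCoeff_smap,
      constantCoeff_smap, constantCoeff_waveH, map_one, map_one, mul_one]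
  · have h2 : ∏ k', waveH k' ^ legs (Sum.inl k) k' = greenH (Sum.inl k) := by
      rw [Finset.prod_eq_single k]
      · rw [legs, if_pos rfl, waveH_sq]
      · intro b _ hb
        rw [legs, if_neg hb, pow_zero]
      · exact fun h => absurd (Finset.mem_univ k) h
    have h := comulH_greenH (Sum.inl k)
    rw [h2, ← substL_apply, ← waveH_sq, map_pow] at h
    rw [h, map_pow, map_pow, map_pow, mul_pow]

/-- The coproduct formula for a vertex is divided by that for the wave factors of its lines. The
prefactor of the vertex formula cancels, and only the substitution remains. -/
theorem comulH_couplingH (j : VertexType) :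
    smap comulH (couplingH j) = substL (inclR (couplingH j)) := by
  have h := comulH_greenH (Sum.inr j)
  rw [← substL_apply, ← coupling_mul_wave, map_mul, map_mul inclR, map_mul substL, map_prod,
    map_prod inclR, map_prod substL, map_prod inclL] at h
  simp only [map_pow, comulH_waveH, mul_pow, Finset.prod_mul_distrib, legs] at h
  have hu : IsUnit ((∏ k, inclL (waveH k) ^ vertexLegs j k) *
      ∏ k, substL (inclR (waveH k)) ^ vertexLegs j k) := by
    have h1 : ∀ k, IsUnit (waveH k) := fun k =>
      ⟨⟨waveH k, waveInvH k, waveH_mul_inv k, (mul_comm _ _).trans (waveH_mul_inv k)⟩, rfl⟩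
    refine IsUnit.mul ?_ ?_
    · exact Finset.prod_induction _ IsUnit (fun _ _ => IsUnit.mul) isUnit_one fun k _ => ((h1 k).map inclL).pow _
    · exact Finset.prod_induction _ IsUnit (fun _ _ => IsUnit.mul) isUnit_one fun k _ => (((h1 k).map inclR).map substL).pow _
  refine hu.mul_right_cancel ?_
  rw [h]
  ring

end QCD

namespace QCD

/-! ## Coassociativity and counit -/

section Substitution

variable {R : Type*} [CommRing R] {c d : Fin 5 → MvPowerSeries (Fin 5) R}

theorem substHom_comp (hc : ∀ j, MvPowerSeries.constantCoeff (c j) = 0)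
    (hd : ∀ j, MvPowerSeries.constantCoeff (d j) = 0)
    (hcd : ∀ j, MvPowerSeries.constantCoeff (substHom c hc (d j)) = 0)
    (f : MvPowerSeries (Fin 5) R) :
    substHom c hc (substHom d hd f) = substHom (fun j => substHom c hc (d j)) hcd f := by
  simp only [substHom_apply]
  exact MvPowerSeries.subst_comp_subst_apply (MvPowerSeries.hasSubst_of_constantCoeff_zero hd)
    (MvPowerSeries.hasSubst_of_constantCoeff_zero hc) f

theorem substHom_congr {hc : ∀ j, MvPowerSeries.constantCoeff (c j) = 0}
    {hd : ∀ j, MvPowerSeries.constantCoeff (d j) = 0} (h : ∀ j, c j = d j)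
    (f : MvPowerSeries (Fin 5) R) : substHom c hc f = substHom d hd f := by
  obtain rfl := funext h
  rfl

theorem substHom_X (hc : ∀ j, MvPowerSeries.constantCoeff (c j) = 0) (j : Fin 5) :
    substHom c hc (MvPowerSeries.X j) = c j := by
  rw [substHom_apply]
  exact MvPowerSeries.subst_X (MvPowerSeries.hasSubst_of_constantCoeff_zero hc) j

theorem substHom_self (hc : ∀ j, MvPowerSeries.constantCoeff
    (MvPowerSeries.X j : MvPowerSeries (Fin 5) R) = 0) (f : MvPowerSeries (Fin 5) R) :
    substHom (fun j => MvPowerSeries.X j) hc f = f := by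
  rw [substHom_apply]
  exact congrFun MvPowerSeries.subst_self f

theorem smap_substHom {S : Type*} [CommRing S] [Algebra ℂ R] [Algebra ℂ S] (φ : R →ₐ[ℂ] S)
    (hc : ∀ j, MvPowerSeries.constantCoeff (c j) = 0)
    (hc' : ∀ j, MvPowerSeries.constantCoeff (smap φ (c j)) = 0) (f : MvPowerSeries (Fin 5) R) :
    smap φ (substHom c hc f) = substHom (fun j => smap φ (c j)) hc' (smap φ f) := by
  rw [substHom_apply, substHom_apply, smap_subst φ hc]

end Substitution

section ImageOfCoproduct

variable {C : Type*} [CommRing C] [Algebra ℂ C]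

theorem constantCoeff_smap_couplingH (φ : greenAlg →ₐ[ℂ] C) (j : VertexType) :
    MvPowerSeries.constantCoeff (smap φ (couplingH j)) = 0 := by
  rw [constantCoeff_smap, constantCoeff_couplingH, map_zero]

/-- Substitution of the image of the couplings. -/
def substC (φ : greenAlg →ₐ[ℂ] C) : MvPowerSeries (Fin 5) C →ₐ[C] MvPowerSeries (Fin 5) C :=
  substHom (fun j => smap φ (couplingH j)) (constantCoeff_smap_couplingH φ)

/-- `δ` is related to the maps `l` and `r` as the coproduct is to the inclusions of the two
factors. -/
structure IsCoproduct (δ l r : greenAlg →ₐ[ℂ] C) : Prop where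
  wave (k : EdgeType) : smap δ (waveH k) = smap l (waveH k) * substC l (smap r (waveH k))
  coupling (j : VertexType) : smap δ (couplingH j) = substC l (smap r (couplingH j))

variable {D : Type*} [CommRing D] [Algebra ℂ D] {δ l r : greenAlg →ₐ[ℂ] C}

theorem smap_substC (φ : C →ₐ[ℂ] D) (l : greenAlg →ₐ[ℂ] C) (f : MvPowerSeries (Fin 5) C) :
    smap φ (substC l f) = substC (φ.comp l) (smap φ f) :=
  smap_substHom φ _ (constantCoeff_smap_couplingH (φ.comp l)) f

theorem IsCoproduct.map (h : IsCoproduct δ l r) (φ : C →ₐ[ℂ] D) {δ' l' r' : greenAlg →ₐ[ℂ] D}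
    (hδ : ∀ x, δ' x = φ (δ x)) (hl : ∀ x, l' x = φ (l x)) (hr : ∀ x, r' x = φ (r x)) :
    IsCoproduct δ' l' r' := by
  obtain rfl : δ' = φ.comp δ := AlgHom.ext hδ
  obtain rfl : l' = φ.comp l := AlgHom.ext hl
  obtain rfl : r' = φ.comp r := AlgHom.ext hr
  constructor
  · intro k
    rw [← smap_smap, h.wave, map_mul, smap_substC, smap_smap, smap_smap]
  · intro j
    rw [← smap_smap, h.coupling, smap_substC, smap_smap]

/-- Substitution is compatible with the coproduct. -/
theorem IsCoproduct.substC_eq (h : IsCoproduct δ l r) (f : MvPowerSeries (Fin 5) C) :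
    substC δ f = substC l (substC r f) := by
  have h1 := h.coupling
  unfold substC at h1 ⊢
  rw [substHom_comp _ _ fun j => by rw [← h1, constantCoeff_smap_couplingH]]
  exact substHom_congr h1 f

/-- Both maps send the couplings to those of the third factor, with the couplings of the second
substituted, and then those of the first. The two orders of nesting agree by associativity of
substitution, and the wave factors multiply along the same chain. -/
theorem IsCoproduct.coassoc {δ δ' l₁ r₂ e₁ e₂ e₃ : greenAlg →ₐ[ℂ] C} (h₁ : IsCoproduct δ l₁ e₃)
    (h₂ : IsCoproduct δ' e₁ r₂) (h₃ : IsCoproduct l₁ e₁ e₂) (h₄ : IsCoproduct r₂ e₂ e₃) :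
    δ = δ' := by
  refine greenAlg_hom_ext' (fun k => ?_) fun j => ?_
  · rw [h₁.wave, h₂.wave, h₃.wave, h₄.wave, h₃.substC_eq, map_mul, mul_assoc]
  · rw [h₁.coupling, h₂.coupling, h₄.coupling, h₃.substC_eq]

end ImageOfCoproduct

/-- The inclusion of the first factor of `H ⊗ H`. -/
def inL : greenAlg →ₐ[ℂ] greenAlg ⊗[ℂ] greenAlg := Algebra.TensorProduct.includeLeft

/-- The inclusion of the second factor of `H ⊗ H`. -/
def inR : greenAlg →ₐ[ℂ] greenAlg ⊗[ℂ] greenAlg := Algebra.TensorProduct.includeRight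

theorem inL_apply (x : greenAlg) : inL x = x ⊗ₜ 1 := rfl

theorem inR_apply (x : greenAlg) : inR x = 1 ⊗ₜ x := rfl

theorem isCoproduct_comulH : IsCoproduct (C := greenAlg ⊗[ℂ] greenAlg) comulH inL inR :=
  ⟨comulH_waveH, comulH_couplingH⟩

/-- The triple tensor product receives three inclusions `e1`, `e2`, `e3` of single factors and two
coproducts placed on adjacent pairs. The images of the coproduct relation under `m`, `m'`, `a` and
`b` are exactly the four hypotheses of `IsCoproduct.coassoc`. -/
theorem comulH_coassoc : ((Algebra.TensorProduct.assoc ℂ ℂ ℂ greenAlg greenAlg greenAlg).toAlgHom.comp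
    (Algebra.TensorProduct.map comulH (AlgHom.id ℂ greenAlg))).comp comulH =
    (Algebra.TensorProduct.map (AlgHom.id ℂ greenAlg) comulH).comp comulH := by
  let a : greenAlg ⊗[ℂ] greenAlg →ₐ[ℂ] greenAlg ⊗[ℂ] (greenAlg ⊗[ℂ] greenAlg) :=
    (Algebra.TensorProduct.assoc ℂ ℂ ℂ greenAlg greenAlg greenAlg).toAlgHom.comp
      Algebra.TensorProduct.includeLeft
  let b : greenAlg ⊗[ℂ] greenAlg →ₐ[ℂ] greenAlg ⊗[ℂ] (greenAlg ⊗[ℂ] greenAlg) :=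
    Algebra.TensorProduct.includeRight
  let m : greenAlg ⊗[ℂ] greenAlg →ₐ[ℂ] greenAlg ⊗[ℂ] (greenAlg ⊗[ℂ] greenAlg) :=
    (Algebra.TensorProduct.assoc ℂ ℂ ℂ greenAlg greenAlg greenAlg).toAlgHom.comp
      (Algebra.TensorProduct.map comulH (AlgHom.id ℂ greenAlg))
  let m' : greenAlg ⊗[ℂ] greenAlg →ₐ[ℂ] greenAlg ⊗[ℂ] (greenAlg ⊗[ℂ] greenAlg) :=
    Algebra.TensorProduct.map (AlgHom.id ℂ greenAlg) comulH
  let e1 : greenAlg →ₐ[ℂ] greenAlg ⊗[ℂ] (greenAlg ⊗[ℂ] greenAlg) :=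
    Algebra.TensorProduct.includeLeft
  let e2 : greenAlg →ₐ[ℂ] greenAlg ⊗[ℂ] (greenAlg ⊗[ℂ] greenAlg) := b.comp inL
  let e3 : greenAlg →ₐ[ℂ] greenAlg ⊗[ℂ] (greenAlg ⊗[ℂ] greenAlg) := b.comp inR
  have hL : ∀ x, a.comp comulH x = m (inL x) := fun x => by
    rw [inL_apply]
    simp [a, m]
  have hR : ∀ x, e3 x = m (inR x) := fun x => by
    rw [inR_apply]
    simp [e3, b, m, inR_apply, Algebra.TensorProduct.one_def]
  have hL' : ∀ x, e1 x = m' (inL x) := fun x => by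
    rw [inL_apply]
    simp [e1, m']
  have hR' : ∀ x, b.comp comulH x = m' (inR x) := fun x => by
    rw [inR_apply]
    simp [b, m']
  have h1 : IsCoproduct (C := greenAlg ⊗[ℂ] (greenAlg ⊗[ℂ] greenAlg))
      (m.comp comulH) (a.comp comulH) e3 :=
    isCoproduct_comulH.map m (fun _ => rfl) hL hR
  have h2 : IsCoproduct (C := greenAlg ⊗[ℂ] (greenAlg ⊗[ℂ] greenAlg))
      (m'.comp comulH) e1 (b.comp comulH) :=
    isCoproduct_comulH.map m' (fun _ => rfl) hL' hR'
  have h3 : IsCoproduct (C := greenAlg ⊗[ℂ] (greenAlg ⊗[ℂ] greenAlg))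
      (a.comp comulH) e1 e2 :=
    isCoproduct_comulH.map a (fun _ => rfl) (fun _ => rfl) fun _ => rfl
  have h4 : IsCoproduct (C := greenAlg ⊗[ℂ] (greenAlg ⊗[ℂ] greenAlg))
      (b.comp comulH) e2 e3 :=
    isCoproduct_comulH.map b (fun _ => rfl) (fun _ => rfl) fun _ => rfl
  exact h1.coassoc h2 h3 h4

theorem counitCK_greenCoeff (r : Residue) (N : Fin 5 →₀ ℕ) : counitCK (greenCoeff r N) = 0 := by
  unfold greenCoeff
  rw [map_sum]
  refine Finset.sum_eq_zero fun g _ => ?_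
  rw [map_smul, counitCK, MvPolynomial.aeval_X, smul_zero]

theorem counitH_greenH_edge (k : EdgeType) : smap counitH (greenH (Sum.inl k)) = 1 := by
  have h : smap counitCK (graphSeries (Sum.inl k)) = 0 := by
    ext M
    exact counitCK_greenCoeff _ _
  change smap counitCK (1 - graphSeries (Sum.inl k)) = 1
  rw [map_sub, h, map_one, sub_zero]

theorem counitH_greenH_vertex (j : VertexType) :
    smap counitH (greenH (Sum.inr j)) = MvPowerSeries.X j := by
  have h : smap counitCK (graphSeries (Sum.inr j)) = 0 := by
    ext M
    exact counitCK_greenCoeff _ _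
  change smap counitCK (MvPowerSeries.X j + graphSeries (Sum.inr j)) = _
  rw [map_add, h, smap_X, add_zero]

theorem counitH_waveH (k : EdgeType) : smap counitH (waveH k) = 1 := by
  refine eq_of_sq_eq_sq ?_ ?_ ?_
  · rw [constantCoeff_smap, constantCoeff_waveH, map_one]
  · rw [map_one]
  · rw [← map_pow, waveH_sq, counitH_greenH_edge, one_pow]

theorem counitH_couplingH (j : VertexType) :
    smap counitH (couplingH j) = MvPowerSeries.X j := by
  have h := counitH_greenH_vertex j
  rw [← coupling_mul_wave, map_mul, map_prod (smap counitH)] at h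
  simpa only [map_pow (smap counitH), counitH_waveH, one_pow, Finset.prod_const_one, mul_one]
    using h

section Unit

variable {C : Type*} [CommRing C] [Algebra ℂ C]

theorem unit_waveH {φ : greenAlg →ₐ[ℂ] C} (h : φ = (Algebra.ofId ℂ C).comp counitH)
    (k : EdgeType) : smap φ (waveH k) = 1 := by
  rw [h, ← smap_smap, counitH_waveH, map_one]

theorem unit_couplingH {φ : greenAlg →ₐ[ℂ] C} (h : φ = (Algebra.ofId ℂ C).comp counitH)
    (j : VertexType) : smap φ (couplingH j) = MvPowerSeries.X j := by
  rw [h, ← smap_smap, counitH_couplingH, smap_X]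

theorem unit_substC {φ : greenAlg →ₐ[ℂ] C} (h : φ = (Algebra.ofId ℂ C).comp counitH)
    (f : MvPowerSeries (Fin 5) C) : substC φ f = f :=
  (substHom_congr (hd := fun j => MvPowerSeries.constantCoeff_X j) (unit_couplingH h) f).trans
    (substHom_self _ f)

theorem substC_couplingH {φ : greenAlg →ₐ[ℂ] C} (j : VertexType) :
    substC φ (MvPowerSeries.X j) = smap φ (couplingH j) := substHom_X _ j

end Unit

/-- The counit kills all graphs, so it turns the couplings into the variables and the wave factors
into 1. The substitution in the coproduct formula becomes the identity. -/
theorem comulH_counit_left : ((Algebra.TensorProduct.lid ℂ greenAlg).toAlgHom.comp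
    (Algebra.TensorProduct.map counitH (AlgHom.id ℂ greenAlg))).comp comulH =
      AlgHom.id ℂ greenAlg := by
  let m : greenAlg ⊗[ℂ] greenAlg →ₐ[ℂ] greenAlg := (Algebra.TensorProduct.lid ℂ
    greenAlg).toAlgHom.comp (Algebra.TensorProduct.map counitH (AlgHom.id ℂ greenAlg))
  have hl : ∀ x, (Algebra.ofId ℂ greenAlg).comp counitH x = m (inL x) := fun x => by
    rw [inL_apply]
    simp [m, Algebra.ofId_apply, Algebra.algebraMap_eq_smul_one]
  have hr : ∀ x, AlgHom.id ℂ greenAlg x = m (inR x) := fun x => by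
    rw [inR_apply]
    simp [m]
  have h : IsCoproduct (m.comp comulH) _ _ := isCoproduct_comulH.map m (fun _ => rfl) hl hr
  refine greenAlg_hom_ext' (fun k => ?_) fun j => ?_
  · exact (h.wave k).trans (by rw [unit_waveH rfl, unit_substC rfl, one_mul])
  · exact (h.coupling j).trans (by rw [unit_substC rfl])

theorem comulH_counit_right : ((Algebra.TensorProduct.rid ℂ ℂ greenAlg).toAlgHom.comp
    (Algebra.TensorProduct.map (AlgHom.id ℂ greenAlg) counitH)).comp comulH =
      AlgHom.id ℂ greenAlg := by
  let m : greenAlg ⊗[ℂ] greenAlg →ₐ[ℂ] greenAlg := (Algebra.TensorProduct.rid ℂ ℂ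
    greenAlg).toAlgHom.comp (Algebra.TensorProduct.map (AlgHom.id ℂ greenAlg) counitH)
  have hr : ∀ x, (Algebra.ofId ℂ greenAlg).comp counitH x = m (inR x) := fun x => by
    rw [inR_apply]
    simp [m, Algebra.ofId_apply, Algebra.algebraMap_eq_smul_one]
  have hl : ∀ x, AlgHom.id ℂ greenAlg x = m (inL x) := fun x => by
    rw [inL_apply]
    simp [m]
  have h : IsCoproduct (m.comp comulH) _ _ := isCoproduct_comulH.map m (fun _ => rfl) hl hr
  refine greenAlg_hom_ext' (fun k => ?_) fun j => ?_
  · exact (h.wave k).trans (by rw [unit_waveH rfl, map_one, mul_one])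
  · exact (h.coupling j).trans (by rw [unit_couplingH rfl, substC_couplingH])

end QCD

namespace QCD

/-! ## Antipodes of bialgebras that are locally nilpotent -/

section Antipode

variable {B : Type*} [CommRing B] [Bialgebra ℂ B]

variable (B) in
/-- The unit minus the identity, for the convolution product. -/
def convNil : WithConv (B →ₗ[ℂ] B) := 1 - WithConv.toConv LinearMap.id

theorem convNil_apply (x : B) :
    (convNil B).ofConv x = algebraMap ℂ B (Coalgebra.counit x) - x := rfl

/-- The values of the geometric series. -/
def geomSum (n : ℕ) : WithConv (B →ₗ[ℂ] B) := ∑ k ∈ Finset.range n, convNil B ^ k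

theorem geomSum_mul (n : ℕ) :
    geomSum n * WithConv.toConv (LinearMap.id : B →ₗ[ℂ] B) = 1 - convNil B ^ n := by
  have h : WithConv.toConv (LinearMap.id : B →ₗ[ℂ] B) = 1 - convNil B := by
    rw [convNil, sub_sub_cancel]
  rw [h]
  exact geom_sum_mul_neg _ _

theorem mul_geomSum (n : ℕ) :
    WithConv.toConv (LinearMap.id : B →ₗ[ℂ] B) * geomSum n = 1 - convNil B ^ n := by
  have h : WithConv.toConv (LinearMap.id : B →ₗ[ℂ] B) = 1 - convNil B := by
    rw [convNil, sub_sub_cancel]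
  rw [h]
  exact mul_neg_geom_sum _ _

theorem ofConv_geomSum (n : ℕ) (x : B) :
    (geomSum n).ofConv x = ∑ k ∈ Finset.range n, (convNil B ^ k).ofConv x := by
  rw [geomSum]
  induction n with
  | zero => rfl
  | succ n ih =>
    rw [Finset.sum_range_succ, Finset.sum_range_succ, ← ih]
    rfl

theorem geometric_finite (h : ∀ x : B, ∃ n, ∀ k, n ≤ k → (convNil B ^ k).ofConv x = 0) (x : B) :
    (Function.support fun k => (convNil B ^ k).ofConv x).Finite := by
  obtain ⟨n, hn⟩ := h x
  refine (Set.finite_lt_nat n).subset fun k hk => ?_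
  by_contra hkn
  exact hk (hn k (not_lt.mp hkn))

/-- The geometric series, if it is locally finite. -/
def geometric (h : ∀ x : B, ∃ n, ∀ k, n ≤ k → (convNil B ^ k).ofConv x = 0) : B →ₗ[ℂ] B where
  toFun x := ∑ᶠ k, (convNil B ^ k).ofConv x
  map_add' x y := by
    rw [← finsum_add_distrib (geometric_finite h x) (geometric_finite h y)]
    exact finsum_congr fun k => map_add _ _ _
  map_smul' a x := by
    rw [RingHom.id_apply, smul_finsum]
    exact finsum_congr fun k => map_smul _ _ _

variable (h : ∀ x : B, ∃ n, ∀ k, n ≤ k → (convNil B ^ k).ofConv x = 0)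

theorem geometric_apply (x : B) : ∃ n, ∀ m, n ≤ m → geometric h x = (geomSum m).ofConv x := by
  obtain ⟨n, hn⟩ := h x
  refine ⟨n, fun m hm => ?_⟩
  rw [ofConv_geomSum]
  refine finsum_eq_sum_of_support_subset _ fun k hk => ?_
  rw [Finset.coe_range]
  by_contra hkm
  exact hk (hn k (hm.trans (not_lt.mp hkm)))

/-- A tensor is a finite sum of pure tensors, so a single truncation of the series serves for all of
them. -/
theorem map_geometric (t : B ⊗[ℂ] B) : ∃ n, ∀ m, n ≤ m →
    TensorProduct.map (geometric h) LinearMap.id t =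
        TensorProduct.map (geomSum m).ofConv LinearMap.id t ∧
      TensorProduct.map LinearMap.id (geometric h) t =
        TensorProduct.map LinearMap.id (geomSum m).ofConv t := by
  induction t with
  | zero => exact ⟨0, fun m _ => by simp only [map_zero, and_self]⟩
  | tmul x y =>
    obtain ⟨a, ha⟩ := geometric_apply h x
    obtain ⟨b, hb⟩ := geometric_apply h y
    refine ⟨max a b, fun m hm => ?_⟩
    simp only [TensorProduct.map_tmul, ha m (le_of_max_le_left hm), hb m (le_of_max_le_right hm),
      and_self]
  | add s t hs ht =>
    obtain ⟨a, ha⟩ := hs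
    obtain ⟨b, hb⟩ := ht
    refine ⟨max a b, fun m hm => ?_⟩
    obtain ⟨a1, a2⟩ := ha m (le_of_max_le_left hm)
    obtain ⟨b1, b2⟩ := hb m (le_of_max_le_right hm)
    simp only [map_add, a1, a2, b1, b2, and_self]

/-- For a truncation with m terms the convolution with the identity is 1 minus the m-th power of
`convNil`. For m large enough this power vanishes on `x`. -/
theorem geometric_antipode (x : B) :
    LinearMap.mul' ℂ B (TensorProduct.map (geometric h) LinearMap.id (Coalgebra.comul x)) =
        algebraMap ℂ B (Coalgebra.counit x) ∧
      LinearMap.mul' ℂ B (TensorProduct.map LinearMap.id (geometric h) (Coalgebra.comul x)) =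
        algebraMap ℂ B (Coalgebra.counit x) := by
  obtain ⟨n, hn⟩ := map_geometric h (Coalgebra.comul x)
  obtain ⟨m, hm⟩ := h x
  obtain ⟨h1, h2⟩ := hn (max n m) (le_max_left _ _)
  have h3 := hm (max n m) (le_max_right _ _)
  rw [h1, h2]
  constructor
  · have h4 := congrArg (fun f => f.ofConv x) (geomSum_mul (B := B) (max n m))
    refine h4.trans ?_
    change algebraMap ℂ B (Coalgebra.counit x) - (convNil B ^ max n m).ofConv x = _
    rw [h3, sub_zero]
  · have h4 := congrArg (fun f => f.ofConv x) (mul_geomSum (B := B) (max n m))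
    refine h4.trans ?_
    change algebraMap ℂ B (Coalgebra.counit x) - (convNil B ^ max n m).ofConv x = _
    rw [h3, sub_zero]

theorem mul_map_mem {f g : B →ₗ[ℂ] B} {I J : Ideal B} (hf : ∀ x, f x ∈ I) (hg : ∀ x, g x ∈ J)
    (t : B ⊗[ℂ] B) : LinearMap.mul' ℂ B (TensorProduct.map f g t) ∈ I * J := by
  induction t with
  | zero => simp only [map_zero, Submodule.zero_mem]
  | tmul x y =>
    rw [TensorProduct.map_tmul, LinearMap.mul'_apply]
    exact Ideal.mul_mem_mul (hf x) (hg y)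
  | add s t hs ht =>
    rw [map_add, map_add]
    exact Submodule.add_mem _ hs ht

/-- One factor of the convolution takes values in the kernel of the counit, and convolution
multiplies the ideals in which values lie. -/
theorem convNil_pow_mem (k : ℕ) (x : B) :
    (convNil B ^ k).ofConv x ∈ RingHom.ker (Bialgebra.counitAlgHom ℂ B) ^ k := by
  induction k generalizing x with
  | zero => rw [pow_zero, pow_zero, Ideal.one_eq_top]; exact Submodule.mem_top
  | succ k ih =>
    rw [pow_succ, pow_succ]
    refine mul_map_mem ih (fun y => ?_) _
    rw [convNil_apply, RingHom.mem_ker, map_sub]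
    simp

theorem mul_map_comm {f g : B →ₗ[ℂ] B} {θ : B →ₐ[ℂ] B} (hf : ∀ x, θ (f x) = f (θ x))
    (hg : ∀ x, θ (g x) = g (θ x)) (t : B ⊗[ℂ] B) :
    θ (LinearMap.mul' ℂ B (TensorProduct.map f g t)) =
      LinearMap.mul' ℂ B (TensorProduct.map f g (Algebra.TensorProduct.map θ θ t)) := by
  induction t with
  | zero => simp only [map_zero]
  | tmul x y => simp [hf, hg]
  | add s t hs ht => simp only [map_add, hs, ht]

theorem convNil_pow_comm {θ : B →ₐ[ℂ] B} (hε : ∀ x, Coalgebra.counit (R := ℂ) (θ x) =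
    Coalgebra.counit x) (hΔ : ∀ x, Coalgebra.comul (R := ℂ) (θ x) =
      Algebra.TensorProduct.map θ θ (Coalgebra.comul x)) (k : ℕ) (x : B) :
    θ ((convNil B ^ k).ofConv x) = (convNil B ^ k).ofConv (θ x) := by
  induction k generalizing x with
  | zero =>
    rw [pow_zero]
    change θ (algebraMap ℂ B (Coalgebra.counit x)) = algebraMap ℂ B (Coalgebra.counit (θ x))
    rw [hε, AlgHom.commutes]
  | succ k ih =>
    rw [pow_succ]
    change θ (LinearMap.mul' ℂ B (TensorProduct.map _ _ (Coalgebra.comul x))) =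
      LinearMap.mul' ℂ B (TensorProduct.map _ _ (Coalgebra.comul (θ x)))
    rw [hΔ]
    refine mul_map_comm ih (fun y => ?_) _
    rw [convNil_apply, convNil_apply, map_sub, hε, AlgHom.commutes]

end Antipode

end QCD

namespace QCD

/-! ## The number of vertices of a graph with a vertex as residue -/

namespace FeynmanGraph

variable (Γ : FeynmanGraph)

/-- The internal half-edges of one type are paired off by `twin`, whose fixed points are the
external lines. -/
theorem card_etype_modEq (k : EdgeType) :
    Nat.card {h // Γ.etype h = k} ≡ Γ.extCount k [MOD 2] := by
  classical
  have := Fintype.ofFinite Γ.HE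
  let f : Function.End {h // Γ.etype h = k} :=
    fun h => ⟨Γ.twin h.1, (Γ.etype_twin h.1).trans h.2⟩
  -- The exponent is written as `2 ^ 1` because the congruence for fixed points is stated for a map
  -- with a prime power as exponent.
  have hf : f ^ 2 ^ 1 = 1 := by
    funext h
    exact Subtype.ext (Γ.twin_twin h.1)
  have h1 := Equiv.Perm.card_fixedPoints_modEq (p := 2) hf
  rw [← Nat.card_eq_fintype_card, ← Nat.card_eq_fintype_card] at h1
  convert h1 using 1
  exact Nat.card_congr ⟨fun h => ⟨⟨h.1, h.2.2⟩, Subtype.ext h.2.1⟩,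
    fun h => ⟨h.1.1, congrArg Subtype.val h.2, h.1.2⟩, fun _ => rfl, fun _ => rfl⟩

theorem extCount_le (k : EdgeType) : Γ.extCount k ≤ Nat.card {h // Γ.etype h = k} :=
  Nat.card_le_card_of_injective (fun h => ⟨h.1, h.2.2⟩) fun _ _ e =>
    Subtype.ext (Subtype.mk.inj e)

/-- A finite check: no vertex type arises from a different one by joining lines of equal type in
pairs. -/
theorem eq_of_vertexLegs : ∀ i j : VertexType,
    (∀ k, vertexLegs j k ≤ vertexLegs i k ∧ vertexLegs i k % 2 = vertexLegs j k % 2) → i = j := by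
  unfold vertexLegs
  decide

variable {Γ} in
-- With a single vertex, the external lines are what is left of its legs after some are joined in
-- pairs. By `eq_of_vertexLegs` none are joined, so there would be no internal edge.
theorem IsOnePI.two_le_card (h : Γ.IsOnePI) {j : VertexType}
    (hj : ∀ k, Γ.extCount k = vertexLegs j k) : 2 ≤ Nat.card Γ.V := by
  have hpos : 0 < Nat.card Γ.V := by
    have := h.connected.1
    exact Nat.card_pos
  by_contra hlt
  have hone : Nat.card Γ.V = 1 := by omega
  obtain ⟨hs, ⟨v⟩⟩ := Nat.card_eq_one_iff_unique.mp hone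
  have hcard : ∀ k, Nat.card {h // Γ.etype h = k} = vertexLegs (Γ.vtype v) k := fun k => by
    rw [← Γ.valence v k]
    exact Nat.card_congr ⟨fun x => ⟨x.1, Subsingleton.elim _ _, x.2⟩, fun x => ⟨x.1, x.2.2⟩,
      fun _ => rfl, fun _ => rfl⟩
  have hij : Γ.vtype v = j := eq_of_vertexLegs _ _ fun k => by
    rw [← hcard, ← hj]
    exact ⟨Γ.extCount_le k, Γ.card_etype_modEq k⟩
  obtain ⟨x, hx⟩ := h.not_tree
  have hb : Function.Bijective (fun h : {h // Γ.twin h = h ∧ Γ.etype h = Γ.etype x} =>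
      (⟨h.1, h.2.2⟩ : {h // Γ.etype h = Γ.etype x})) := by
    refine (Nat.bijective_iff_injective_and_card _).mpr ⟨fun _ _ e =>
      Subtype.ext (Subtype.mk.inj e), ?_⟩
    rw [hcard, hij]
    exact hj _
  obtain ⟨y, hy⟩ := hb.2 ⟨x, rfl⟩
  have hyx : y.1 = x := congrArg Subtype.val hy
  exact hx (hyx ▸ y.2.1)

end FeynmanGraph

/-! ## The grading by the number of vertices -/

/-- The number of vertices, minus one if the residue is a vertex. -/
def GraphClass.weight (g : GraphClass) : ℕ := g.vcount.degree - (shift g.res).degree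

/-- For an edge as residue one vertex suffices; a vertex as residue requires two, which is
`IsOnePI.two_le_card`. The inequality makes the subtraction in `weight` exact and the weight
positive. -/
theorem GraphClass.lt_vcount_degree (g : GraphClass) : (shift g.res).degree < g.vcount.degree := by
  have h1 : g.rep.res = g.res := rfl
  have h2 := g.rep.onePI
  have h3 := g.rep.legs_eq
  rw [h1] at h3
  unfold vcount
  rw [← FeynmanGraph.card_V]
  revert h3
  rcases g.res with k | j <;> intro h3
  · rw [shift, Sum.elim_inl, map_zero]
    have := h2.connected.1
    exact Nat.card_pos
  · rw [shift, Sum.elim_inr, Finsupp.degree_single]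
    exact h2.two_le_card (j := j) h3

theorem GraphClass.one_le_weight (g : GraphClass) : 1 ≤ g.weight :=
  Nat.sub_pos_of_lt g.lt_vcount_degree

/-- The weight of a monomial. -/
def monomialWeight (m : GraphClass →₀ ℕ) : ℕ := m.sum fun g k => k * g.weight

theorem degree_le_monomialWeight (m : GraphClass →₀ ℕ) : m.degree ≤ monomialWeight m :=
  Finset.sum_le_sum fun g _ => Nat.le_mul_of_pos_right _ g.one_le_weight

/-- Multiplication by `2` to the power of the weight. -/
def scaleCK : HCK →ₐ[ℂ] HCK := MvPolynomial.aeval fun g => (2 : ℂ) ^ g.weight • MvPolynomial.X g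

theorem scaleCK_monomial (m : GraphClass →₀ ℕ) (a : ℂ) :
    scaleCK (MvPolynomial.monomial m a) = (2 : ℂ) ^ monomialWeight m • MvPolynomial.monomial m a := by
  rw [scaleCK, MvPolynomial.aeval_monomial, MvPolynomial.monomial_eq, ← MvPolynomial.algebraMap_eq,
    ← mul_smul_comm]
  congr 1
  rw [Finsupp.prod, Finsupp.prod, monomialWeight, Finsupp.sum, ← Finset.prod_pow_eq_pow_sum,
    ← Finset.prod_smul]
  refine Finset.prod_congr rfl fun g _ => ?_
  rw [smul_pow, ← pow_mul, mul_comm]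

theorem coeff_scaleCK (p : HCK) (m : GraphClass →₀ ℕ) :
    MvPolynomial.coeff m (scaleCK p) = (2 : ℂ) ^ monomialWeight m * MvPolynomial.coeff m p := by
  classical
  induction p using MvPolynomial.induction_on' with
  | monomial u a =>
    rw [scaleCK_monomial, MvPolynomial.coeff_smul, MvPolynomial.coeff_monomial, smul_eq_mul]
    split_ifs with h
    · rw [h]
    · rw [mul_zero, mul_zero]
  | add p q hp hq => rw [map_add, MvPolynomial.coeff_add, hp, hq, MvPolynomial.coeff_add, mul_add]

theorem counitCK_scaleCK (p : HCK) : counitCK (scaleCK p) = counitCK p := by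
  have h : counitCK.comp scaleCK = counitCK := by
    refine MvPolynomial.algHom_ext fun g => ?_
    rw [AlgHom.comp_apply, scaleCK, MvPolynomial.aeval_X, map_smul, counitCK, MvPolynomial.aeval_X,
      smul_zero]
  exact DFunLike.congr_fun h p

theorem scaleCK_greenCoeff (r : Residue) (N : Fin 5 →₀ ℕ) :
    (2 : ℂ) ^ (shift r).degree • scaleCK (greenCoeff r N) =
      (2 : ℂ) ^ N.degree • greenCoeff r N := by
  rw [greenCoeff, map_sum, Finset.smul_sum, Finset.smul_sum]
  refine Finset.sum_congr rfl fun g hg => ?_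
  obtain ⟨h1, h2⟩ := mem_classes.mp hg
  have h3 := g.lt_vcount_degree
  rw [map_smul, scaleCK, MvPolynomial.aeval_X, smul_comm _ (g.sym⁻¹), smul_comm _ (g.sym⁻¹),
    smul_smul ((2 : ℂ) ^ _) ((2 : ℂ) ^ _), ← pow_add, GraphClass.weight, ← h1, ← h2, Nat.add_sub_cancel' h3.le]

section Dilation

variable {R S : Type*} [CommRing R] [CommRing S]

/-- The substitution of `2 λ` for `λ`. -/
def dil : MvPowerSeries (Fin 5) R →+* MvPowerSeries (Fin 5) R :=
  MvPowerSeries.rescale fun _ => 2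

theorem coeff_dil (M : Fin 5 →₀ ℕ) (f : MvPowerSeries (Fin 5) R) :
    MvPowerSeries.coeff M (dil f) = 2 ^ M.degree * MvPowerSeries.coeff M f := by
  rw [dil, MvPowerSeries.coeff_rescale, Finsupp.prod, Finset.prod_pow_eq_pow_sum]
  rfl

theorem constantCoeff_dil (f : MvPowerSeries (Fin 5) R) :
    MvPowerSeries.constantCoeff (dil f) = MvPowerSeries.constantCoeff f := by
  rw [← MvPowerSeries.coeff_zero_eq_constantCoeff_apply, coeff_dil, map_zero, pow_zero, one_mul,
    MvPowerSeries.coeff_zero_eq_constantCoeff_apply]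

theorem smap_dil [Algebra ℂ R] [Algebra ℂ S] (φ : R →ₐ[ℂ] S) (f : MvPowerSeries (Fin 5) R) :
    smap φ (dil f) = dil (smap φ f) := by
  ext M
  rw [coeff_smap, coeff_dil, coeff_dil, coeff_smap, map_mul, map_pow, map_ofNat]

theorem dil_eq (f : MvPowerSeries (Fin 5) R) : dil f =
    substHom (fun j => 2 * MvPowerSeries.X j) (fun j => by simp) f := by
  rw [dil, MvPowerSeries.rescale_eq_subst, substHom_apply]
  congr 1
  funext j
  simp [MvPowerSeries.smul_eq_C_mul, map_ofNat]

variable {c : Fin 5 → MvPowerSeries (Fin 5) R}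

theorem dil_substHom (hc : ∀ j, MvPowerSeries.constantCoeff (c j) = 0)
    (hc' : ∀ j, MvPowerSeries.constantCoeff (dil (c j)) = 0) (f : MvPowerSeries (Fin 5) R) :
    dil (substHom c hc f) = substHom (fun j => dil (c j)) hc' f := by
  rw [dil_eq, substHom_comp _ _ fun j => by rw [← dil_eq, hc']]
  exact substHom_congr (fun j => (dil_eq _).symm) f

theorem substHom_dil (hc : ∀ j, MvPowerSeries.constantCoeff (c j) = 0)
    (hc' : ∀ j, MvPowerSeries.constantCoeff (2 * c j) = 0) (f : MvPowerSeries (Fin 5) R) :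
    substHom c hc (dil f) = substHom (fun j => 2 * c j) hc' f := by
  have h : ∀ j, substHom c hc (2 * MvPowerSeries.X j) = 2 * c j := fun j => by
    rw [map_mul, map_ofNat, substHom_X]
  rw [dil_eq, substHom_comp _ _ fun j => by rw [h, hc']]
  exact substHom_congr h f

end Dilation

theorem scaleCK_coeff_greenSeries (r : Residue) (M : Fin 5 →₀ ℕ) :
    (2 : ℂ) ^ (shift r).degree • scaleCK (MvPowerSeries.coeff M (greenSeries r)) =
      (2 : ℂ) ^ M.degree • MvPowerSeries.coeff M (greenSeries r) := by
  classical
  rcases r with k | j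
  · rw [greenSeries, map_sub, coeff_graphSeries, map_sub, smul_sub, smul_sub, scaleCK_greenCoeff,
      MvPowerSeries.coeff_one, shift, Sum.elim_inl, map_zero, pow_zero, one_smul]
    split_ifs with h
    · rw [h, map_one, map_zero, pow_zero, one_smul, one_smul]
    · rw [map_zero, smul_zero]
  · rw [greenSeries, map_add, coeff_graphSeries, map_add, smul_add, smul_add, scaleCK_greenCoeff,
      MvPowerSeries.coeff_X]
    split_ifs with h
    · rw [h, map_one]
      rfl
    · rw [map_zero, smul_zero, smul_zero]

/-- The exponent is an integer because at `M = 0` it is negative for a vertex; the coefficient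
vanishes there. -/
theorem scaleCK_coeff_greenSeries' (r : Residue) (M : Fin 5 →₀ ℕ) :
    scaleCK (MvPowerSeries.coeff M (greenSeries r)) =
      (2 : ℂ) ^ ((M.degree : ℤ) - (shift r).degree) • MvPowerSeries.coeff M (greenSeries r) := by
  have h2 : (2 : ℂ) ^ (shift r).degree ≠ 0 := pow_ne_zero _ two_ne_zero
  rw [zpow_sub₀ two_ne_zero, zpow_natCast, zpow_natCast, div_eq_inv_mul, mul_smul,
    ← scaleCK_coeff_greenSeries, inv_smul_smul₀ h2]

theorem scaleCK_mem (x : greenAlg) : scaleCK x ∈ greenAlg := by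
  have h : greenAlg ≤ greenAlg.comap scaleCK := greenAlg_le fun r M => by
    rw [Subalgebra.mem_comap, scaleCK_coeff_greenSeries']
    exact greenAlg.smul_mem (coeff_greenSeries_mem r M) _
  exact h x.2

/-- `scaleCK` on `H`. -/
def scaleH : greenAlg →ₐ[ℂ] greenAlg := (scaleCK.comp greenAlg.val).codRestrict greenAlg scaleCK_mem

theorem scaleH_greenH (r : Residue) :
    2 ^ (shift r).degree * smap scaleH (greenH r) = dil (greenH r) := by
  ext1 M
  rw [coeff_dil]
  have h := scaleCK_coeff_greenSeries r M
  refine Subtype.ext (Eq.trans ?_ (h.trans ?_))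
  · rw [← MvPolynomial.C_mul', map_pow]
    have : (2 : MvPowerSeries (Fin 5) greenAlg) ^ (shift r).degree =
        MvPowerSeries.C (2 ^ (shift r).degree) := by rw [map_pow, map_ofNat]
    rw [this, MvPowerSeries.coeff_C_mul]
    rfl
  · rw [← MvPolynomial.C_mul', map_pow]
    rfl

theorem scaleH_waveH (k : EdgeType) : smap scaleH (waveH k) = dil (waveH k) := by
  refine eq_of_sq_eq_sq ?_ ?_ ?_
  · rw [constantCoeff_smap, constantCoeff_waveH, map_one]
  · rw [constantCoeff_dil, constantCoeff_waveH]
  · have h := scaleH_greenH (Sum.inl k)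
    rw [shift, Sum.elim_inl, map_zero, pow_zero, one_mul, ← waveH_sq, map_pow, map_pow] at h
    exact h

theorem scaleH_couplingH (j : VertexType) :
    2 * smap scaleH (couplingH j) = dil (couplingH j) := by
  have h := scaleH_greenH (Sum.inr j)
  rw [shift, Sum.elim_inr, Finsupp.degree_single, pow_one, ← coupling_mul_wave, map_mul,
    map_mul dil, map_prod, map_prod dil, ← mul_assoc] at h
  simp only [map_pow, scaleH_waveH] at h
  have hu : IsUnit (∏ k, dil (waveH k) ^ vertexLegs j k) := by
    have h1 : ∀ k, IsUnit (waveH k) := fun k =>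
      ⟨⟨waveH k, waveInvH k, waveH_mul_inv k, (mul_comm _ _).trans (waveH_mul_inv k)⟩, rfl⟩
    exact Finset.prod_induction _ IsUnit (fun _ _ => IsUnit.mul) isUnit_one
      fun k _ => ((h1 k).map dil).pow _
  exact hu.mul_right_cancel h

section ScaleCoproduct

variable {C : Type*} [CommRing C] [Algebra ℂ C] {δ l r δ' : greenAlg →ₐ[ℂ] C}

theorem smap_scaleH_waveH (l : greenAlg →ₐ[ℂ] C) (k : EdgeType) :
    smap (l.comp scaleH) (waveH k) = dil (smap l (waveH k)) := by
  rw [← smap_smap, scaleH_waveH, smap_dil]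

theorem smap_scaleH_couplingH (l : greenAlg →ₐ[ℂ] C) (j : VertexType) :
    2 * smap (l.comp scaleH) (couplingH j) = dil (smap l (couplingH j)) := by
  rw [← smap_dil, ← scaleH_couplingH, map_mul, map_ofNat, smap_smap]

theorem substC_scaleH (l : greenAlg →ₐ[ℂ] C) (f : MvPowerSeries (Fin 5) C) :
    substC (l.comp scaleH) (dil f) = dil (substC l f) := by
  have h : ∀ j, MvPowerSeries.constantCoeff (dil (smap l (couplingH j))) = 0 := fun j => by
    rw [constantCoeff_dil, constantCoeff_smap_couplingH]
  unfold substC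
  rw [dil_substHom _ h, substHom_dil _ fun j => by rw [smap_scaleH_couplingH, h]]
  exact substHom_congr (smap_scaleH_couplingH l) f

/-- Scaling by weight dilates the variables in the wave factors, and in the couplings too up to the
factor 2 for the bare coupling. Dilation is itself a substitution and is compatible with
substituting the couplings, so both maps agree on wave factors and couplings. -/
theorem IsCoproduct.scale (h : IsCoproduct δ l r)
    (h' : IsCoproduct δ' (l.comp scaleH) (r.comp scaleH)) : δ' = δ.comp scaleH := by
  refine greenAlg_hom_ext' (fun k => ?_) fun j => ?_
  · rw [h'.wave, smap_scaleH_waveH, smap_scaleH_waveH, substC_scaleH, smap_scaleH_waveH, h.wave,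
      map_mul]
  · have hu : IsUnit (2 : MvPowerSeries (Fin 5) C) := by
      have := (IsUnit.mk0 (2 : ℂ) two_ne_zero).map (algebraMap ℂ (MvPowerSeries (Fin 5) C))
      rwa [map_ofNat] at this
    refine hu.mul_left_cancel ?_
    have h2 : ∀ f, 2 * substC (l.comp scaleH) f = substC (l.comp scaleH) (2 * f) := fun f => by
      rw [map_mul, map_ofNat]
    rw [h'.coupling, h2, smap_scaleH_couplingH, smap_scaleH_couplingH, substC_scaleH, h.coupling]

end ScaleCoproduct

theorem comulH_scaleH (x : greenAlg) :
    comulH (scaleH x) = Algebra.TensorProduct.map scaleH scaleH (comulH x) := by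
  let m : greenAlg ⊗[ℂ] greenAlg →ₐ[ℂ] greenAlg ⊗[ℂ] greenAlg :=
    Algebra.TensorProduct.map scaleH scaleH
  have h : IsCoproduct (C := greenAlg ⊗[ℂ] greenAlg) (m.comp comulH) (inL.comp scaleH)
      (inR.comp scaleH) := by
    refine isCoproduct_comulH.map m (fun _ => rfl) (fun x => ?_) fun x => ?_
    · rw [inL_apply, AlgHom.comp_apply, inL_apply]
      simp [m]
    · rw [inR_apply, AlgHom.comp_apply, inR_apply]
      simp [m]
  exact (DFunLike.congr_fun (isCoproduct_comulH.scale h) x).symm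

theorem counitH_scaleH (x : greenAlg) : counitH (scaleH x) = counitH x := counitCK_scaleCK x

end QCD

namespace QCD

/-! ## The Hopf algebra -/

/-- `H` is spanned by elements of a given weight. -/
theorem greenAlg_induction {p : greenAlg → Prop}
    (eigen : ∀ (x : greenAlg) (n : ℤ), scaleH x = (2 : ℂ) ^ n • x → p x)
    (add : ∀ x y, p x → p y → p (x + y)) (smul : ∀ (a : ℂ) x, p x → p (a • x)) (x : greenAlg) :
    p x := by
  -- Eigenvalues multiply, so the eigenvectors of the scaling form a submonoid, and the algebra it
  -- generates is merely its linear span.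
  let E : Submonoid HCK :=
    { carrier := {y | y ∈ greenAlg ∧ ∃ n : ℤ, scaleCK y = (2 : ℂ) ^ n • y}
      one_mem' := ⟨greenAlg.one_mem, 0, by rw [map_one, zpow_zero, one_smul]⟩
      mul_mem' := by
        rintro y z ⟨hy, n, hn⟩ ⟨hz, m, hm⟩
        refine ⟨greenAlg.mul_mem hy hz, n + m, ?_⟩
        rw [map_mul, hn, hm, smul_mul_smul_comm, zpow_add₀ two_ne_zero] }
  have h1 : greenAlg ≤ Algebra.adjoin ℂ (E : Set HCK) := greenAlg_le fun r M =>
    Algebra.subset_adjoin ⟨coeff_greenSeries_mem r M, _, scaleCK_coeff_greenSeries' r M⟩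
  have h2 : (x : HCK) ∈ Submodule.span ℂ (E : Set HCK) := by
    have h3 : (x : HCK) ∈ Subalgebra.toSubmodule (Algebra.adjoin ℂ (E : Set HCK)) := h1 x.2
    rwa [Algebra.adjoin_eq_span, Submonoid.closure_eq] at h3
  have h4 : ∃ hx : (x : HCK) ∈ greenAlg, p ⟨x, hx⟩ := by
    refine Submodule.span_induction (p := fun y _ => ∃ hy : y ∈ greenAlg, p ⟨y, hy⟩) ?_ ?_ ?_ ?_ h2
    · rintro y ⟨hy, n, hn⟩
      exact ⟨hy, eigen ⟨y, hy⟩ n (Subtype.ext hn)⟩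
    · exact ⟨greenAlg.zero_mem, eigen 0 0 (by rw [map_zero, smul_zero])⟩
    · rintro y z - - ⟨hy, py⟩ ⟨hz, pz⟩
      exact ⟨greenAlg.add_mem hy hz, add _ _ py pz⟩
    · rintro a y - ⟨hy, py⟩
      exact ⟨greenAlg.smul_mem hy a, smul a _ py⟩
  exact h4.2

theorem counitCK_apply (p : HCK) : counitCK p = MvPolynomial.constantCoeff p := by
  rw [counitCK]
  exact MvPolynomial.aeval_zero' p

/-- The counit is the constant coefficient, so its kernel lies in the ideal generated by all graphs.
The k-th power of that ideal contains no monomial with fewer than k factors. -/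
theorem ker_counitH_pow {k : ℕ} {x : greenAlg} (hx : x ∈ RingHom.ker counitH ^ k)
    {m : GraphClass →₀ ℕ} (hm : m.degree < k) : MvPolynomial.coeff m (x : HCK) = 0 := by
  have h1 : RingHom.ker counitH ≤ (MvPolynomial.idealOfVars GraphClass ℂ).comap greenAlg.val :=
    fun y hy => by
      rw [Ideal.mem_comap, ← pow_one (MvPolynomial.idealOfVars GraphClass ℂ),
        MvPolynomial.mem_pow_idealOfVars_iff']
      intro u hu
      rw [Nat.lt_one_iff, Finsupp.degree_eq_zero_iff] at hu
      rw [hu]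
      exact (counitCK_apply _).symm.trans hy
  have h2 : greenAlg.val x ∈ MvPolynomial.idealOfVars GraphClass ℂ ^ k := by
    refine Ideal.pow_right_mono (Ideal.map_le_iff_le_comap.mpr h1) k ?_
    rw [← Ideal.map_pow]
    exact Ideal.mem_map_of_mem _ hx
  exact (MvPolynomial.mem_pow_idealOfVars_iff' _ _).mp h2 m hm

/-- A monomial in `x` has at least `k` factors, each of weight at least 1, so its weight is at least
`k`. But an eigenvector for 2^n contains only monomials of weight `n`, since distinct powers of 2
are different. -/
theorem eq_zero_of_scaleH {k : ℕ} {x : greenAlg} (hx : x ∈ RingHom.ker counitH ^ k) {n : ℤ}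
    (hn : scaleH x = (2 : ℂ) ^ n • x) (hk : n < k) : x = 0 := by
  refine Subtype.ext (MvPolynomial.ext _ _ fun m => ?_)
  rw [ZeroMemClass.coe_zero, MvPolynomial.coeff_zero]
  by_contra hne
  have h1 : k ≤ m.degree := not_lt.mp fun h => hne (ker_counitH_pow hx h)
  have h2 : scaleCK (x : HCK) = (2 : ℂ) ^ n • (x : HCK) := congrArg Subtype.val hn
  have h3 := congrArg (MvPolynomial.coeff m) h2
  rw [coeff_scaleCK, MvPolynomial.coeff_smul, smul_eq_mul, mul_left_inj' hne] at h3
  have h4 : ((monomialWeight m : ℕ) : ℤ) = n := by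
    -- The eigenvalues are compared as real numbers, where the exponent is recovered by injectivity.
    have h5 : (2 : ℝ) ^ ((monomialWeight m : ℕ) : ℤ) = (2 : ℝ) ^ n := by
      refine Complex.ofReal_injective ?_
      rw [Complex.ofReal_zpow, Complex.ofReal_zpow, zpow_natCast]
      exact h3
    exact zpow_right_injective₀ two_pos (by norm_num) h5
  have h6 := degree_le_monomialWeight m
  omega

/-- The bialgebra structure of `H`. -/
abbrev greenBialgebra : Bialgebra ℂ greenAlg :=
  Bialgebra.ofAlgHom comulH counitH comulH_coassoc
    (by
      have h := comulH_counit_left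
      ext x
      have h1 := DFunLike.congr_fun h x
      exact (AlgEquiv.eq_symm_apply _).mpr h1)
    (by
      have h := comulH_counit_right
      ext x
      have h1 := DFunLike.congr_fun h x
      exact (AlgEquiv.eq_symm_apply _).mpr h1)

theorem exists_antipode : ∃ S : greenAlg →ₗ[ℂ] greenAlg, IsHopfAlgebra comulH counitH S := by
  let _ := greenBialgebra
  have h : ∀ x : greenAlg, ∃ n, ∀ k, n ≤ k → (convNil greenAlg ^ k).ofConv x = 0 := by
    refine greenAlg_induction (fun x n hn => ?_) (fun x y hx hy => ?_) fun a x hx => ?_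
    -- The convolution powers commute with the scaling, hence preserve its eigenvalue, and they land
    -- in powers of the augmentation ideal. They vanish as soon as `k` exceeds the exponent `n`,
    -- which as an integer is not known to be non-negative here.
    · refine ⟨n.toNat + 1, fun k hk => eq_zero_of_scaleH (convNil_pow_mem k x) (n := n) ?_ ?_⟩
      · rw [convNil_pow_comm counitH_scaleH comulH_scaleH, hn, map_smul]
      · have := Int.self_le_toNat n
        omega
    · obtain ⟨a, ha⟩ := hx
      obtain ⟨b, hb⟩ := hy
      refine ⟨max a b, fun k hk => ?_⟩
      rw [map_add, ha k (le_of_max_le_left hk), hb k (le_of_max_le_right hk), add_zero]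
    · obtain ⟨n, hn⟩ := hx
      exact ⟨n, fun k hk => by rw [map_smul, hn k hk, smul_zero]⟩
  exact ⟨geometric h, DFunLike.congr_fun comulH_coassoc, DFunLike.congr_fun comulH_counit_left,
    DFunLike.congr_fun comulH_counit_right, fun x => (geometric_antipode h x).1,
    fun x => (geometric_antipode h x).2⟩

end QCD

namespace QCD

/-! ## Algebras graded by the numbers of fields -/

section Grading

variable {L : Type} [Ring L] [Algebra ℂ L]

/-- `x` is homogeneous of degree `u` for the grading given by the coaction `γ`. -/
def IsHomog (γ : L →ₐ[ℂ] L ⊗[ℂ] MvPolynomial EdgeType ℂ) (u : EdgeType →₀ ℕ) (x : L) : Prop :=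
  γ x = x ⊗ₜ MvPolynomial.monomial u 1

theorem IsHomog.one (γ : L →ₐ[ℂ] L ⊗[ℂ] MvPolynomial EdgeType ℂ) : IsHomog γ 0 1 := by
  rw [IsHomog, map_one, Algebra.TensorProduct.one_def]
  rfl

theorem IsHomog.mul {γ : L →ₐ[ℂ] L ⊗[ℂ] MvPolynomial EdgeType ℂ} {u v : EdgeType →₀ ℕ} {x y : L}
    (hx : IsHomog γ u x) (hy : IsHomog γ v y) : IsHomog γ (u + v) (x * y) := by
  rw [IsHomog, map_mul, hx, hy, Algebra.TensorProduct.tmul_mul_tmul, MvPolynomial.monomial_mul,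
    mul_one]

theorem IsHomog.add {γ : L →ₐ[ℂ] L ⊗[ℂ] MvPolynomial EdgeType ℂ} {u : EdgeType →₀ ℕ} {x y : L}
    (hx : IsHomog γ u x) (hy : IsHomog γ u y) : IsHomog γ u (x + y) := by
  rw [IsHomog, map_add, hx, hy, TensorProduct.add_tmul]

variable {P Q : Type*} [CommRing P] [CommRing Q]

/-- The product of powers of `W`. -/
def fieldPower (W : EdgeType → P) (u : EdgeType →₀ ℕ) : P := ∏ k, W k ^ u k

theorem map_fieldPower {F : Type*} [FunLike F P Q] [MonoidHomClass F P Q] (φ : F)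
    (W : EdgeType → P) (u : EdgeType →₀ ℕ) :
    φ (fieldPower W u) = fieldPower (fun k => φ (W k)) u := by
  simp only [fieldPower, map_prod, map_pow]

theorem fieldPower_mul (W W' : EdgeType → P) (u : EdgeType →₀ ℕ) :
    fieldPower (fun k => W k * W' k) u = fieldPower W u * fieldPower W' u := by
  simp only [fieldPower, mul_pow, Finset.prod_mul_distrib]

theorem fieldPower_one (u : EdgeType →₀ ℕ) : fieldPower (fun _ => (1 : P)) u = 1 := by
  simp only [fieldPower, one_pow, Finset.prod_const_one]

variable [Algebra ℂ P] [Algebra ℂ Q]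

theorem commute_includeRight (z : L ⊗[ℂ] P) (p : P) : Commute z (1 ⊗ₜ p) := by
  induction z with
  | zero => exact Commute.zero_left _
  | tmul x q =>
    rw [Commute, SemiconjBy, Algebra.TensorProduct.tmul_mul_tmul,
      Algebra.TensorProduct.tmul_mul_tmul, one_mul, mul_one, mul_comm]
  | add s t hs ht => exact hs.add_left ht

theorem aeval_monomial_eq (W : EdgeType → P) (u : EdgeType →₀ ℕ) :
    MvPolynomial.aeval W (MvPolynomial.monomial u (1 : ℂ)) = fieldPower W u := by
  rw [MvPolynomial.aeval_monomial, map_one, one_mul]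
  exact Finsupp.prod_fintype _ _ fun k => pow_zero _

/-- The algebra map that multiplies an element of degree `u` by the product `W^u`, and applies `T`
to the scalars. -/
def twist (γ : L →ₐ[ℂ] L ⊗[ℂ] MvPolynomial EdgeType ℂ) (W : EdgeType → P) (T : Q →ₐ[ℂ] P) :
    L ⊗[ℂ] Q →ₐ[ℂ] L ⊗[ℂ] P :=
  Algebra.TensorProduct.lift
    ((Algebra.TensorProduct.map (AlgHom.id ℂ L) (MvPolynomial.aeval W)).comp γ)
    (Algebra.TensorProduct.includeRight.comp T) fun _ _ => commute_includeRight _ _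

variable {γ : L →ₐ[ℂ] L ⊗[ℂ] MvPolynomial EdgeType ℂ}

theorem IsHomog.twist_tmul {u : EdgeType →₀ ℕ} {x : L} (hx : IsHomog γ u x) (W : EdgeType → P)
    (T : Q →ₐ[ℂ] P) (q : Q) : twist γ W T (x ⊗ₜ q) = x ⊗ₜ (fieldPower W u * T q) := by
  refine (Algebra.TensorProduct.lift_tmul _ _ _ x q).trans ?_
  rw [AlgHom.comp_apply, hx, Algebra.TensorProduct.map_tmul, aeval_monomial_eq, AlgHom.comp_apply,
    Algebra.TensorProduct.includeRight_apply, Algebra.TensorProduct.tmul_mul_tmul, mul_one,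
    AlgHom.id_apply]

theorem twist_one_tmul (W : EdgeType → P) (T : Q →ₐ[ℂ] P) (q : Q) :
    twist γ W T (1 ⊗ₜ q) = 1 ⊗ₜ T q := by
  rw [(IsHomog.one γ).twist_tmul, fieldPower]
  simp only [Finsupp.coe_zero, Pi.zero_apply, pow_zero, Finset.prod_const_one, one_mul]

/-- Linear maps on `L ⊗ Q` are determined by their values on homogeneous elements. -/
theorem homog_ext {M : Type*} [AddCommMonoid M] [Module ℂ M]
    (hγ : Submodule.span ℂ {x | ∃ u, IsHomog γ u x} = ⊤) {f g : L ⊗[ℂ] Q →ₗ[ℂ] M}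
    (h : ∀ u x, IsHomog γ u x → ∀ q, f (x ⊗ₜ q) = g (x ⊗ₜ q)) : f = g := by
  refine TensorProduct.ext (LinearMap.ext_on hγ ?_)
  rintro x ⟨u, hx⟩
  exact LinearMap.ext (h u x hx)

end Grading

/-! ## The coaction on a graded algebra -/

section Order

variable {R S : Type*} [CommRing R] [CommRing S]

theorem coeff_mul_eq_zero {k : ℕ} {f g : MvPowerSeries (Fin 5) R}
    (hf : ∀ m : Fin 5 →₀ ℕ, m.degree < k → MvPowerSeries.coeff m f = 0) (m : Fin 5 →₀ ℕ)
    (hm : m.degree < k) : MvPowerSeries.coeff m (g * f) = 0 := by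
  refine MvPowerSeries.coeff_of_lt_order (lt_of_lt_of_le ?_ MvPowerSeries.le_order_mul)
  exact (Nat.cast_lt.mpr hm).trans_le ((MvPowerSeries.nat_le_order hf).trans le_add_self)

theorem coeff_substHom_eq_zero {c : Fin 5 → MvPowerSeries (Fin 5) R}
    (hc : ∀ j, MvPowerSeries.constantCoeff (c j) = 0) {k : ℕ} {f : MvPowerSeries (Fin 5) R}
    (hf : ∀ m : Fin 5 →₀ ℕ, m.degree < k → MvPowerSeries.coeff m f = 0) (m : Fin 5 →₀ ℕ)
    (hm : m.degree < k) : MvPowerSeries.coeff m (substHom c hc f) = 0 := by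
  rw [substHom_apply]
  refine MvPowerSeries.coeff_of_lt_order (lt_of_lt_of_le ?_
    (MvPowerSeries.le_order_subst (MvPowerSeries.hasSubst_of_constantCoeff_zero hc) f))
  refine (Nat.cast_lt.mpr hm).trans_le ((MvPowerSeries.nat_le_order hf).trans ?_)
  refine le_mul_of_one_le_left' (le_iInf fun j => ?_)
  exact MvPowerSeries.one_le_order_iff_constCoeff_eq_zero.mpr (hc j)

variable [Algebra ℂ R] [Algebra ℂ S]
variable {L : Type} [Ring L] [Algebra ℂ L] {γ : L →ₐ[ℂ] L ⊗[ℂ] MvPolynomial EdgeType ℂ}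

theorem twist_mem_orderGE (hγ : Submodule.span ℂ {x | ∃ u, IsHomog γ u x} = ⊤)
    (W : EdgeType → MvPowerSeries (Fin 5) S)
    (T : MvPowerSeries (Fin 5) R →ₐ[ℂ] MvPowerSeries (Fin 5) S) {k : ℕ}
    (hT : ∀ f : MvPowerSeries (Fin 5) R, (∀ m : Fin 5 →₀ ℕ, m.degree < k →
      MvPowerSeries.coeff m f = 0) → ∀ m : Fin 5 →₀ ℕ, m.degree < k →
      MvPowerSeries.coeff m (T f) = 0) :
    ∀ z ∈ orderGE L R k, twist γ W T z ∈ orderGE L S k := by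
  intro z hz
  refine Submodule.span_induction (p := fun z _ => twist γ W T z ∈ orderGE L S k) ?_ ?_ ?_ ?_ hz
  · rintro _ ⟨x, f, hf, rfl⟩
    have hx : x ∈ Submodule.span ℂ {x | ∃ u, IsHomog γ u x} := hγ ▸ Submodule.mem_top
    refine Submodule.span_induction (p := fun x _ => twist γ W T (x ⊗ₜ f) ∈ orderGE L S k)
      ?_ ?_ ?_ ?_ hx
    · rintro y ⟨u, hy⟩
      rw [hy.twist_tmul]
      exact Submodule.subset_span ⟨y, _, coeff_mul_eq_zero (hT f hf), rfl⟩
    · rw [TensorProduct.zero_tmul, map_zero]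
      exact Submodule.zero_mem _
    · intro y z _ _ hy hz
      rw [TensorProduct.add_tmul, map_add]
      exact Submodule.add_mem _ hy hz
    · intro a y _ hy
      rw [← TensorProduct.smul_tmul', map_smul]
      exact Submodule.smul_mem _ _ hy
  · rw [map_zero]
    exact Submodule.zero_mem _
  · intro y z _ _ hy hz
    rw [map_add]
    exact Submodule.add_mem _ hy hz
  · intro a y _ hy
    rw [map_smul]
    exact Submodule.smul_mem _ _ hy

end Order

section Coaction

variable {L : Type} [Ring L] [Algebra ℂ L] {γ : L →ₐ[ℂ] L ⊗[ℂ] MvPolynomial EdgeType ℂ}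

/-- The substitution of the couplings in a series with coefficients in `R`. -/
def subCoupling {R C : Type*} [CommRing R] [Algebra ℂ R] [CommRing C] [Algebra ℂ C]
    (l : greenAlg →ₐ[ℂ] C) (r : R →ₐ[ℂ] C) :
    MvPowerSeries (Fin 5) R →ₐ[ℂ] MvPowerSeries (Fin 5) C :=
  ((substC l).restrictScalars ℂ).comp (smap r)

theorem subCoupling_apply {R C : Type*} [CommRing R] [Algebra ℂ R] [CommRing C] [Algebra ℂ C]
    (l : greenAlg →ₐ[ℂ] C) (r : R →ₐ[ℂ] C) (f : MvPowerSeries (Fin 5) R) :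
    subCoupling l r f = substC l (smap r f) := rfl

theorem coeff_subCoupling_eq_zero {R C : Type*} [CommRing R] [Algebra ℂ R] [CommRing C]
    [Algebra ℂ C] (l : greenAlg →ₐ[ℂ] C) (r : R →ₐ[ℂ] C) {k : ℕ} (f : MvPowerSeries (Fin 5) R)
    (hf : ∀ m : Fin 5 →₀ ℕ, m.degree < k → MvPowerSeries.coeff m f = 0) (m : Fin 5 →₀ ℕ)
    (hm : m.degree < k) : MvPowerSeries.coeff m (subCoupling l r f) = 0 :=
  coeff_substHom_eq_zero (constantCoeff_smap_couplingH l) (fun m hm => (coeff_smap r m f).trans (by rw [hf m hm, map_zero])) m hm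

/-- The coaction of `H` on `L ⊗ C[[λ]]`. -/
def coaction (γ : L →ₐ[ℂ] L ⊗[ℂ] MvPolynomial EdgeType ℂ) : Ext L ℂ →ₐ[ℂ] Ext L greenAlg :=
  twist γ waveH (subCoupling (AlgHom.id ℂ greenAlg) (Algebra.ofId ℂ greenAlg))

theorem coaction_coupling (j : VertexType) :
    coaction γ (1 ⊗ₜ MvPowerSeries.X j) = 1 ⊗ₜ couplingH j := by
  rw [coaction, twist_one_tmul, subCoupling_apply, smap_X, substC_couplingH]
  rfl

/-- On an element of degree `u` the first application multiplies by a power of the wave factors, and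
the second multiplies again and substitutes the couplings in what is there. The relations of
`IsCoproduct` for wave factors and for substitution say that the result is the coproduct applied to
coefficients. -/
theorem coaction_coassoc {C : Type*} [CommRing C] [Algebra ℂ C] {δ l r : greenAlg →ₐ[ℂ] C}
    (h : IsCoproduct δ l r) (hγ : Submodule.span ℂ {x | ∃ u, IsHomog γ u x} = ⊤) (z : Ext L ℂ) :
    twist γ (fun k => smap l (waveH k)) (subCoupling l r) (coaction γ z) =
      idTensor L δ (coaction γ z) := by
  have key : ((twist γ (fun k => smap l (waveH k)) (subCoupling l r)).comp
      (coaction γ)).toLinearMap = ((idTensor L δ).comp (coaction γ)).toLinearMap := by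
    refine homog_ext hγ fun u x hx q => ?_
    change twist γ _ _ (coaction γ (x ⊗ₜ q)) = idTensor L δ (coaction γ (x ⊗ₜ q))
    have h1 : subCoupling l r (fieldPower waveH u) =
        fieldPower (fun k => substC l (smap r (waveH k))) u := map_fieldPower _ _ _
    have h2 : smap δ (fieldPower waveH u) =
        fieldPower (fun k => smap l (waveH k) * substC l (smap r (waveH k))) u := by
      rw [map_fieldPower]
      simp only [h.wave]
    have h3 : subCoupling l r
        (subCoupling (AlgHom.id ℂ greenAlg) (Algebra.ofId ℂ greenAlg) q) =
        smap δ (subCoupling (AlgHom.id ℂ greenAlg) (Algebra.ofId ℂ greenAlg) q) := by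
      simp only [subCoupling_apply]
      rw [smap_substC, smap_substC, AlgHom.comp_id, AlgHom.comp_id, h.substC_eq, smap_smap,
        smap_smap]
      congr 4
      exact Subsingleton.elim _ _
    rw [coaction, hx.twist_tmul, hx.twist_tmul, idTensor, Algebra.TensorProduct.map_tmul,
      AlgHom.id_apply, map_mul, map_mul, h1, h2, h3, fieldPower_mul, mul_assoc]
  exact DFunLike.congr_fun key z

theorem coaction_counit (hγ : Submodule.span ℂ {x | ∃ u, IsHomog γ u x} = ⊤) (z : Ext L ℂ) :
    idTensor L counitH (coaction γ z) = z := by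
  have key : ((idTensor L counitH).comp (coaction γ)).toLinearMap = LinearMap.id := by
    refine homog_ext hγ fun u x hx q => ?_
    change idTensor L counitH (coaction γ (x ⊗ₜ q)) = x ⊗ₜ q
    have h1 : smap counitH (fieldPower waveH u) = 1 := by
      rw [map_fieldPower]
      simp only [counitH_waveH, fieldPower_one]
    have h2 : smap counitH
        (subCoupling (AlgHom.id ℂ greenAlg) (Algebra.ofId ℂ greenAlg) q) = q := by
      have h3 : counitH.comp (AlgHom.id ℂ greenAlg) = (Algebra.ofId ℂ ℂ).comp counitH :=
        AlgHom.ext fun _ => rfl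
      rw [subCoupling_apply, smap_substC, unit_substC h3]
      rw [smap_smap, Subsingleton.elim (counitH.comp (Algebra.ofId ℂ greenAlg)) (AlgHom.id ℂ ℂ),
        smap_id]
    rw [coaction, hx.twist_tmul, idTensor, Algebra.TensorProduct.map_tmul, AlgHom.id_apply,
      map_mul, h1, h2, one_mul]
  exact DFunLike.congr_fun key z

theorem twist_idTensor {C : Type*} [CommRing C] [Algebra ℂ C] (l r : greenAlg →ₐ[ℂ] C)
    (hγ : Submodule.span ℂ {x | ∃ u, IsHomog γ u x} = ⊤) (z : Ext L ℂ) :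
    twist γ (fun k => smap l (waveH k)) (subCoupling l r) (idTensor L (Algebra.ofId ℂ greenAlg) z) =
      idTensor L l (coaction γ z) := by
  have key : ((twist γ (fun k => smap l (waveH k)) (subCoupling l r)).comp
      (idTensor L (Algebra.ofId ℂ greenAlg))).toLinearMap =
      ((idTensor L l).comp (coaction γ)).toLinearMap := by
    refine homog_ext hγ fun u x hx q => ?_
    change twist γ _ _ (idTensor L (Algebra.ofId ℂ greenAlg) (x ⊗ₜ q)) =
      idTensor L l (coaction γ (x ⊗ₜ q))
    have h3 : subCoupling l r (smap (Algebra.ofId ℂ greenAlg) q) =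
        smap l (subCoupling (AlgHom.id ℂ greenAlg) (Algebra.ofId ℂ greenAlg) q) := by
      simp only [subCoupling_apply]
      rw [smap_substC, AlgHom.comp_id, smap_smap, smap_smap]
      congr 3
      exact Subsingleton.elim _ _
    rw [coaction, hx.twist_tmul, idTensor, idTensor, Algebra.TensorProduct.map_tmul,
      Algebra.TensorProduct.map_tmul, AlgHom.id_apply, hx.twist_tmul, map_mul, map_fieldPower, h3]
  exact DFunLike.congr_fun key z

theorem subCoupling_C {C : Type*} [CommRing C] [Algebra ℂ C] (l r : greenAlg →ₐ[ℂ] C)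
    (b : greenAlg) : subCoupling l r (MvPowerSeries.C b) = MvPowerSeries.C (r b) := by
  have h : smap r (MvPowerSeries.C b) = MvPowerSeries.C (r b) :=
    MvPowerSeries.map_C (r : greenAlg →+* C) b
  rw [subCoupling_apply, h]
  exact AlgHom.commutes (substC l) (r b)

end Coaction

section Comodule

variable {L : Type} [Ring L] [Algebra ℂ L] {B C : Type*} [CommRing B] [Algebra ℂ B] [CommRing C]
  [Algebra ℂ C]

theorem idTensor_idTensor {D : Type*} [CommRing D] [Algebra ℂ D] (f : B →ₐ[ℂ] C) (g : C →ₐ[ℂ] D)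
    (z : Ext L B) : idTensor L g (idTensor L f z) = idTensor L (g.comp f) z := by
  induction z using TensorProduct.induction_on with
  | zero => simp only [map_zero]
  | tmul x q => rfl
  | add s t hs ht => simp only [map_add, hs, ht]

theorem idTensor_mem_orderGE (f : B →ₐ[ℂ] C) (k : ℕ) :
    ∀ z ∈ orderGE L B k, idTensor L f z ∈ orderGE L C k := by
  intro z hz
  refine Submodule.span_induction (p := fun z _ => idTensor L f z ∈ orderGE L C k) ?_ ?_ ?_ ?_ hz
  · rintro _ ⟨x, q, hq, rfl⟩
    exact Submodule.subset_span ⟨x, smap f q, fun m hm => by rw [coeff_smap, hq m hm, map_zero],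
      rfl⟩
  · rw [map_zero]
    exact Submodule.zero_mem _
  · intro y z _ _ hy hz
    rw [map_add]
    exact Submodule.add_mem _ hy hz
  · intro a y _ hy
    rw [map_smul]
    exact Submodule.smul_mem _ _ hy

/-- A criterion for comodule algebras, where the tensor square of `B` is given by `C`. -/
theorem isComoduleAlgebra_of_tensorSquare {Δ : B →ₐ[ℂ] B ⊗[ℂ] B} {ε : B →ₐ[ℂ] ℂ}
    {ρ : Ext L ℂ →ₐ[ℂ] Ext L B} {ρ₂ : Ext L B →ₐ[ℂ] Ext L C} {e : C →ₐ[ℂ] B ⊗[ℂ] B}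
    {l r δ : B →ₐ[ℂ] C} (hl : ∀ b, e (l b) = b ⊗ₜ 1) (hr : ∀ b, e (r b) = 1 ⊗ₜ b)
    (hδ : ∀ b, e (δ b) = Δ b) (continuous : ∀ k, ∀ z ∈ orderGE L ℂ k, ρ z ∈ orderGE L B k)
    (counit : ∀ z, idTensor L ε (ρ z) = z)
    (extend : ∀ z, ρ₂ (idTensor L (Algebra.ofId ℂ B) z) = idTensor L l (ρ z))
    (scalar : ∀ b : B, ρ₂ (1 ⊗ₜ MvPowerSeries.C b) = 1 ⊗ₜ MvPowerSeries.C (r b))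
    (continuous₂ : ∀ k, ∀ z ∈ orderGE L B k, ρ₂ z ∈ orderGE L C k)
    (coassoc : ∀ z, ρ₂ (ρ z) = idTensor L δ (ρ z)) : IsComoduleAlgebra Δ ε ρ where
  continuous := continuous
  counit := counit
  coassoc := by
    have hl' : e.comp l = Algebra.TensorProduct.includeLeft := AlgHom.ext hl
    have hδ' : e.comp δ = Δ := AlgHom.ext hδ
    refine ⟨(idTensor L e).comp ρ₂, ⟨fun z => ?_, fun b => ?_, fun k z hz => ?_⟩, fun z => ?_⟩
    · rw [AlgHom.comp_apply, extend, idTensor_idTensor, hl']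
    · rw [AlgHom.comp_apply, scalar]
      have h : smap e (MvPowerSeries.C (r b)) = MvPowerSeries.C (e (r b)) :=
        MvPowerSeries.map_C (e : C →+* B ⊗[ℂ] B) (r b)
      rw [← hr, ← h]
      rfl
    · exact idTensor_mem_orderGE e k _ (continuous₂ k z hz)
    · rw [AlgHom.comp_apply, coassoc, idTensor_idTensor, hδ']

variable {γ : L →ₐ[ℂ] L ⊗[ℂ] MvPolynomial EdgeType ℂ}

/-- The extension that is the identity on the last factor is again a twist: new wave factors and
couplings come from `l`, while the coefficients already present are moved by `r`. -/
theorem exists_coaction_extend {δ l r : greenAlg →ₐ[ℂ] C} (h : IsCoproduct δ l r)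
    (hγ : Submodule.span ℂ {x | ∃ u, IsHomog γ u x} = ⊤) :
    ∃ ρ₂ : Ext L greenAlg →ₐ[ℂ] Ext L C,
      (∀ z, ρ₂ (idTensor L (Algebra.ofId ℂ greenAlg) z) = idTensor L l (coaction γ z)) ∧
      (∀ b : greenAlg, ρ₂ (1 ⊗ₜ MvPowerSeries.C b) = 1 ⊗ₜ MvPowerSeries.C (r b)) ∧
      (∀ k, ∀ z ∈ orderGE L greenAlg k, ρ₂ z ∈ orderGE L C k) ∧
      ∀ z, ρ₂ (coaction γ z) = idTensor L δ (coaction γ z) :=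
  ⟨twist γ (fun k => smap l (waveH k)) (subCoupling l r), twist_idTensor l r hγ,
    fun b => by rw [twist_one_tmul, subCoupling_C],
    fun _ => twist_mem_orderGE hγ _ _ (coeff_subCoupling_eq_zero _ _), coaction_coassoc h hγ⟩

/-- The coaction on a graded algebra makes it a comodule algebra. -/
theorem coaction_isComoduleAlgebra (hγ : Submodule.span ℂ {x | ∃ u, IsHomog γ u x} = ⊤) :
    IsComoduleAlgebra comulH counitH (coaction γ) := by
  obtain ⟨ρ₂, h1, h2, h3, h4⟩ :=
    exists_coaction_extend (C := greenAlg ⊗[ℂ] greenAlg) isCoproduct_comulH hγ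
  exact isComoduleAlgebra_of_tensorSquare (C := greenAlg ⊗[ℂ] greenAlg) (e := AlgHom.id ℂ _)
    (fun _ => rfl) (fun _ => rfl) (fun _ => rfl)
    (fun _ => twist_mem_orderGE hγ _ _ (coeff_subCoupling_eq_zero _ _)) (coaction_counit hγ)
    h1 h2 h3 h4

end Comodule

end QCD

namespace QCD

/-! ## The numbers of fields in a density and in a local functional -/

/-- The degree of a field. -/
def Field.degree (φ : Field) : EdgeType →₀ ℕ := φ.edge.elim 0 fun k => Finsupp.single k 1

theorem fieldPower_degree (wave : EdgeType → MvPowerSeries (Fin 5) greenAlg) (φ : Field) :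
    fieldPower wave φ.degree = fieldFactor wave φ := by
  unfold fieldPower Field.degree fieldFactor
  cases φ.edge with
  | none => simp
  | some k =>
    rw [Option.elim_some, Option.elim_some, Finset.prod_eq_single k]
    · rw [Finsupp.single_eq_same, pow_one]
    · intro b _ hb
      rw [Finsupp.single_eq_of_ne hb, pow_zero]
    · exact fun h => absurd (Finset.mem_univ k) h

/-- The grading of `Density` by the numbers of fields. -/
def densityGrading : Density →ₐ[ℂ] Density ⊗[ℂ] MvPolynomial EdgeType ℂ :=
  RingQuot.liftAlgHom ℂ ⟨FreeAlgebra.lift ℂ fun x : Jet =>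
    Density.jet x ⊗ₜ MvPolynomial.monomial x.field.degree 1, by
      rintro _ _ ⟨x, y⟩
      rw [map_mul, map_smul, map_mul, FreeAlgebra.lift_ι_apply, FreeAlgebra.lift_ι_apply,
        Algebra.TensorProduct.tmul_mul_tmul, Algebra.TensorProduct.tmul_mul_tmul,
        Density.jet_comm, TensorProduct.smul_tmul', mul_comm (MvPolynomial.monomial _ _)]⟩

theorem isHomog_jet (x : Jet) : IsHomog densityGrading x.field.degree (Density.jet x) := by
  rw [IsHomog, densityGrading, Density.jet, RingQuot.liftAlgHom_mkAlgHom_apply,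
    FreeAlgebra.lift_ι_apply]
  rfl

/-- A density that is homogeneous, together with its derivatives. -/
def IsHomogDensity (u : EdgeType →₀ ℕ) (x : Density) : Prop :=
  IsHomog densityGrading u x ∧ ∀ μ, IsHomog densityGrading u (Density.deriv μ x)

theorem Density.deriv_one (μ : Fin 4) : Density.deriv μ 1 = 0 := by
  have h := Density.deriv_mul μ 1 1
  rw [mul_one, mul_one, one_mul] at h
  exact left_eq_add.mp h

theorem isHomogDensity_jet (x : Jet) : IsHomogDensity x.field.degree (Density.jet x) := by
  refine ⟨isHomog_jet x, fun μ => ?_⟩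
  rw [Density.deriv_jet]
  exact isHomog_jet (x.succ μ)

theorem isHomogDensity_one : IsHomogDensity 0 1 := by
  refine ⟨IsHomog.one _, fun μ => ?_⟩
  rw [Density.deriv_one, IsHomog, map_zero, TensorProduct.zero_tmul]

/-- Homogeneity of the derivatives is carried along because it then follows for products from the
Leibniz rule, in which both terms have the same degree. -/
theorem IsHomogDensity.mul {u v : EdgeType →₀ ℕ} {x y : Density} (hx : IsHomogDensity u x)
    (hy : IsHomogDensity v y) : IsHomogDensity (u + v) (x * y) := by
  refine ⟨hx.1.mul hy.1, fun μ => ?_⟩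
  rw [Density.deriv_mul]
  exact (hx.1.mul (hy.2 μ)).add ((hx.2 μ).mul hy.1)

theorem isHomogDensity_word (w : List Jet) :
    ∃ u, IsHomogDensity u (w.map Density.jet).prod := by
  induction w with
  | nil => exact ⟨0, isHomogDensity_one⟩
  | cons x w ih =>
    obtain ⟨u, hu⟩ := ih
    rw [List.map_cons, List.prod_cons]
    exact ⟨_, (isHomogDensity_jet x).mul hu⟩

/-- An algebra with a submonoid of homogeneous elements that generates it. -/
theorem span_eq_top_of_adjoin {A : Type*} [Ring A] [Algebra ℂ A] {s : Set A} {E : Submonoid A}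
    (hs : Algebra.adjoin ℂ s = ⊤) (h : s ⊆ E) : Submodule.span ℂ (E : Set A) = ⊤ := by
  refine top_le_iff.mp ?_
  rw [← Algebra.top_toSubmodule, ← hs, Algebra.adjoin_eq_span]
  exact Submodule.span_mono (Submonoid.closure_le.mpr h)

theorem adjoin_jet : Algebra.adjoin ℂ (Set.range Density.jet) = ⊤ := by
  have h1 : Set.range Density.jet =
      RingQuot.mkAlgHom ℂ DensityRel '' Set.range (FreeAlgebra.ι ℂ) := by
    rw [← Set.range_comp]
    rfl
  rw [h1, ← AlgHom.map_adjoin, FreeAlgebra.adjoin_range_ι, Algebra.map_top]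
  exact (AlgHom.range_eq_top _).mpr (RingQuot.mkAlgHom_surjective ℂ DensityRel)

theorem span_isHomogDensity : Submodule.span ℂ {x | ∃ u, IsHomogDensity u x} = ⊤ :=
  span_eq_top_of_adjoin (E :=
    { carrier := {x | ∃ u, IsHomogDensity u x}
      one_mem' := ⟨0, isHomogDensity_one⟩
      mul_mem' := fun ⟨_, hx⟩ ⟨_, hy⟩ => ⟨_, hx.mul hy⟩ }) adjoin_jet
    (Set.range_subset_iff.mpr fun x => ⟨_, isHomogDensity_jet x⟩)

theorem span_isHomog_density : Submodule.span ℂ {x | ∃ u, IsHomog densityGrading u x} = ⊤ :=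
  top_le_iff.mp (span_isHomogDensity ▸ Submodule.span_mono fun _ ⟨u, hu⟩ => ⟨u, hu.1⟩)

theorem integral_deriv (μ : Fin 4) (x : Density) : integral (Density.deriv μ x) = 0 := by
  have h : (Submodule.mkQ (⨆ μ, LinearMap.range (Density.deriv μ))) (Density.deriv μ x) = 0 :=
    (Submodule.Quotient.mk_eq_zero _).mpr (Submodule.mem_iSup_of_mem μ ⟨x, rfl⟩)
  change RingQuot.mkAlgHom ℂ LocRel (TensorAlgebra.ι ℂ (Submodule.mkQ _ _)) = 0
  rw [h, map_zero, map_zero]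

/-- The integral of a density, with its grading. -/
def densityIntegral : Density →ₗ[ℂ] Loc ⊗[ℂ] MvPolynomial EdgeType ℂ :=
  integral.rTensor (MvPolynomial EdgeType ℂ) ∘ₗ densityGrading.toLinearMap

theorem IsHomog.densityIntegral {u : EdgeType →₀ ℕ} {x : Density}
    (hx : IsHomog densityGrading u x) :
    densityIntegral x = integral x ⊗ₜ MvPolynomial.monomial u 1 := by
  change integral.rTensor (MvPolynomial EdgeType ℂ) (densityGrading x) = _
  rw [hx, LinearMap.rTensor_tmul]

/-- A derivative of a homogeneous density is homogeneous of the same degree, and its integral is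
zero. Therefore the grading by numbers of fields descends to integrals. -/
theorem densityIntegral_deriv (μ : Fin 4) (x : Density) :
    densityIntegral (Density.deriv μ x) = 0 := by
  have h : densityIntegral ∘ₗ Density.deriv μ = 0 := by
    refine LinearMap.ext_on span_isHomogDensity ?_
    rintro y ⟨u, hy⟩
    rw [LinearMap.comp_apply, (hy.2 μ).densityIntegral, integral_deriv, TensorProduct.zero_tmul]
    rfl
  exact DFunLike.congr_fun h x

theorem totalDerivatives_le_ker :
    (⨆ μ, LinearMap.range (Density.deriv μ)) ≤ LinearMap.ker densityIntegral := by
  refine iSup_le fun μ => ?_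
  rintro _ ⟨x, rfl⟩
  exact LinearMap.mem_ker.mpr (densityIntegral_deriv μ x)

/-- The grading of integrals. -/
def gradedIntegral : Integrals →ₗ[ℂ] Loc ⊗[ℂ] MvPolynomial EdgeType ℂ :=
  Submodule.liftQ (M₂ := Loc ⊗[ℂ] MvPolynomial EdgeType ℂ) (τ₁₂ := RingHom.id ℂ)
    (⨆ μ, LinearMap.range (Density.deriv μ)) densityIntegral totalDerivatives_le_ker

theorem gradedIntegral_word (w : List Jet) : ∃ u, gradedIntegral (Integrals.word w) =
    integral (w.map Density.jet).prod ⊗ₜ MvPolynomial.monomial u 1 := by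
  obtain ⟨u, hu⟩ := isHomogDensity_word w
  refine ⟨u, ?_⟩
  exact hu.1.densityIntegral

theorem integral_comm (w w' : List Jet) :
    integral (w.map Density.jet).prod * integral (w'.map Density.jet).prod =
      koszul (wordDegree w) (wordDegree w') •
        (integral (w'.map Density.jet).prod * integral (w.map Density.jet).prod) := by
  have h := RingQuot.mkAlgHom_rel ℂ (LocRel.comm w w')
  rw [map_mul, map_smul, map_mul] at h
  exact h

/-- The grading of `Loc` by the numbers of fields. -/
def locGrading : Loc →ₐ[ℂ] Loc ⊗[ℂ] MvPolynomial EdgeType ℂ :=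
  RingQuot.liftAlgHom ℂ ⟨TensorAlgebra.lift ℂ gradedIntegral, by
    rintro _ _ ⟨w, w'⟩
    obtain ⟨u, hu⟩ := gradedIntegral_word w
    obtain ⟨v, hv⟩ := gradedIntegral_word w'
    rw [map_mul, map_smul, map_mul, TensorAlgebra.lift_ι_apply, TensorAlgebra.lift_ι_apply, hu, hv,
      Algebra.TensorProduct.tmul_mul_tmul, Algebra.TensorProduct.tmul_mul_tmul, integral_comm,
      TensorProduct.smul_tmul', mul_comm (MvPolynomial.monomial _ _)]⟩

theorem IsHomogDensity.integral {u : EdgeType →₀ ℕ} {x : Density} (hx : IsHomogDensity u x) :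
    IsHomog locGrading u (integral x) := by
  change RingQuot.liftAlgHom ℂ _ (RingQuot.mkAlgHom ℂ LocRel (TensorAlgebra.ι ℂ _)) = _
  rw [RingQuot.liftAlgHom_mkAlgHom_apply, TensorAlgebra.lift_ι_apply]
  exact hx.1.densityIntegral

theorem adjoin_integral : Algebra.adjoin ℂ (Set.range integral) = ⊤ := by
  have h1 : Set.range integral =
      RingQuot.mkAlgHom ℂ LocRel '' Set.range (TensorAlgebra.ι ℂ (M := Integrals)) := by
    rw [← Set.range_comp]
    exact (Submodule.mkQ_surjective _).range_comp (RingQuot.mkAlgHom ℂ LocRel ∘ TensorAlgebra.ι ℂ)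
  rw [h1, ← AlgHom.map_adjoin, TensorAlgebra.adjoin_range_ι, Algebra.map_top]
  exact (AlgHom.range_eq_top _).mpr (RingQuot.mkAlgHom_surjective ℂ LocRel)

theorem span_isHomog_loc : Submodule.span ℂ {x | ∃ u, IsHomog locGrading u x} = ⊤ := by
  refine span_eq_top_of_adjoin (s := integral '' {x | ∃ u, IsHomogDensity u x}) (E :=
    { carrier := {x | ∃ u, IsHomog locGrading u x}
      one_mem' := ⟨0, IsHomog.one _⟩
      mul_mem' := fun ⟨_, hx⟩ ⟨_, hy⟩ => ⟨_, hx.mul hy⟩ }) ?_ ?_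
  · refine top_le_iff.mp ?_
    rw [← adjoin_integral]
    refine Algebra.adjoin_le ?_
    have h1 : Submodule.span ℂ (integral '' {x | ∃ u, IsHomogDensity u x}) =
        LinearMap.range integral := by
      rw [Submodule.span_image, span_isHomogDensity, Submodule.map_top]
    rintro _ ⟨x, rfl⟩
    have h2 : integral x ∈ Submodule.span ℂ (integral '' {x | ∃ u, IsHomogDensity u x}) :=
      h1 ▸ ⟨x, rfl⟩
    exact Algebra.span_le_adjoin ℂ _ h2
  · rintro _ ⟨x, ⟨u, hu⟩, rfl⟩
    exact ⟨u, hu.integral⟩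

/-! ## The coaction on fields and on local functionals -/

theorem coaction_field (φ : Field) : coaction densityGrading (Density.jet ⟨φ, 0⟩ ⊗ₜ 1) =
    Density.jet ⟨φ, 0⟩ ⊗ₜ fieldFactor waveH φ := by
  rw [coaction, (isHomog_jet ⟨φ, 0⟩).twist_tmul, map_one, mul_one, fieldPower_degree]

/-- A density and its derivative have the same numbers of fields, so both are multiplied by the same
wave factors, and these do not depend on spacetime. -/
theorem coaction_deriv (μ : Fin 4) (z : Ext Density ℂ) :
    coaction densityGrading ((Density.deriv μ).rTensor _ z) =
      (Density.deriv μ).rTensor _ (coaction densityGrading z) := by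
  have key : (coaction densityGrading).toLinearMap ∘ₗ (Density.deriv μ).rTensor _ =
      (Density.deriv μ).rTensor _ ∘ₗ (coaction densityGrading).toLinearMap := by
    refine TensorProduct.ext (LinearMap.ext_on span_isHomogDensity ?_)
    rintro x ⟨u, hx⟩
    refine LinearMap.ext fun q => ?_
    change coaction densityGrading ((Density.deriv μ).rTensor _ (x ⊗ₜ q)) =
      (Density.deriv μ).rTensor _ (coaction densityGrading (x ⊗ₜ q))
    rw [LinearMap.rTensor_tmul, coaction, (hx.2 μ).twist_tmul, hx.1.twist_tmul,
      LinearMap.rTensor_tmul]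
  exact DFunLike.congr_fun key z

theorem coaction_integral (z : Ext Density ℂ) :
    coaction locGrading (integral.rTensor _ z) =
      integral.rTensor _ (coaction densityGrading z) := by
  have key : (coaction locGrading).toLinearMap ∘ₗ integral.rTensor _ =
      integral.rTensor _ ∘ₗ (coaction densityGrading).toLinearMap := by
    refine TensorProduct.ext (LinearMap.ext_on span_isHomogDensity ?_)
    rintro x ⟨u, hx⟩
    refine LinearMap.ext fun q => ?_
    change coaction locGrading (integral.rTensor _ (x ⊗ₜ q)) =
      integral.rTensor _ (coaction densityGrading (x ⊗ₜ q))
    rw [LinearMap.rTensor_tmul, coaction, coaction, hx.integral.twist_tmul, hx.1.twist_tmul,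
      LinearMap.rTensor_tmul]
  exact DFunLike.congr_fun key z

theorem coupling_isExpansion (j : VertexType) :
    IsExpansion (Finsupp.single j 1) (Yv j) (couplingH j) :=
  (expands_Yv j).toIsExpansion fun M =>
    congrArg (fun f => toHat (MvPowerSeries.coeff M f)) (val_couplingH j)

theorem wave_isExpansion (k : EdgeType) : IsExpansion 0 (sqrtG k) (waveH k) :=
  (expands_sqrt k).toIsExpansion fun M =>
    congrArg (fun f => toHat (MvPowerSeries.coeff M f)) (val_waveH k)

end QCD

end

theorem mainTheorem2 :
    ∃ (Δ : QCD.greenAlg →ₐ[ℂ] QCD.greenAlg ⊗[ℂ] QCD.greenAlg)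
      (S : QCD.greenAlg →ₗ[ℂ] QCD.greenAlg),
      -- the coproduct and counit of `H_CK` make `H` a Hopf algebra
      (∀ x, Algebra.TensorProduct.map QCD.greenAlg.val QCD.greenAlg.val (Δ x) =
        QCD.comulCK (x : QCD.HCK)) ∧
      QCD.IsHopfAlgebra Δ QCD.counitH S ∧
      ∃ (coupling : QCD.VertexType → MvPowerSeries (Fin 5) QCD.greenAlg)
        (wave : QCD.EdgeType → MvPowerSeries (Fin 5) QCD.greenAlg)
        -- the coaction on polynomials in the fields and on local functionals
        (ρ₀ : QCD.Ext QCD.Density ℂ →ₐ[ℂ] QCD.Ext QCD.Density QCD.greenAlg)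
        (ρ : QCD.Ext QCD.Loc ℂ →ₐ[ℂ] QCD.Ext QCD.Loc QCD.greenAlg),
        (∀ j, QCD.IsExpansion (Finsupp.single j 1) (QCD.Yv j) (coupling j)) ∧
        (∀ i, QCD.IsExpansion 0 (QCD.sqrtG i) (wave i)) ∧
        QCD.IsComoduleAlgebra Δ QCD.counitH ρ₀ ∧
        QCD.IsComoduleAlgebra Δ QCD.counitH ρ ∧
        (∀ j, ρ₀ (1 ⊗ₜ MvPowerSeries.X j) = 1 ⊗ₜ coupling j) ∧
        (∀ j, ρ (1 ⊗ₜ MvPowerSeries.X j) = 1 ⊗ₜ coupling j) ∧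
        (∀ φ : QCD.Field, ρ₀ (QCD.Density.jet ⟨φ, 0⟩ ⊗ₜ 1) =
          QCD.Density.jet ⟨φ, 0⟩ ⊗ₜ QCD.fieldFactor wave φ) ∧
        (∀ μ z, ρ₀ ((QCD.Density.deriv μ).rTensor _ z) =
          (QCD.Density.deriv μ).rTensor _ (ρ₀ z)) ∧
        (∀ z, ρ (QCD.integral.rTensor _ z) = QCD.integral.rTensor _ (ρ₀ z)) := by
  obtain ⟨S, hS⟩ := QCD.exists_antipode
  exact ⟨QCD.comulH, S, QCD.valTensor_comulH, hS, QCD.couplingH, QCD.waveH,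
    QCD.coaction QCD.densityGrading, QCD.coaction QCD.locGrading, QCD.coupling_isExpansion,
    QCD.wave_isExpansion, QCD.coaction_isComoduleAlgebra QCD.span_isHomog_density,
    QCD.coaction_isComoduleAlgebra QCD.span_isHomog_loc, QCD.coaction_coupling,
    QCD.coaction_coupling, QCD.coaction_field, QCD.coaction_deriv, QCD.coaction_integral⟩
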